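/- A chore division instance consists of $n\ge 1$ agents, $m\ge 0$ indivisible chores and disutilities $d_{ij}>0$ of each chore $j$ for each agent $i$; the disutility of a set $S$ of chores for agent $i$ is $d_i(S)=\sum_{j\in S}d_{ij}$. An allocation $X=(X_1,\dots,X_n)$ is a partition of the set of chores into $n$ (possibly empty) bundles. It is $\lambda$-EFX if $d_i(X_i\setminus\{j\})\le\lambda\, d_i(X_h)$ for all agents $i,h$ and all chores $j\in X_i$. It is Pareto optimal (PO) if there is no allocation $Y$ with $d_i(Y_i)\le d_i(X_i)$ for all agents $i$ and $d_h(Y_h)<d_h(X_h)$ for some agent $h$. The instance is $\{1,k\}$-bivalued, for a real number $k\ge 1$, if $d_{ij}\in\{1,k\}$ for all $i,j$. Theorem. Every $\{1,k\}$-bivalued chore division instance has an allocation that is $(2-1/k)$-EFX and PO, and such an allocation can be computed in polynomial time: there is a single algorithm (a program for a random access machine with memory cells for natural numbers and for real numbers, whose only elementary operations on numbers are reading and writing memory, addition, subtraction and comparison, each at unit cost) and a polynomial $q$ such that, for every real $k\ge1$ and every $\{1,k\}$-bivalued instance, the algorithm, given $n$, $m$ and the matrix $(d_{ij})$, halts after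 at most $q(n+m)$ elementary steps and outputs such an allocation. -/

import Mathlib

namespace ChoreDivision

/-- A chore division instance with agents `Fin n`, chores `Fin m` and additive disutilities:
`d i j > 0` is the disutility of chore `j` for agent `i`. -/
structure ChoreInstance (n m : ℕ) where
  d : Fin n → Fin m → ℝ
  d_pos : ∀ i j, 0 < d i j

/-- An (integral) allocation, i.e. a partition of the chores into `n` (possibly empty) bundles,
is given by the agent who receives each chore. -/
abbrev Allocation (n m : ℕ) := Fin m → Fin n

variable {n m : ℕ}

/-- The bundle `X_i` allocated to agent `i`. -/
def Allocation.bundle (X : Allocation n m) (i : Fin n) : Finset (Fin m) :=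
  Finset.univ.filter fun j => X j = i

namespace ChoreInstance

/-- The additive disutility `d_i(S)` of a set `S` of chores. -/
def disutility (I : ChoreInstance n m) (i : Fin n) (S : Finset (Fin m)) : ℝ :=
  ∑ j ∈ S, I.d i j

/-- `{1,k}`-bivalued instances. -/
def IsBivalued (I : ChoreInstance n m) (k : ℝ) : Prop :=
  ∀ i j, I.d i j = 1 ∨ I.d i j = k

/-- `lam`-envy-freeness up to any chore. -/
def IsEFX (I : ChoreInstance n m) (lam : ℝ) (X : Allocation n m) : Prop :=
  ∀ i h : Fin n, ∀ j ∈ X.bundle i,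
    I.disutility i ((X.bundle i).erase j) ≤ lam * I.disutility i (X.bundle h)

/-- The allocation `Y` dominates the allocation `X`. -/
def Dominates (I : ChoreInstance n m) (Y X : Allocation n m) : Prop :=
  (∀ i, I.disutility i (Y.bundle i) ≤ I.disutility i (X.bundle i)) ∧
    ∃ h, I.disutility h (Y.bundle h) < I.disutility h (X.bundle h)

/-- Pareto optimality (among integral allocations). -/
def IsParetoOptimal (I : ChoreInstance n m) (X : Allocation n m) : Prop :=
  ¬ ∃ Y : Allocation n m, I.Dominates Y X

end ChoreInstance

/-! ### The model of computation

While-programs over two kinds of data, natural numbers and real numbers, stored in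
two-dimensional arrays (a random access memory with indirect addressing). A program mentions
finitely many arrays, by fixed names in `ℕ`. The only arithmetic operations are addition and
subtraction, and the only tests are comparisons; every elementary operation costs one step.

There is no multiplication, so no number can become long within few steps: after `t` steps every
natural number has `O(t)` more bits than the input `n`, `m`, and every real number is an integer
combination of `1` and the input numbers with coefficients of `O(t)` bits. Polynomially many steps
of this machine are therefore also polynomial time in the bit model (Turing machines) when the
input numbers are rational. -/

/-- The contents of the memory: `s.nat a i j` is entry `(i, j)` of the array `a` of natural
numbers, and `s.num a i j` is entry `(i, j)` of the array `a` of real numbers. -/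
structure Store where
  nat : ℕ → ℕ → ℕ → ℕ
  num : ℕ → ℕ → ℕ → ℝ

/-- Overwrite one entry of an array. -/
def update {α : Type} (f : ℕ → ℕ → ℕ → α) (a i j : ℕ) (v : α) : ℕ → ℕ → ℕ → α :=
  fun a' i' j' => if a' = a ∧ i' = i ∧ j' = j then v else f a' i' j'

/-- Expressions for natural numbers: constants, array entries (at computed indices),
sums and truncated differences. -/
inductive NatExpr where
  | lit (c : ℕ)
  | get (a : ℕ) (i j : NatExpr)
  | add (x y : NatExpr)
  | sub (x y : NatExpr)

/-- Expressions for real numbers: integer constants, array entries, sums and differences. -/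
inductive NumExpr where
  | lit (c : ℤ)
  | get (a : ℕ) (i j : NatExpr)
  | add (x y : NumExpr)
  | sub (x y : NumExpr)

/-- Tests: comparisons and their Boolean combinations. -/
inductive Test where
  | natLt (x y : NatExpr)
  | numLt (x y : NumExpr)
  | not (b : Test)
  | and (b c : Test)

/-- While-programs. -/
inductive Program where
  | skip
  | setNat (a : ℕ) (i j : NatExpr) (v : NatExpr)
  | setNum (a : ℕ) (i j : NatExpr) (v : NumExpr)
  | seq (P Q : Program)
  | cond (b : Test) (P Q : Program)
  | loop (b : Test) (P : Program)

/-- The value of an expression. -/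
def NatExpr.eval (s : Store) : NatExpr → ℕ
  | lit c => c
  | get a i j => s.nat a (i.eval s) (j.eval s)
  | add x y => x.eval s + y.eval s
  | sub x y => x.eval s - y.eval s

/-- The number of elementary operations needed to evaluate an expression. -/
def NatExpr.cost : NatExpr → ℕ
  | lit _ => 1
  | get _ i j => i.cost + j.cost + 1
  | add x y => x.cost + y.cost + 1
  | sub x y => x.cost + y.cost + 1

/-- The value of an expression. -/
def NumExpr.eval (s : Store) : NumExpr → ℝ
  | lit c => c
  | get a i j => s.num a (i.eval s) (j.eval s)
  | add x y => x.eval s + y.eval s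
  | sub x y => x.eval s - y.eval s

/-- The number of elementary operations needed to evaluate an expression. -/
def NumExpr.cost : NumExpr → ℕ
  | lit _ => 1
  | get _ i j => i.cost + j.cost + 1
  | add x y => x.cost + y.cost + 1
  | sub x y => x.cost + y.cost + 1

/-- The truth of a test. -/
def Test.Holds (s : Store) : Test → Prop
  | natLt x y => x.eval s < y.eval s
  | numLt x y => x.eval s < y.eval s
  | not b => ¬ b.Holds s
  | and b c => b.Holds s ∧ c.Holds s

/-- The number of elementary operations needed to evaluate a test. -/
def Test.cost : Test → ℕ
  | natLt x y => x.cost + y.cost + 1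
  | numLt x y => x.cost + y.cost + 1
  | not b => b.cost + 1
  | and b c => b.cost + c.cost + 1

/-- `Exec P s t s'`: started in the store `s`, the program `P` halts after exactly `t` elementary
steps, in the store `s'`. -/
inductive Exec : Program → Store → ℕ → Store → Prop where
  | skip (s : Store) : Exec .skip s 1 s
  | setNat (s : Store) (a : ℕ) (i j v : NatExpr) :
      Exec (.setNat a i j v) s (i.cost + j.cost + v.cost + 1)
        { s with nat := update s.nat a (i.eval s) (j.eval s) (v.eval s) }
  | setNum (s : Store) (a : ℕ) (i j : NatExpr) (v : NumExpr) :
      Exec (.setNum a i j v) s (i.cost + j.cost + v.cost + 1)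
        { s with num := update s.num a (i.eval s) (j.eval s) (v.eval s) }
  | seq {P Q : Program} {s s' s'' : Store} {t u : ℕ} :
      Exec P s t s' → Exec Q s' u s'' → Exec (.seq P Q) s (t + u) s''
  | condTrue {b : Test} {P Q : Program} {s s' : Store} {t : ℕ} :
      b.Holds s → Exec P s t s' → Exec (.cond b P Q) s (b.cost + t + 1) s'
  | condFalse {b : Test} {P Q : Program} {s s' : Store} {t : ℕ} :
      ¬ b.Holds s → Exec Q s t s' → Exec (.cond b P Q) s (b.cost + t + 1) s'
  | loopDone {b : Test} {P : Program} {s : Store} :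
      ¬ b.Holds s → Exec (.loop b P) s (b.cost + 1) s
  | loopStep {b : Test} {P : Program} {s s' s'' : Store} {t u : ℕ} :
      b.Holds s → Exec P s t s' → Exec (.loop b P) s' u s'' →
        Exec (.loop b P) s (b.cost + t + u + 1) s''

/-- The initial store for an instance: entries `(0, 0)` and `(0, 1)` of the array `0` of natural
numbers hold `n` and `m`, the array `0` of real numbers holds the matrix of disutilities, and all
other entries are `0`. -/
noncomputable def ChoreInstance.input (I : ChoreInstance n m) : Store where
  nat := update (update (fun _ _ _ => 0) 0 0 0 n) 0 0 1 m
  num := fun a i j => if h : a = 0 ∧ i < n ∧ j < m then I.d ⟨i, h.2.1⟩ ⟨j, h.2.2⟩ else 0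

/-- `P.Computes I X T`: on the instance `I`, the program `P` halts after at most `T` steps and
outputs the allocation `X`, by writing the agent who receives chore `j` into entry `(0, j)` of the
array `1` of natural numbers. -/
def Program.Computes (P : Program) (I : ChoreInstance n m) (X : Allocation n m) (T : ℕ) : Prop :=
  ∃ (t : ℕ) (s : Store), Exec P I.input t s ∧ t ≤ T ∧ ∀ j : Fin m, s.nat 1 0 j = (X j : ℕ)

end ChoreDivision

/-! Let `K` be the largest entry of the matrix (at least 1), so that all disutilities are 1 or `K`.
An agent likes a chore if its disutility is 1.

Pareto optimality comes from supporting prices. Agents are light (weight 1) or heavy (weight `K`),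
chores have prices 1 or `K`, and the weighted disutility of a chore is at least its price for
everybody and equal to it for the owner. The allocation then minimises a positively weighted sum of
disutilities (`Supported.not_dominated`).

To find prices, give every chore that somebody likes to such an agent, and balance the bundle sizes
along transfer chains until no chain leads to an agent with two chores fewer. The level of an agent
is the largest bundle size from which a chain reaches it. Levels exceed the agent's own bundle size
by at most one and are monotone along likes (`Leveled.of_stable`). For a threshold `t`, agents of
level at most `t` are light and their chores cost 1; all other chores cost `K`. These prices remain
supporting when chores of price `K` move to light agents (`Settled.supported`). So the chores nobody
likes go to light agents of least price load, and then chores move from the most loaded heavy agent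
to the least loaded light one while their loads differ by more than `K`.

The aim is fairness in prices (`Settled.fair`): owners of a chore of price `K` envy by at most `K`,
owners of cheap chores only by at most 1. The latter own at most `t` chores, so it suffices that all
loads are at least `t - 1`. Thresholds are tried from `m` downwards. A failure at `t + 1` is
information: by a double count (`Spread.exists_load_lt`, `Spread.small_or_reduced`) it yields at
threshold `t` an agent of small load, and hence the bound that prevents envy towards heavy agents
who have lost nothing.

If all price loads are at least `K`, price fairness gives the factor `2 - 1/K` directly, since `v +
K - 1 ≤ (2 - 1/K) v` for `v ≥ K`. If the least load `a` is below `K`, an owner of a chore of price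
`K` has load at most `K + a < 2K`, and the remaining envy is removed by exchanging one disliked
chore for a whole bundle (`Repaired.exchange`); prices still support the result.

All loops count up to `n` or `m`, so a time bound is read off the syntax (`Cmd.exec_compile`), and
correctness is proved by loop invariants (`Cmd.den_loop_induction`). -/

namespace ChoreDivision

/-! ### Counting-loop programs: semantics, frames, running time -/

/-- Programs all of whose loops are counting loops: `loop v b C` runs `C` with the entry `(0, 0)`
of the array `v` running through the numbers below the entry `(0, b)` of the array `0`. -/
inductive Cmd where
  | skip
  | setNat (a : ℕ) (i j v : NatExpr)
  | setNum (a : ℕ) (i j : NatExpr) (v : NumExpr)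
  | seq (C D : Cmd)
  | cond (b : Test) (C D : Cmd)
  | loop (v b : ℕ) (C : Cmd)

/-- Assign to a scalar or an array entry. -/
def Store.setNat (s : Store) (a i j v : ℕ) : Store := { s with nat := update s.nat a i j v }

/-- Assign to a scalar or an array entry. -/
noncomputable def Store.setNum (s : Store) (a i j : ℕ) (v : ℝ) : Store :=
  { s with num := update s.num a i j v }

/-- A scalar variable. -/
abbrev var (a : ℕ) : NatExpr := .get a (.lit 0) (.lit 0)

namespace Cmd

/-- The while-program denoted by a command. -/
def compile : Cmd → Program
  | skip => .skip
  | setNat a i j v => .setNat a i j v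
  | setNum a i j v => .setNum a i j v
  | seq C D => .seq C.compile D.compile
  | cond b C D => .cond b C.compile D.compile
  | loop v b C => .seq (.setNat v (.lit 0) (.lit 0) (.lit 0))
      (.loop (.natLt (var v) (.get 0 (.lit 0) (.lit b)))
        (.seq C.compile (.setNat v (.lit 0) (.lit 0) (.add (var v) (.lit 1)))))

open Classical in
/-- The store transformer computed by a command. -/
noncomputable def den : Cmd → Store → Store
  | skip, s => s
  | setNat a i j v, s => s.setNat a (i.eval s) (j.eval s) (v.eval s)
  | setNum a i j v, s => s.setNum a (i.eval s) (j.eval s) (v.eval s)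
  | seq C D, s => D.den (C.den s)
  | cond b C D, s => if b.Holds s then C.den s else D.den s
  | loop v b C, s => Nat.rec (s.setNat v 0 0 0) (fun i s' => (C.den s').setNat v 0 0 (i + 1))
      (s.nat 0 0 b)

/-- The arrays of natural numbers that a command may change. -/
def natWrites : Cmd → List ℕ
  | skip => []
  | setNat a _ _ _ => [a]
  | setNum _ _ _ _ => []
  | seq C D => C.natWrites ++ D.natWrites
  | cond _ C D => C.natWrites ++ D.natWrites
  | loop v _ C => v :: C.natWrites

/-- The arrays of real numbers that a command may change. -/
def numWrites : Cmd → List ℕ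
  | skip => []
  | setNat _ _ _ _ => []
  | setNum a _ _ _ => [a]
  | seq C D => C.numWrites ++ D.numWrites
  | cond _ C D => C.numWrites ++ D.numWrites
  | loop _ _ C => C.numWrites

/-- No command overwrites the input sizes or the counter of a loop around it, and all loops are
bounded by one of the input sizes. -/
def WellFormed : Cmd → Prop
  | skip => True
  | setNat a _ _ _ => a ≠ 0
  | setNum _ _ _ _ => True
  | seq C D => C.WellFormed ∧ D.WellFormed
  | cond _ C D => C.WellFormed ∧ D.WellFormed
  | loop v b C => v ≠ 0 ∧ b < 2 ∧ v ∉ C.natWrites ∧ C.WellFormed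

instance decidableWellFormed : ∀ C : Cmd, Decidable C.WellFormed
  | skip => inferInstanceAs (Decidable True)
  | setNat a _ _ _ => inferInstanceAs (Decidable (a ≠ 0))
  | setNum _ _ _ _ => inferInstanceAs (Decidable True)
  | seq C D => @instDecidableAnd _ _ (decidableWellFormed C) (decidableWellFormed D)
  | cond _ C D => @instDecidableAnd _ _ (decidableWellFormed C) (decidableWellFormed D)
  | loop _ _ C => @instDecidableAnd _ _ _ (@instDecidableAnd _ _ _
      (@instDecidableAnd _ _ _ (decidableWellFormed C)))

open Polynomial in
/-- A bound for the running time of a command, as a polynomial in the input size. -/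
noncomputable def time : Cmd → ℕ[X]
  | skip => 1
  | setNat _ i j v => C (i.cost + j.cost + v.cost + 1)
  | setNum _ i j v => C (i.cost + j.cost + v.cost + 1)
  | seq P Q => P.time + Q.time
  | cond b P Q => C (b.cost + 1) + P.time + Q.time
  | loop _ _ P => X * (P.time + C 16) + C 12

/-- `t` and `s` agree on all arrays that the command `C` does not change. -/
def Frame (C : Cmd) (s t : Store) : Prop :=
  (∀ a, a ∉ C.natWrites → t.nat a = s.nat a) ∧ ∀ a, a ∉ C.numWrites → t.num a = s.num a

end Cmd

@[simp] theorem Store.setNat_num (s : Store) (a i j v : ℕ) : (s.setNat a i j v).num = s.num := rfl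

@[simp] theorem Store.setNum_nat (s : Store) (a i j : ℕ) (v : ℝ) :
    (s.setNum a i j v).nat = s.nat := rfl

theorem Store.setNat_nat (s : Store) (a i j v b i' j' : ℕ) :
    (s.setNat a i j v).nat b i' j' = if b = a ∧ i' = i ∧ j' = j then v else s.nat b i' j' := rfl

theorem Store.setNum_num (s : Store) (a i j : ℕ) (v : ℝ) (b i' j' : ℕ) :
    (s.setNum a i j v).num b i' j' = if b = a ∧ i' = i ∧ j' = j then v else s.num b i' j' := rfl

theorem Store.setNat_nat_ne (s : Store) {a b : ℕ} (i j v : ℕ) (h : b ≠ a) :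
    (s.setNat a i j v).nat b = s.nat b := by
  funext i' j'; simp [Store.setNat_nat, h]

theorem Store.setNum_num_ne (s : Store) {a b : ℕ} (i j : ℕ) (v : ℝ) (h : b ≠ a) :
    (s.setNum a i j v).num b = s.num b := by
  funext i' j'; simp [Store.setNum_num, h]

namespace Cmd

/-- Non-interference is syntactic: in the correctness proofs below, `decide` on the lists of written
arrays mostly suffices to show which data survive a subprogram. -/
theorem frame_den (C : Cmd) (s : Store) : C.Frame s (C.den s) := by
  induction C generalizing s with
  | skip => exact ⟨fun _ _ => rfl, fun _ _ => rfl⟩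
  | setNat a i j v =>
    refine ⟨fun b hb => ?_, fun _ _ => rfl⟩
    exact Store.setNat_nat_ne _ _ _ _ (by simpa [natWrites] using hb)
  | setNum a i j v =>
    refine ⟨fun _ _ => rfl, fun b hb => ?_⟩
    exact Store.setNum_num_ne _ _ _ _ (by simpa [numWrites] using hb)
  | seq C D hC hD =>
    constructor
    · intro a ha
      simp only [natWrites, List.mem_append, not_or] at ha
      exact ((hD _).1 a ha.2).trans ((hC s).1 a ha.1)
    · intro a ha
      simp only [numWrites, List.mem_append, not_or] at ha
      exact ((hD _).2 a ha.2).trans ((hC s).2 a ha.1)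
  | cond b C D hC hD =>
    constructor
    · intro a ha
      simp only [natWrites, List.mem_append, not_or] at ha
      simp only [den]
      split_ifs
      · exact (hC s).1 a ha.1
      · exact (hD s).1 a ha.2
    · intro a ha
      simp only [numWrites, List.mem_append, not_or] at ha
      simp only [den]
      split_ifs
      · exact (hC s).2 a ha.1
      · exact (hD s).2 a ha.2
  | loop v b C hC =>
    simp only [den]
    generalize s.nat 0 0 b = N
    constructor
    · intro a ha
      simp only [natWrites, List.mem_cons, not_or] at ha
      induction N with
      | zero => exact Store.setNat_nat_ne _ _ _ _ ha.1
      | succ N ih => exact (Store.setNat_nat_ne _ _ _ _ ha.1).trans (((hC _).1 a ha.2).trans ih)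
    · intro a ha
      simp only [numWrites] at ha
      induction N with
      | zero => rfl
      | succ N ih => exact ((hC _).2 a ha).trans ih

/-- The array `0` holds the loop bounds, so these stay constant throughout the execution. -/
theorem zero_notMem_natWrites {C : Cmd} (h : C.WellFormed) : 0 ∉ C.natWrites := by
  induction C with
  | skip => simp [natWrites]
  | setNat a i j v => simpa [natWrites, WellFormed, eq_comm] using h
  | setNum a i j v => simp [natWrites]
  | seq C D hC hD => simpa [natWrites] using ⟨hC h.1, hD h.2⟩
  | cond b C D hC hD => simpa [natWrites] using ⟨hC h.1, hD h.2⟩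
  | loop v b C hC => simpa [natWrites, eq_comm] using ⟨h.1, hC h.2.2.2⟩

/-- The loop rule: an invariant of the body holds after the loop. -/
theorem den_loop_induction {v b : ℕ} {C : Cmd} {s : Store} (P : ℕ → Store → Prop)
    (h0 : P 0 (s.setNat v 0 0 0))
    (hs : ∀ i s', i < s.nat 0 0 b → s'.nat v 0 0 = i → (loop v b C).Frame s s' → P i s' →
      P (i + 1) ((C.den s').setNat v 0 0 (i + 1))) :
    P (s.nat 0 0 b) ((loop v b C).den s) := by
  -- The invariant travels together with the value of the counter and the frame, which is why the
  -- step hypothesis `hs` may use both.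
  have key : ∀ N, N ≤ s.nat 0 0 b →
      let s' : Store := Nat.rec (s.setNat v 0 0 0)
        (fun i s' => (C.den s').setNat v 0 0 (i + 1)) N
      P N s' ∧ s'.nat v 0 0 = N ∧ (loop v b C).Frame s s' := by
    intro N
    induction N with
    | zero =>
      intro _
      refine ⟨h0, by simp [Store.setNat_nat], fun a ha => ?_, fun _ _ => rfl⟩
      simp only [natWrites, List.mem_cons, not_or] at ha
      exact Store.setNat_nat_ne _ _ _ _ ha.1
    | succ N ih =>
      intro hN
      obtain ⟨hP, hv, hf⟩ := ih (by omega)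
      refine ⟨hs N _ (by omega) hv hf hP, by simp [Store.setNat_nat], fun a ha => ?_,
        fun a ha => ?_⟩
      · have ha' := ha
        simp only [natWrites, List.mem_cons, not_or] at ha
        exact (Store.setNat_nat_ne _ _ _ _ ha.1).trans
          (((frame_den C _).1 a ha.2).trans (hf.1 a ha'))
      · exact ((frame_den C _).2 a ha).trans (hf.2 a ha)
  exact (key _ le_rfl).1

/-- Commands compute their store transformers in polynomial time. -/
theorem exec_compile {n m : ℕ} (C : Cmd) (hC : C.WellFormed) (s : Store)
    (hn : s.nat 0 0 0 = n) (hm : s.nat 0 0 1 = m) :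
    ∃ t ≤ C.time.eval (n + m), Exec C.compile s t (C.den s) := by
  induction C generalizing s with
  | skip => exact ⟨1, by simp [time], Exec.skip s⟩
  | setNat a i j v => exact ⟨_, by simp [time], Exec.setNat s a i j v⟩
  | setNum a i j v => exact ⟨_, by simp [time], Exec.setNum s a i j v⟩
  | seq C D ihC ihD =>
    obtain ⟨t, ht, h⟩ := ihC hC.1 s hn hm
    have h0 := (frame_den C s).1 0 (zero_notMem_natWrites hC.1)
    obtain ⟨u, hu, h'⟩ := ihD hC.2 (C.den s) (by rw [h0, hn]) (by rw [h0, hm])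
    exact ⟨t + u, by simp only [time, Polynomial.eval_add]; omega, Exec.seq h h'⟩
  | cond b C D ihC ihD =>
    simp only [den]
    split_ifs with hb
    · obtain ⟨t, ht, h⟩ := ihC hC.1 s hn hm
      exact ⟨_, by simp only [time, Polynomial.eval_add, Polynomial.eval_C]; omega,
        Exec.condTrue hb h⟩
    · obtain ⟨t, ht, h⟩ := ihD hC.2 s hn hm
      exact ⟨_, by simp only [time, Polynomial.eval_add, Polynomial.eval_C]; omega,
        Exec.condFalse hb h⟩
  | loop v b C ih =>
    obtain ⟨hv, hb, hvC, hC⟩ := hC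
    have h0C := zero_notMem_natWrites hC
    set f : ℕ → Store := fun N => Nat.rec (s.setNat v 0 0 0)
      (fun i s' => (C.den s').setNat v 0 0 (i + 1)) N with hf
    have f0 : ∀ N, (f N).nat 0 = s.nat 0 := by
      intro N
      induction N with
      | zero => exact Store.setNat_nat_ne _ _ _ _ hv.symm
      | succ N ih =>
        exact (Store.setNat_nat_ne _ _ _ _ hv.symm).trans (((frame_den C _).1 0 h0C).trans ih)
    have fv : ∀ N, (f N).nat v 0 0 = N := by
      intro N
      cases N <;> simp [hf, Store.setNat_nat]
    have hB : s.nat 0 0 b ≤ n + m := by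
      interval_cases b <;> omega
    -- `k` counts the iterations still to come. The overhead of an iteration is 7 for the test, 8
    -- for the increment and 1 for the loop itself; the final failing test costs 8, and with 4 for
    -- the initialisation this gives the 12 in `Cmd.time`.
    have main : ∀ k N, N + k = s.nat 0 0 b → ∃ t ≤ k * (C.time.eval (n + m) + 16) + 8,
        Exec (.loop (.natLt (var v) (.get 0 (.lit 0) (.lit b)))
          (.seq C.compile (.setNat v (.lit 0) (.lit 0) (.add (var v) (.lit 1))))) (f N) t
          (f (s.nat 0 0 b)) := by
      intro k
      induction k with
      | zero =>
        intro N hN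
        obtain rfl : N = s.nat 0 0 b := by omega
        refine ⟨_, ?_, Exec.loopDone ?_⟩
        · simp [Test.cost, NatExpr.cost]
        · simp [Test.Holds, NatExpr.eval, fv, f0]
      | succ k ihk =>
        intro N hN
        obtain ⟨t, ht, h⟩ := ihk (N + 1) (by omega)
        obtain ⟨u, hu, h'⟩ := ih hC (f N) (by rw [f0, hn]) (by rw [f0, hm])
        have hset := Exec.setNat (C.den (f N)) v (.lit 0) (.lit 0) (.add (var v) (.lit 1))
        have hval : NatExpr.eval (C.den (f N)) (.add (var v) (.lit 1)) = N + 1 := by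
          simp only [NatExpr.eval, (frame_den C _).1 v hvC, fv]
        rw [hval] at hset
        refine ⟨_, ?_, Exec.loopStep ?_ (Exec.seq h' hset) h⟩
        · simp only [Test.cost, NatExpr.cost]
          ring_nf at ht ⊢
          omega
        · simp only [Test.Holds, NatExpr.eval, fv, f0]
          omega
    obtain ⟨t, ht, h⟩ := main (s.nat 0 0 b) 0 (by omega)
    refine ⟨_, ?_, Exec.seq (Exec.setNat s v (.lit 0) (.lit 0) (.lit 0)) h⟩
    have := Nat.mul_le_mul_right (C.time.eval (n + m) + 16) hB
    simp only [time, Polynomial.eval_add, Polynomial.eval_mul, Polynomial.eval_X,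
      Polynomial.eval_C, NatExpr.cost]
    omega

end Cmd

open Finset

theorem Store.setNat_row (s : Store) (a i j v : ℕ) :
    (s.setNat a i j v).nat a i = Function.update (s.nat a i) j v := by
  funext j'
  by_cases h : j' = j <;> simp [Store.setNat_nat, Function.update, h]

theorem Store.setNum_row (s : Store) (a i j : ℕ) (v : ℝ) :
    (s.setNum a i j v).num a i = Function.update (s.num a i) j v := by
  funext j'
  by_cases h : j' = j <;> simp [Store.setNum_num, Function.update, h]

/-! ### Balanced assignments of the liked chores, transfer chains and levels -/

/-- Agent `i` has the smaller of the two disutilities for chore `j`. -/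
def Likes (D : ℕ → ℕ → ℝ) (i j : ℕ) : Prop := ¬ 1 < D i j

/-- The number of chores below `m` that `X` gives to `i`. -/
def cnt (m : ℕ) (X : ℕ → ℕ) (i : ℕ) : ℕ := #{j ∈ range m | X j = i}

/-- Every chore is held by an agent who likes it, if there is one, and is unassigned otherwise. -/
def Valid (D : ℕ → ℕ → ℝ) (n m : ℕ) (X : ℕ → ℕ) : Prop :=
  ∀ j < m, (X j < n ∧ Likes D (X j) j) ∨ (X j = n ∧ ∀ i < n, ¬ Likes D i j)

theorem Valid.le {D : ℕ → ℕ → ℝ} {n m : ℕ} {X : ℕ → ℕ} (h : Valid D n m X) {j : ℕ}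
    (hj : j < m) : X j ≤ n := by
  rcases h j hj with h | h
  · exact h.1.le
  · exact h.1.le

theorem cnt_zero (X : ℕ → ℕ) (i : ℕ) : cnt 0 X i = 0 := by simp [cnt]

theorem cnt_succ (m : ℕ) (X : ℕ → ℕ) (i : ℕ) :
    cnt (m + 1) X i = cnt m X i + if X m = i then 1 else 0 := by
  unfold cnt
  rw [range_add_one, filter_insert]
  split_ifs with h
  · rw [card_insert_of_notMem (by simp)]
  · rfl

/-- Indicators on both sides avoid truncated subtraction and cover the case `y = X j`. -/
theorem cnt_update {m : ℕ} (X : ℕ → ℕ) {j : ℕ} (hj : j < m) (y a : ℕ) :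
    cnt m (Function.update X j y) a + (if a = X j then 1 else 0) =
      cnt m X a + (if a = y then 1 else 0) := by
  induction m with
  | zero => omega
  | succ m ih =>
    rw [cnt_succ, cnt_succ]
    rcases Nat.lt_succ_iff_lt_or_eq.mp hj with h | rfl
    · have := ih h
      rw [Function.update_of_ne (by omega)]
      omega
    · have h1 : cnt j (Function.update X j y) a = cnt j X a := by
        unfold cnt
        congr 1
        apply filter_congr
        intro x hx
        rw [Function.update_of_ne (by simp at hx; omega)]
      rw [h1, Function.update_self]
      simp only [eq_comm (a := a)]
      omega

theorem sum_cnt_le (n m : ℕ) (X : ℕ → ℕ) : ∑ i ∈ range n, cnt m X i ≤ m := by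
  induction m with
  | zero => simp [cnt_zero]
  | succ m ih =>
    simp only [cnt_succ, sum_add_distrib]
    have : ∑ i ∈ range n, (if X m = i then 1 else 0) ≤ 1 := by
      rw [sum_ite_eq]; split_ifs <;> simp
    omega

/-- Some chore of `x` is liked by `y`. -/
def Hop (D : ℕ → ℕ → ℝ) (n m : ℕ) (X : ℕ → ℕ) (x y : ℕ) : Prop :=
  y < n ∧ ∃ j < m, X j = x ∧ Likes D y j

/-- Reachability by transfer chains. -/
def Reach (D : ℕ → ℕ → ℝ) (n m : ℕ) (X : ℕ → ℕ) : ℕ → ℕ → Prop :=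
  Relation.ReflTransGen (Hop D n m X)

/-- No transfer chain leads to an agent with two chores less. -/
def Stable (D : ℕ → ℕ → ℝ) (n m : ℕ) (X : ℕ → ℕ) : Prop :=
  ∀ x < n, ∀ y < n, Reach D n m X x y → cnt m X x ≤ cnt m X y + 1

/-- `p` marks a set of agents and `via` a tree of transfer chains from `x` to them, with ranks `r`
that increase along the chains. -/
structure IsTree (D : ℕ → ℕ → ℝ) (n m : ℕ) (X : ℕ → ℕ) (x : ℕ) (p via r : ℕ → ℕ) : Prop where
  root : p x ≠ 0
  out : p n = 0
  parent : ∀ y < n, p y ≠ 0 → y ≠ x → via y < m ∧ Likes D y (via y) ∧ X (via y) < n ∧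
    p (X (via y)) ≠ 0 ∧ r (X (via y)) < r y
  rank_lt : ∀ y < n, p y ≠ 0 → r y < #{z ∈ range n | p z ≠ 0}

/-- The marked set is closed under transfers. -/
def MarkClosed (D : ℕ → ℕ → ℝ) (n m : ℕ) (X : ℕ → ℕ) (p : ℕ → ℕ) : Prop :=
  ∀ j < m, ∀ y < n, p (X j) ≠ 0 → Likes D y j → p y ≠ 0

/-- The new agent receives the previous number of marked agents as its rank, which exceeds all ranks
in use. Unassigned chores have the fictitious holder `n`; the field `out` ensures that the chore
used here has a genuine one. -/
theorem IsTree.insert {D : ℕ → ℕ → ℝ} {n m : ℕ} {X : ℕ → ℕ} {x : ℕ} {p via r : ℕ → ℕ}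
    (h : IsTree D n m X x p via r) {j y : ℕ} (hj : j < m) (hX : X j ≤ n) (hy : y < n)
    (hp : p (X j) ≠ 0) (hl : Likes D y j) (hpy : p y = 0) :
    ∃ r', IsTree D n m X x (Function.update p y 1) (Function.update via y j) r' := by
  have hX : X j < n := lt_of_le_of_ne hX fun e => hp (e ▸ h.out)
  have hcard : #{z ∈ range n | Function.update p y 1 z ≠ 0} = #{z ∈ range n | p z ≠ 0} + 1 := by
    rw [← card_insert_of_notMem (a := y) (by simp [hpy])]
    congr 1
    ext z
    by_cases hz : z = y
    · simp [hz, hy]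
    · simp [hz]
  refine ⟨Function.update r y #{z ∈ range n | p z ≠ 0}, ?_, ?_, ?_, ?_⟩
  · by_cases hz : x = y
    · simp [hz]
    · simpa [hz] using h.root
  · simpa [hy.ne'] using h.out
  · intro z hzn hz hzx
    by_cases hzy : z = y
    · subst hzy
      have hne : X j ≠ z := fun h => hp (h ▸ hpy)
      simp only [Function.update_self, Function.update_of_ne hne]
      exact ⟨hj, hl, hX, hp, h.rank_lt _ hX hp⟩
    · simp only [Function.update_of_ne hzy] at hz ⊢
      obtain ⟨h1, h2, h3, h4, h5⟩ := h.parent z hzn hz hzx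
      have hne : X (via z) ≠ y := fun h => h4 (h ▸ hpy)
      simp only [Function.update_of_ne hne]
      exact ⟨h1, h2, h3, h4, h5⟩
  · intro z hzn hz
    rw [hcard]
    by_cases hzy : z = y
    · simp [hzy]
    · simp only [Function.update_of_ne hzy] at hz ⊢
      exact (h.rank_lt z hzn hz).trans (Nat.lt_succ_self _)

theorem IsTree.reach {D : ℕ → ℕ → ℝ} {n m : ℕ} {X : ℕ → ℕ} {x : ℕ} {p via r : ℕ → ℕ}
    (h : IsTree D n m X x p via r) : ∀ y < n, p y ≠ 0 → Reach D n m X x y := by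
  have : ∀ k, ∀ y < n, r y = k → p y ≠ 0 → Reach D n m X x y := by
    intro k
    induction k using Nat.strong_induction_on with
    | _ k ih =>
      intro y hyn hk hy
      by_cases hyx : y = x
      · subst hyx; exact Relation.ReflTransGen.refl
      · obtain ⟨h1, h2, h3, h4, h5⟩ := h.parent y hyn hy hyx
        exact (ih _ (hk ▸ h5) _ h3 rfl h4).tail ⟨hyn, _, h1, rfl, h2⟩
  exact fun y hy => this _ y hy rfl

theorem MarkClosed.of_reach {D : ℕ → ℕ → ℝ} {n m : ℕ} {X p : ℕ → ℕ} (h : MarkClosed D n m X p)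
    {x y : ℕ} (hx : p x ≠ 0) (hxy : Reach D n m X x y) : p y ≠ 0 := by
  induction hxy with
  | refl => exact hx
  | tail _ hs ih =>
    obtain ⟨hy, j, hj, rfl, hl⟩ := hs
    exact h j hj _ hy ih hl

/-- The sum of squares of the bundle sizes. -/
def sqSum (n m : ℕ) (X : ℕ → ℕ) : ℕ := ∑ i ∈ range n, cnt m X i * cnt m X i

theorem sqSum_le (n m : ℕ) (X : ℕ → ℕ) : sqSum n m X ≤ m * m := by
  calc sqSum n m X ≤ ∑ i ∈ range n, m * cnt m X i := by
        apply sum_le_sum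
        intro i _
        exact Nat.mul_le_mul_right _ ((card_filter_le _ _).trans (by simp))
    _ = m * ∑ i ∈ range n, cnt m X i := by rw [mul_sum]
    _ ≤ m * m := Nat.mul_le_mul_left _ (sum_cnt_le n m X)

/-- Moving one unit from `x` to `y` changes the sum of squares by `2 (cnt y - cnt x + 1)`, which is
negative. -/
theorem sqSum_lt {n m : ℕ} {X X' : ℕ → ℕ} {x y : ℕ} (hx : x < n) (hy : y < n)
    (hxy : cnt m X y + 1 < cnt m X x)
    (h : ∀ a < n, cnt m X' a + (if a = x then 1 else 0) = cnt m X a + (if a = y then 1 else 0)) :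
    sqSum n m X' < sqSum n m X := by
  have hne : y ≠ x := by rintro rfl; omega
  have hy' : y ∈ (range n).erase x := by simp [hne, hy]
  unfold sqSum
  rw [← add_sum_erase _ _ (mem_range.2 hx), ← add_sum_erase _ _ hy',
    ← add_sum_erase (range n) (fun i => cnt m X i * cnt m X i) (mem_range.2 hx),
    ← add_sum_erase _ (fun i => cnt m X i * cnt m X i) hy']
  have : ∑ i ∈ ((range n).erase x).erase y, cnt m X' i * cnt m X' i =
      ∑ i ∈ ((range n).erase x).erase y, cnt m X i * cnt m X i := by
    apply sum_congr rfl
    intro a ha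
    simp only [mem_erase, mem_range] at ha
    have := h a ha.2.2
    simp only [ha.1, ha.2.1, if_false, add_zero] at this
    rw [this]
  rw [this]
  have h1 := h x hx
  have h2 := h y hy
  simp only [if_true, hne, hne.symm, if_false, add_zero] at h1 h2
  rw [h2, ← h1]
  nlinarith

/-- The balanced assignment of the liked chores with its levels. -/
structure Leveled (D : ℕ → ℕ → ℝ) (n m : ℕ) (X hi : ℕ → ℕ) : Prop where
  valid : Valid D n m X
  cnt_le : ∀ y < n, cnt m X y ≤ hi y
  le_cnt : ∀ y < n, hi y ≤ cnt m X y + 1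
  le_items : ∀ y < n, hi y ≤ m
  mono : ∀ j < m, X j < n → ∀ y < n, Likes D y j → hi (X j) ≤ hi y

/-- By `h1` and `h2`, `hi y` is the largest bundle size among the agents that reach `y`. Stability
keeps it within one of the size of the bundle of `y` itself, and it is monotone because a liked
chore prolongs every chain by one hop. -/
theorem Leveled.of_stable {D : ℕ → ℕ → ℝ} {n m : ℕ} {X hi : ℕ → ℕ} (hv : Valid D n m X)
    (hs : Stable D n m X)
    (h1 : ∀ y < n, hi y = 0 ∨ ∃ x < n, Reach D n m X x y ∧ hi y = cnt m X x)
    (h2 : ∀ y < n, ∀ x < n, Reach D n m X x y → cnt m X x ≤ hi y) : Leveled D n m X hi where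
  valid := hv
  cnt_le y hy := h2 y hy y hy Relation.ReflTransGen.refl
  le_cnt y hy := by
    rcases h1 y hy with h | ⟨x, hx, hr, h⟩
    · omega
    · rw [h]; exact hs x hx y hy hr
  le_items y hy := by
    rcases h1 y hy with h | ⟨x, hx, hr, h⟩
    · omega
    · rw [h]; exact (card_filter_le _ _).trans (by simp)
  mono j hj hX y hy hl := by
    rcases h1 _ hX with h | ⟨x, hx, hr, h⟩
    · omega
    · rw [h]; exact h2 y hy x hx (hr.tail ⟨hy, j, hj, rfl, hl⟩)

/-! ### Stores with an input; the larger disutility and the first assignment -/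

/-- The store holds an instance of size `n`, `m` with disutilities `D`. -/
structure HasInput (s : Store) (n m : ℕ) (D : ℕ → ℕ → ℝ) : Prop where
  agents : s.nat 0 0 0 = n
  chores : s.nat 0 0 1 = m
  disutility : s.num 0 = D

theorem HasInput.of_frame {s t : Store} {n m : ℕ} {D : ℕ → ℕ → ℝ} {C : Cmd}
    (h : HasInput s n m D) (hf : C.Frame s t) (h1 : 0 ∉ C.natWrites) (h2 : 0 ∉ C.numWrites) :
    HasInput t n m D :=
  ⟨by rw [hf.1 0 h1, h.agents], by rw [hf.1 0 h1, h.chores], by rw [hf.2 0 h2, h.disutility]⟩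

theorem HasInput.den {s : Store} {n m : ℕ} {D : ℕ → ℕ → ℝ} {C : Cmd}
    (h : HasInput s n m D) (h1 : 0 ∉ C.natWrites) (h2 : 0 ∉ C.numWrites) :
    HasInput (C.den s) n m D :=
  h.of_frame (C.frame_den s) h1 h2

/-- An entry of a list. -/
abbrev ent (a : ℕ) (i : NatExpr) : NatExpr := .get a (.lit 0) i

/-- The test that agent `i` likes chore `j`. -/
abbrev likesTest (i j : NatExpr) : Test := .not (.numLt (.lit 1) (.get 0 i j))

attribute [simp] NatExpr.eval NumExpr.eval Test.Holds Store.setNat_nat_ne Store.setNum_num_ne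
  Store.setNat_row Store.setNum_row

@[simp] theorem Cmd.den_skip (s : Store) : Cmd.skip.den s = s := rfl

@[simp] theorem Cmd.den_setNat (s : Store) (a : ℕ) (i j v : NatExpr) :
    (Cmd.setNat a i j v).den s = s.setNat a (i.eval s) (j.eval s) (v.eval s) := rfl

@[simp] theorem Cmd.den_setNum (s : Store) (a : ℕ) (i j : NatExpr) (v : NumExpr) :
    (Cmd.setNum a i j v).den s = s.setNum a (i.eval s) (j.eval s) (v.eval s) := rfl

@[simp] theorem Cmd.den_seq (s : Store) (C D : Cmd) : (Cmd.seq C D).den s = D.den (C.den s) := rfl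

open Classical in
@[simp] theorem Cmd.den_cond (s : Store) (b : Test) (C D : Cmd) :
    (Cmd.cond b C D).den s = if b.Holds s then C.den s else D.den s := rfl

/-- Replace the stored maximum by the disutility of the current pair if that is larger. -/
def maxBody : Cmd :=
  .cond (.numLt (.get 1 (.lit 0) (.lit 0)) (.get 0 (var 10) (var 11)))
    (.setNum 1 (.lit 0) (.lit 0) (.get 0 (var 10) (var 11))) .skip

/-- Store the larger disutility in the array `1` of real numbers. -/
def maxProg : Cmd :=
  .seq (.setNum 1 (.lit 0) (.lit 0) (.lit 1)) (.loop 10 0 (.loop 11 1 maxBody))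

/-- The algorithm is not told `k`. The maximum it finds is `k`, or it is 1 and then all entries are
1; in both cases the instance is bivalued with this maximum, which is at most `k`. -/
theorem maxProg_spec {s : Store} {n m : ℕ} {D : ℕ → ℕ → ℝ} (h : HasInput s n m D) {k : ℝ}
    (hk : 1 ≤ k) (hD : ∀ i < n, ∀ j < m, D i j = 1 ∨ D i j = k) :
    let K := (maxProg.den s).num 1 0 0
    1 ≤ K ∧ K ≤ k ∧ ∀ i < n, ∀ j < m, D i j = 1 ∨ D i j = K := by
  intro K
  set s1 := (Cmd.setNum 1 (.lit 0) (.lit 0) (.lit 1)).den s with hs1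
  have h1 : HasInput s1 n m D := h.den (by decide) (by decide)
  have key := Cmd.den_loop_induction (v := 10) (b := 0) (C := .loop 11 1 maxBody) (s := s1)
    (fun i t => (t.num 1 0 0 = 1 ∨ t.num 1 0 0 = k) ∧ ∀ i' < i, ∀ j < m, D i' j ≤ t.num 1 0 0)
    ⟨by simp [hs1, Store.setNum_num], by simp⟩ ?_
  · rw [h1.agents] at key
    obtain ⟨hK, hle⟩ := key
    change K = 1 ∨ K = k at hK
    change ∀ i' < n, ∀ j < m, D i' j ≤ K at hle
    refine ⟨?_, ?_, ?_⟩
    · rcases hK with h | h <;> rw [h]; exact hk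
    · rcases hK with h | h <;> rw [h]; exact hk
    · intro i hi j hj
      have := hle i hi j hj
      rcases hD i hi j hj with h | h
      · exact Or.inl h
      · right
        rcases hK with h' | h'
        · rw [h', h] at this
          rw [h, h']
          exact le_antisymm this hk
        · exact h.trans h'.symm
  · intro i t hi hv hf ⟨ht, hle⟩
    have h2 : HasInput t n m D := h1.of_frame hf (by decide) (by decide)
    rw [h1.agents] at hi
    have key := Cmd.den_loop_induction (v := 11) (b := 1) (C := maxBody) (s := t)
      (fun j t => (t.num 1 0 0 = 1 ∨ t.num 1 0 0 = k) ∧ (∀ i' < i, ∀ j < m, D i' j ≤ t.num 1 0 0) ∧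
        ∀ j' < j, D i j' ≤ t.num 1 0 0)
      ⟨ht, hle, by simp⟩ ?_
    · rw [h2.chores] at key
      refine ⟨key.1, fun i' hi' j hj => ?_⟩
      rcases Nat.lt_succ_iff_lt_or_eq.mp hi' with h | rfl
      · exact key.2.1 i' h j hj
      · exact key.2.2 j hj
    · intro j u hj hv' hf' ⟨hu, hle1, hle2⟩
      have h3 : HasInput u n m D := h2.of_frame hf' (by decide) (by decide)
      have h10 : u.nat 10 = t.nat 10 := hf'.1 10 (by decide)
      rw [h2.chores] at hj
      simp only [maxBody, Cmd.den_cond, Cmd.den_setNum, Cmd.den_skip, Test.Holds, NumExpr.eval, NatExpr.eval, hv', h10, hv,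
        h3.disutility, Store.setNat_num]
      split_ifs with hlt
      · simp only [Store.setNum_num, and_self, if_true]
        refine ⟨hD i hi j hj, fun i' hi' j' hj' => (hle1 i' hi' j' hj').trans hlt.le,
          fun j' hj' => ?_⟩
        rcases Nat.lt_succ_iff_lt_or_eq.mp hj' with h | rfl
        · exact (hle2 j' h).trans hlt.le
        · exact le_rfl
      · refine ⟨hu, hle1, fun j' hj' => ?_⟩
        rcases Nat.lt_succ_iff_lt_or_eq.mp hj' with h | rfl
        · exact hle2 j' h
        · exact not_lt.1 hlt

/-- Give chore `j` to agent `i` if the agent likes it. -/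
def initBody : Cmd :=
  .cond (likesTest (var 10) (var 11)) (.setNat 2 (.lit 0) (var 11) (var 10)) .skip

/-- Give chore `j` to an agent who likes it, if there is one. -/
def initChore : Cmd :=
  .seq (.setNat 2 (.lit 0) (var 11) (.get 0 (.lit 0) (.lit 0))) (.loop 10 0 initBody)

/-- Give every chore to an agent who likes it, if there is one. -/
def initProg : Cmd := .loop 11 1 initChore

/-- Each chore starts with the fictitious holder `n` and is overwritten by any agent who likes it,
so a final `n` certifies that nobody does. -/
theorem initProg_spec {s : Store} {n m : ℕ} {D : ℕ → ℕ → ℝ} (h : HasInput s n m D) :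
    Valid D n m ((initProg.den s).nat 2 0) := by
  have key := Cmd.den_loop_induction (v := 11) (b := 1) (C := initChore) (s := s)
    (fun j t => Valid D n j (t.nat 2 0)) (fun j hj => by omega) ?_
  · rw [h.chores] at key; exact key
  intro j t hj hv hf ht
  have h1 : HasInput t n m D := h.of_frame hf (by decide) (by decide)
  set t1 := (Cmd.setNat 2 (.lit 0) (var 11) (.get 0 (.lit 0) (.lit 0))).den t with ht1
  have h2 : HasInput t1 n m D := h1.den (by decide) (by decide)
  have h11 : t1.nat 11 0 0 = j := by simp [ht1, Store.setNat_nat, hv]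
  have hX : t1.nat 2 0 = Function.update (t.nat 2 0) j n := by
    simp [ht1, hv, h1.agents]
  have key := Cmd.den_loop_induction (v := 10) (b := 0) (C := initBody) (s := t1)
    (fun i t' => (∀ j' < j, t'.nat 2 0 j' = t.nat 2 0 j') ∧
      ((t'.nat 2 0 j < n ∧ Likes D (t'.nat 2 0 j) j) ∨
        (t'.nat 2 0 j = n ∧ ∀ i' < i, ¬ Likes D i' j))) ⟨?_, ?_⟩ ?_
  · rw [h2.agents] at key
    intro j' hj'
    change (_ ∧ Likes D (((Cmd.loop 10 0 initBody).den t1).nat 2 0 j') j') ∨ _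
    simp only [Store.setNat_nat_ne _ _ _ _ (show 2 ≠ 11 by decide)]
    rcases Nat.lt_succ_iff_lt_or_eq.mp hj' with hlt | rfl
    · have := ht j' hlt
      rw [← key.1 j' hlt] at this
      exact this
    · exact key.2
  · intro j' hj'
    rw [Store.setNat_nat_ne _ _ _ _ (show 2 ≠ 10 by decide), hX,
      Function.update_of_ne (by omega)]
  · right
    rw [Store.setNat_nat_ne _ _ _ _ (show 2 ≠ 10 by decide), hX]
    simp
  · intro i u hi hv' hf' ⟨hu1, hu2⟩
    have h3 : HasInput u n m D := h2.of_frame hf' (by decide) (by decide)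
    have h11' : u.nat 11 = t1.nat 11 := hf'.1 11 (by decide)
    rw [h2.agents] at hi
    simp only [initBody, Cmd.den_cond, Cmd.den_setNat, Cmd.den_skip, Test.Holds, NumExpr.eval,
      NatExpr.eval, hv', h11', h11, h3.disutility, Int.cast_one]
    split_ifs with hl
    · refine ⟨by simpa using hu1, ?_⟩
      simp only [Store.setNat_nat_ne _ _ _ _ (show 2 ≠ 10 by decide)]
      refine hu2.imp_right fun ⟨ha, hb⟩ => ⟨ha, fun i' hi' => ?_⟩
      rcases Nat.lt_succ_iff_lt_or_eq.mp hi' with h | rfl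
      · exact hb i' h
      · simpa [Likes] using hl
    · simp only [Store.setNat_nat_ne _ _ _ _ (show 2 ≠ 10 by decide), Store.setNat_row]
      refine ⟨fun j' hj' => ?_, Or.inl ?_⟩
      · rw [Function.update_of_ne (by omega), hu1 j' hj']
      · simpa using ⟨hi, hl⟩

/-! ### Searching for transfer chains -/

/-- Extend the marked set by agent `y`, if possible, along chore `j`. -/
def bfsStep : Cmd :=
  .cond (.and (.natLt (.lit 0) (ent 5 (ent 2 (var 13))))
      (.and (likesTest (var 14) (var 13)) (.not (.natLt (.lit 0) (ent 5 (var 14))))))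
    (.seq (.setNat 5 (.lit 0) (var 14) (.lit 1)) (.setNat 6 (.lit 0) (var 14) (var 13))) .skip

/-- Extend the marked set along all chores. -/
def bfsRound : Cmd := .loop 13 1 (.loop 14 0 bfsStep)

/-- Mark the source only. -/
def bfsInit : Cmd :=
  .seq (.loop 12 0 (.setNat 5 (.lit 0) (var 12) (.lit 0)))
    (.seq (.setNat 5 (.lit 0) (.get 0 (.lit 0) (.lit 0)) (.lit 0))
      (.setNat 5 (.lit 0) (var 20) (.lit 1)))

/-- Mark the agents reachable from the source in the variable `20`. -/
def bfs : Cmd := .seq bfsInit (.loop 12 0 bfsRound)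

/-- The last two clauses serve the count of rounds in `bfs_spec`: everything one hop away from the
old marks gets marked, and a closed set of marks does not grow. -/
theorem bfsRound_spec {s : Store} {n m : ℕ} {D : ℕ → ℕ → ℝ} (h : HasInput s n m D) {x : ℕ}
    (hV : Valid D n m (s.nat 2 0))
    (hT : ∃ r, IsTree D n m (s.nat 2 0) x (s.nat 5 0) (s.nat 6 0) r) :
    let t := bfsRound.den s
    (∃ r, IsTree D n m (s.nat 2 0) x (t.nat 5 0) (t.nat 6 0) r) ∧
      (∀ y, s.nat 5 0 y ≠ 0 → t.nat 5 0 y ≠ 0) ∧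
      (∀ j < m, ∀ y < n, s.nat 5 0 (s.nat 2 0 j) ≠ 0 → Likes D y j → t.nat 5 0 y ≠ 0) ∧
      (MarkClosed D n m (s.nat 2 0) (s.nat 5 0) → ∀ y, t.nat 5 0 y ≠ 0 → s.nat 5 0 y ≠ 0) := by
  intro t
  have key := Cmd.den_loop_induction (v := 13) (b := 1) (C := .loop 14 0 bfsStep) (s := s)
    (fun j t => (∃ r, IsTree D n m (s.nat 2 0) x (t.nat 5 0) (t.nat 6 0) r) ∧
      (∀ y, s.nat 5 0 y ≠ 0 → t.nat 5 0 y ≠ 0) ∧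
      (∀ j' < j, ∀ y < n, s.nat 5 0 (s.nat 2 0 j') ≠ 0 → Likes D y j' → t.nat 5 0 y ≠ 0) ∧
      (MarkClosed D n m (s.nat 2 0) (s.nat 5 0) → ∀ y, t.nat 5 0 y ≠ 0 → s.nat 5 0 y ≠ 0))
      (by
        simp only [Store.setNat_nat_ne _ _ _ _ (show 5 ≠ 13 by decide),
          Store.setNat_nat_ne _ _ _ _ (show 6 ≠ 13 by decide)]
        exact ⟨hT, fun _ h => h, by simp, fun _ _ h => h⟩) ?_
  · rw [h.chores] at key
    exact key
  intro j u hj hv hf ⟨hT, hmono, hdone, hcl⟩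
  rw [h.chores] at hj
  have h1 : HasInput u n m D := h.of_frame hf (by decide) (by decide)
  have hX : u.nat 2 = s.nat 2 := hf.1 2 (by decide)
  have key := Cmd.den_loop_induction (v := 14) (b := 0) (C := bfsStep) (s := u)
    (fun i t => (∃ r, IsTree D n m (s.nat 2 0) x (t.nat 5 0) (t.nat 6 0) r) ∧
      (∀ y, s.nat 5 0 y ≠ 0 → t.nat 5 0 y ≠ 0) ∧
      (∀ j' < j, ∀ y < n, s.nat 5 0 (s.nat 2 0 j') ≠ 0 → Likes D y j' → t.nat 5 0 y ≠ 0) ∧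
      (∀ y < i, s.nat 5 0 (s.nat 2 0 j) ≠ 0 → Likes D y j → t.nat 5 0 y ≠ 0) ∧
      (MarkClosed D n m (s.nat 2 0) (s.nat 5 0) → ∀ y, t.nat 5 0 y ≠ 0 → s.nat 5 0 y ≠ 0))
      (by
        simp only [Store.setNat_nat_ne _ _ _ _ (show 5 ≠ 14 by decide),
          Store.setNat_nat_ne _ _ _ _ (show 6 ≠ 14 by decide)]
        exact ⟨hT, hmono, hdone, by simp, hcl⟩) ?_
  · rw [h1.agents] at key
    simp only [Store.setNat_nat_ne _ _ _ _ (show 5 ≠ 13 by decide),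
          Store.setNat_nat_ne _ _ _ _ (show 6 ≠ 13 by decide)]
    refine ⟨key.1, key.2.1, fun j' hj' => ?_, key.2.2.2.2⟩
    rcases Nat.lt_succ_iff_lt_or_eq.mp hj' with h | rfl
    · exact key.2.2.1 j' h
    · exact key.2.2.2.1
  intro i t hi hv' hf' ⟨⟨r, hT⟩, hmono, hdone, hdone', hcl⟩
  rw [h1.agents] at hi
  have h2 : HasInput t n m D := h1.of_frame hf' (by decide) (by decide)
  have hX' : t.nat 2 = s.nat 2 := (hf'.1 2 (by decide)).trans hX
  have h13 : t.nat 13 = u.nat 13 := hf'.1 13 (by decide)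
  simp only [Store.setNat_nat_ne _ _ _ _ (show 5 ≠ 14 by decide),
    Store.setNat_nat_ne _ _ _ _ (show 6 ≠ 14 by decide), bfsStep, Cmd.den_cond, Cmd.den_seq,
    Cmd.den_setNat, Cmd.den_skip, Test.Holds, NumExpr.eval, NatExpr.eval, hv', h13, hv, h2.disutility, hX', Int.cast_one]
  split_ifs with hc
  · obtain ⟨hp, hl, hpy⟩ := hc
    have e5 : ((t.setNat 5 0 i 1).setNat 6 0 ((t.setNat 5 0 i 1).nat 14 0 0)
        ((t.setNat 5 0 i 1).nat 13 0 0)).nat 5 0 = Function.update (t.nat 5 0) i 1 := by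
      rw [Store.setNat_nat_ne _ _ _ _ (by decide), Store.setNat_row]
    have e6 : ((t.setNat 5 0 i 1).setNat 6 0 ((t.setNat 5 0 i 1).nat 14 0 0)
        ((t.setNat 5 0 i 1).nat 13 0 0)).nat 6 0 = Function.update (t.nat 6 0) i j := by
      rw [Store.setNat_row, Store.setNat_nat_ne _ _ _ _ (by decide),
        Store.setNat_nat_ne _ _ _ _ (by decide), Store.setNat_nat_ne _ _ _ _ (by decide),
        hv', h13, hv]
    rw [e5, e6]
    have hmono' : ∀ y, t.nat 5 0 y ≠ 0 → Function.update (t.nat 5 0) i 1 y ≠ 0 := by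
      intro y hy
      by_cases hyi : y = i <;> simp [hyi] ; simpa [hyi] using hy
    refine ⟨hT.insert hj (hV.le hj) hi hp.ne' hl (by omega), fun y hy => hmono' y (hmono y hy),
      fun j' hj' y hy h h' => hmono' y (hdone j' hj' y hy h h'), fun y hy h h' => ?_,
      fun hc y hy => ?_⟩
    · rcases Nat.lt_succ_iff_lt_or_eq.mp hy with h'' | rfl
      · exact hmono' y (hdone' y h'' h h')
      · simp
    · by_cases hyi : y = i
      · exact hyi ▸ hc j hj i hi (hcl hc _ hp.ne') hl
      · exact hcl hc y (by simpa [hyi] using hy)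
  · refine ⟨⟨r, hT⟩, hmono, hdone, fun y hy h h' => ?_, hcl⟩
    rcases Nat.lt_succ_iff_lt_or_eq.mp hy with h'' | rfl
    · exact hdone' y h'' h h'
    · by_contra hne
      exact hc ⟨Nat.pos_of_ne_zero (hmono _ h), h', by simp [hne]⟩

/-- The one-vertex tree, of rank 0. The loop clears only entries below `n`; the entry `n`, required
to be 0 by `IsTree.out`, is cleared separately. The old contents of the array `6` do not matter, as
the root has no parent. -/
theorem bfsInit_spec {s : Store} {n m : ℕ} {D : ℕ → ℕ → ℝ} (h : HasInput s n m D)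
    (hx : s.nat 20 0 0 < n) :
    ∃ r, IsTree D n m (s.nat 2 0) (s.nat 20 0 0) ((bfsInit.den s).nat 5 0)
      ((bfsInit.den s).nat 6 0) r := by
  set C : Cmd := Cmd.loop 12 0 (.setNat 5 (.lit 0) (var 12) (.lit 0)) with hC
  have key := Cmd.den_loop_induction (v := 12) (b := 0)
    (C := .setNat 5 (.lit 0) (var 12) (.lit 0)) (s := s)
    (fun i t => ∀ y < i, t.nat 5 0 y = 0) (by simp) (by
      intro i t hi hv hf ht y hy
      by_cases hyi : y = i
      · simp [hyi, hv]
      · simpa [hyi, hv] using ht y (by omega))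
  rw [h.agents] at key
  have hin : HasInput (C.den s) n m D := h.den (by decide) (by decide)
  have h20 := (C.frame_den s).1 20 (by decide)
  have e : (bfsInit.den s).nat 5 0 =
      Function.update (Function.update ((C.den s).nat 5 0) n 0) (s.nat 20 0 0) 1 := by
    simp [bfsInit, ← hC, hin.agents, h20]
  have h1 : ∀ y ≤ n, (bfsInit.den s).nat 5 0 y ≠ 0 → y = s.nat 20 0 0 := by
    intro y hy hne
    rw [e] at hne
    by_contra hyx
    rw [Function.update_of_ne hyx] at hne
    rcases hy.lt_or_eq with h | h
    · rw [Function.update_of_ne h.ne] at hne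
      exact hne (key y h)
    · simp [h] at hne
  have h2 : (bfsInit.den s).nat 5 0 (s.nat 20 0 0) ≠ 0 := by rw [e]; simp
  refine ⟨fun _ => 0, h2, ?_, fun y hy hp hyx => absurd (h1 y hy.le hp) hyx, fun y hy hp => ?_⟩
  · by_contra hne
    have := h1 n le_rfl hne
    omega
  · exact card_pos.2 ⟨y, by simpa using ⟨hy, hp⟩⟩

/-- After `i` rounds the marked set is closed or has more than `i` elements: a round that marks no
new agent proves closedness. Hence `n` rounds suffice. -/
theorem bfs_spec {s : Store} {n m : ℕ} {D : ℕ → ℕ → ℝ} (h : HasInput s n m D)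
    (hV : Valid D n m (s.nat 2 0)) (hx : s.nat 20 0 0 < n) :
    (∃ r, IsTree D n m (s.nat 2 0) (s.nat 20 0 0) ((bfs.den s).nat 5 0) ((bfs.den s).nat 6 0) r) ∧
      ∀ y < n, (bfs.den s).nat 5 0 y ≠ 0 ↔ Reach D n m (s.nat 2 0) (s.nat 20 0 0) y := by
  have hin : HasInput (bfsInit.den s) n m D := h.den (by decide) (by decide)
  have h2 := (bfsInit.frame_den s).1 2 (by decide)
  have key := Cmd.den_loop_induction (v := 12) (b := 0) (C := bfsRound) (s := bfsInit.den s)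
    (fun i t => (∃ r, IsTree D n m (s.nat 2 0) (s.nat 20 0 0) (t.nat 5 0) (t.nat 6 0) r) ∧
      (MarkClosed D n m (s.nat 2 0) (t.nat 5 0) ∨ i < #{z ∈ range n | t.nat 5 0 z ≠ 0})) ?_ ?_
  · rw [hin.agents] at key
    obtain ⟨⟨r, hT⟩, hc⟩ := key
    have hc : MarkClosed D n m (s.nat 2 0) ((bfs.den s).nat 5 0) := by
      rcases hc with hc | hc
      · exact hc
      · have := card_filter_le (range n)
          (fun z => ((Cmd.loop 12 0 bfsRound).den (bfsInit.den s)).nat 5 0 z ≠ 0)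
        rw [card_range] at this
        omega
    exact ⟨⟨r, hT⟩, fun y hy => ⟨hT.reach y hy, hc.of_reach hT.root⟩⟩
  · obtain ⟨r, hT⟩ := bfsInit_spec h hx
    have e5 : ((bfsInit.den s).setNat 12 0 0 0).nat 5 = (bfsInit.den s).nat 5 := by simp
    have e6 : ((bfsInit.den s).setNat 12 0 0 0).nat 6 = (bfsInit.den s).nat 6 := by simp
    rw [e5, e6]
    exact ⟨⟨r, hT⟩, Or.inr (card_pos.2 ⟨_, by simpa using ⟨hx, hT.root⟩⟩)⟩
  · intro i t hi hv hf ⟨hT, hc⟩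
    have h1 : HasInput t n m D := hin.of_frame hf (by decide) (by decide)
    have hX : t.nat 2 = s.nat 2 := (hf.1 2 (by decide)).trans h2
    obtain ⟨hT', hmono, hstep, hclosed⟩ := bfsRound_spec h1 (hX ▸ hV) (hX ▸ hT)
    rw [hX] at hT' hstep hclosed
    have e5 : ((bfsRound.den t).setNat 12 0 0 (i + 1)).nat 5 = (bfsRound.den t).nat 5 := by simp
    have e6 : ((bfsRound.den t).setNat 12 0 0 (i + 1)).nat 6 = (bfsRound.den t).nat 6 := by simp
    rw [e5, e6]
    refine ⟨hT', ?_⟩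
    by_cases hsub : ∀ y < n, (bfsRound.den t).nat 5 0 y ≠ 0 → t.nat 5 0 y ≠ 0
    · left
      intro j hj y hy hp hl
      obtain ⟨r', hT'⟩ := hT'
      have hXj : s.nat 2 0 j < n := lt_of_le_of_ne (hV.le hj) fun e => hp (e ▸ hT'.out)
      exact hstep j hj y hy (hsub _ hXj hp) hl
    · right
      push Not at hsub
      obtain ⟨y, hy, hp, hpy⟩ := hsub
      rcases hc with hc | hc
      · exact absurd hpy (hclosed hc y hp)
      · have : #{z ∈ range n | t.nat 5 0 z ≠ 0} <
            #{z ∈ range n | (bfsRound.den t).nat 5 0 z ≠ 0} := by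
          apply card_lt_card
          refine ⟨fun z hz => ?_, fun hss => ?_⟩
          · simp only [mem_filter] at hz ⊢
            exact ⟨hz.1, hmono z hz.2⟩
          · have := hss (by simpa using ⟨hy, hp⟩ : y ∈ _)
            simp [hpy] at this
        omega

/-! ### Balancing by transfer chains -/

/-- Write the bundle sizes to the array `4`. -/
def countProg : Cmd :=
  .seq (.loop 12 0 (.setNat 4 (.lit 0) (var 12) (.lit 0)))
    (.loop 13 1 (.setNat 4 (.lit 0) (ent 2 (var 13)) (.add (ent 4 (ent 2 (var 13))) (.lit 1))))

/-- Unassigned chores are counted in the entry `n`, which is not initialised; hence only `i < n`. -/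
theorem countProg_spec {s : Store} {n m : ℕ} {D : ℕ → ℕ → ℝ} (h : HasInput s n m D) :
    ∀ i < n, (countProg.den s).nat 4 0 i = cnt m (s.nat 2 0) i := by
  set C : Cmd := Cmd.loop 12 0 (.setNat 4 (.lit 0) (var 12) (.lit 0)) with hC
  have key := Cmd.den_loop_induction (v := 12) (b := 0)
    (C := .setNat 4 (.lit 0) (var 12) (.lit 0)) (s := s)
    (fun i t => ∀ y < i, t.nat 4 0 y = 0) (by simp) (by
      intro i t hi hv hf ht y hy
      by_cases hyi : y = i
      · simp [hyi, hv]
      · simpa [hyi, hv] using ht y (by omega))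
  rw [h.agents] at key
  have hin : HasInput (C.den s) n m D := h.den (by decide) (by decide)
  have h2 := (C.frame_den s).1 2 (by decide)
  have key' := Cmd.den_loop_induction (v := 13) (b := 1)
    (C := .setNat 4 (.lit 0) (ent 2 (var 13)) (.add (ent 4 (ent 2 (var 13))) (.lit 1)))
    (s := C.den s) (fun j t => ∀ i < n, t.nat 4 0 i = cnt j (s.nat 2 0) i)
    (fun i hi => by simpa [cnt_zero] using key i hi) (by
      intro j t hj hv hf ht i hi
      have hX : t.nat 2 = s.nat 2 := (hf.1 2 (by decide)).trans h2
      rw [cnt_succ]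
      by_cases hij : s.nat 2 0 j = i
      · subst hij
        simp [hv, hX, ht _ hi]
      · simp [hv, hX, ht _ hi, hij, Ne.symm hij])
  rw [hin.chores] at key'
  exact key'

/-- Look for a marked agent whose bundle is smaller by two than that of the source. -/
def pickProg : Cmd :=
  .seq (.setNat 21 (.lit 0) (.lit 0) (var 20))
    (.loop 12 0 (.cond (.and (.natLt (.lit 0) (ent 5 (var 12)))
        (.natLt (.add (ent 4 (var 12)) (.lit 1)) (ent 4 (var 20))))
      (.setNat 21 (.lit 0) (.lit 0) (var 12)) .skip))

/-- The source itself is the default answer when no improving target exists; the subsequent walk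
then has length zero. -/
theorem pickProg_spec {s : Store} {n m : ℕ} {D : ℕ → ℕ → ℝ} (h : HasInput s n m D) :
    let y := (pickProg.den s).nat 21 0 0
    (y = s.nat 20 0 0 ∧ ∀ z < n, s.nat 5 0 z ≠ 0 → s.nat 4 0 (s.nat 20 0 0) ≤ s.nat 4 0 z + 1) ∨
      (y < n ∧ s.nat 5 0 y ≠ 0 ∧ s.nat 4 0 y + 1 < s.nat 4 0 (s.nat 20 0 0)) := by
  set C : Cmd := .setNat 21 (.lit 0) (.lit 0) (var 20) with hC
  have hin : HasInput (C.den s) n m D := h.den (by decide) (by decide)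
  have key := Cmd.den_loop_induction (v := 12) (b := 0)
    (C := .cond (.and (.natLt (.lit 0) (ent 5 (var 12)))
        (.natLt (.add (ent 4 (var 12)) (.lit 1)) (ent 4 (var 20))))
      (.setNat 21 (.lit 0) (.lit 0) (var 12)) .skip) (s := C.den s)
    (fun i t => (t.nat 21 0 0 = s.nat 20 0 0 ∧
        ∀ z < i, s.nat 5 0 z ≠ 0 → s.nat 4 0 (s.nat 20 0 0) ≤ s.nat 4 0 z + 1) ∨
      (t.nat 21 0 0 < n ∧ s.nat 5 0 (t.nat 21 0 0) ≠ 0 ∧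
        s.nat 4 0 (t.nat 21 0 0) + 1 < s.nat 4 0 (s.nat 20 0 0)))
    (by left; simp [hC]) (by
      intro i t hi hv hf ht
      rw [hin.agents] at hi
      have h20 : t.nat 20 = s.nat 20 := (hf.1 20 (by decide)).trans (by simp [hC])
      have h4 : t.nat 4 = s.nat 4 := (hf.1 4 (by decide)).trans (by simp [hC])
      have h5 : t.nat 5 = s.nat 5 := (hf.1 5 (by decide)).trans (by simp [hC])
      simp only [Cmd.den_cond, Test.Holds, NatExpr.eval, hv, h20, h4, h5]
      split_ifs with hc
      · right
        simpa [hv, hi, Nat.pos_iff_ne_zero] using hc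
      · simp only [Cmd.den_skip, Store.setNat_nat_ne _ _ _ _ (show 21 ≠ 12 by decide)]
        refine ht.imp_left fun ⟨h1, h2⟩ => ⟨h1, fun z hz hp => ?_⟩
        rcases Nat.lt_succ_iff_lt_or_eq.mp hz with h' | rfl
        · exact h2 z h' hp
        · by_contra hlt
          exact hc ⟨Nat.pos_of_ne_zero hp, by omega⟩)
  rw [hin.agents] at key
  exact key

/-- Give the chore through which the variable `21` was marked to that agent, and go on with the
agent who held it. -/
def walkStep : Cmd :=
  .cond (.not (.and (.not (.natLt (var 21) (var 20))) (.not (.natLt (var 20) (var 21)))))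
    (.seq (.setNat 23 (.lit 0) (.lit 0) (ent 6 (var 21)))
      (.seq (.setNat 22 (.lit 0) (.lit 0) (ent 2 (var 23)))
        (.seq (.setNat 2 (.lit 0) (var 23) (var 21))
          (.setNat 21 (.lit 0) (.lit 0) (var 22))))) .skip

/-- Transfer chores along the chain from the source to the agent in the variable `21`. -/
def walkProg : Cmd := .loop 12 0 walkStep

/-- The chain is followed backwards from its end. Intermediate agents gain one chore and lose one.
Ranks decrease strictly, so the source is reached within `n` steps, and chores originally held by
agents of rank below the current one have not been touched, so the next chore still has its old
holder. -/
theorem walkProg_spec {s : Store} {n m : ℕ} {D : ℕ → ℕ → ℝ} (h : HasInput s n m D)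
    (hV : Valid D n m (s.nat 2 0)) {r : ℕ → ℕ}
    (hT : IsTree D n m (s.nat 2 0) (s.nat 20 0 0) (s.nat 5 0) (s.nat 6 0) r)
    (hy : s.nat 21 0 0 < n) (hpy : s.nat 5 0 (s.nat 21 0 0) ≠ 0) :
    let X := (walkProg.den s).nat 2 0
    Valid D n m X ∧
      (∀ a < n, cnt m X a + (if a = s.nat 20 0 0 then 1 else 0) =
        cnt m (s.nat 2 0) a + (if a = s.nat 21 0 0 then 1 else 0)) ∧
      (s.nat 21 0 0 = s.nat 20 0 0 → X = s.nat 2 0) := by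
  have key := Cmd.den_loop_induction (v := 12) (b := 0) (C := walkStep) (s := s)
    (fun i t => Valid D n m (t.nat 2 0) ∧ t.nat 21 0 0 < n ∧ s.nat 5 0 (t.nat 21 0 0) ≠ 0 ∧
      (t.nat 21 0 0 = s.nat 20 0 0 ∨ r (t.nat 21 0 0) + i ≤ r (s.nat 21 0 0)) ∧
      (∀ j < m, r (s.nat 2 0 j) < r (t.nat 21 0 0) → t.nat 2 0 j = s.nat 2 0 j) ∧
      (∀ a < n, cnt m (t.nat 2 0) a + (if a = t.nat 21 0 0 then 1 else 0) =
        cnt m (s.nat 2 0) a + (if a = s.nat 21 0 0 then 1 else 0)) ∧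
      (s.nat 21 0 0 = s.nat 20 0 0 → t.nat 2 0 = s.nat 2 0 ∧ t.nat 21 0 0 = s.nat 20 0 0))
    ?_ ?_
  · rw [h.agents] at key
    obtain ⟨h1, h2, h3, h4, h5, h6, h7⟩ := key
    refine ⟨h1, ?_, fun e => (h7 e).1⟩
    have hr : r (s.nat 21 0 0) < n :=
      (hT.rank_lt _ hy hpy).trans_le ((card_filter_le _ _).trans (by simp))
    have e : ((Cmd.loop 12 0 walkStep).den s).nat 21 0 0 = s.nat 20 0 0 := by
      rcases h4 with h4 | h4
      · exact h4
      · omega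
    rw [e] at h6
    exact h6
  · simp only [Store.setNat_nat_ne _ _ _ _ (show 2 ≠ 12 by decide),
      Store.setNat_nat_ne _ _ _ _ (show 21 ≠ 12 by decide)]
    exact ⟨hV, hy, hpy, by simp, by simp, by simp, by simp⟩
  · intro i t hi hv hf ⟨h1, h2, h3, h4, h5, h6, h7⟩
    have h20 : t.nat 20 = s.nat 20 := hf.1 20 (by decide)
    have e6 : t.nat 6 = s.nat 6 := hf.1 6 (by decide)
    simp only [Store.setNat_nat_ne _ _ _ _ (show 2 ≠ 12 by decide),
      Store.setNat_nat_ne _ _ _ _ (show 21 ≠ 12 by decide), walkStep, Cmd.den_cond, Test.Holds,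
      NatExpr.eval, h20]
    by_cases hx : t.nat 21 0 0 = s.nat 20 0 0
    · rw [if_neg (by omega)]
      exact ⟨h1, h2, h3, Or.inl hx, h5, h6, h7⟩
    · rw [if_pos (by omega)]
      obtain ⟨g1, g2, g3, g4, g5⟩ := hT.parent _ h2 h3 hx
      have hX := h5 _ g1 g5
      simp only [Cmd.den_seq, Cmd.den_setNat, NatExpr.eval, e6, Store.setNat_row, ne_eq,
        Store.setNat_nat_ne _ _ _ _ (show 2 ≠ 21 by decide),
        Store.setNat_nat_ne _ _ _ _ (show 2 ≠ 22 by decide),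
        Store.setNat_nat_ne _ _ _ _ (show 2 ≠ 23 by decide),
        Store.setNat_nat_ne _ _ _ _ (show 21 ≠ 2 by decide),
        Store.setNat_nat_ne _ _ _ _ (show 21 ≠ 22 by decide),
        Store.setNat_nat_ne _ _ _ _ (show 21 ≠ 23 by decide),
        Store.setNat_nat_ne _ _ _ _ (show 22 ≠ 2 by decide),
        Store.setNat_nat_ne _ _ _ _ (show 23 ≠ 22 by decide), Function.update_self, hX]
      refine ⟨?_, g3, g4, Or.inr ?_, ?_, ?_, ?_⟩
      · intro j hj
        by_cases hjv : j = s.nat 6 0 (t.nat 21 0 0)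
        · subst hjv
          simpa using Or.inl ⟨h2, g2⟩
        · rw [Function.update_of_ne hjv]
          exact h1 j hj
      · omega
      · intro j hj hr
        have hjv : j ≠ s.nat 6 0 (t.nat 21 0 0) := by rintro rfl; omega
        rw [Function.update_of_ne hjv]
        exact h5 j hj (by omega)
      · intro a ha
        have q1 := cnt_update (t.nat 2 0) g1 (t.nat 21 0 0) a
        have q2 := h6 a ha
        rw [hX] at q1
        omega
      · intro e
        exact absurd (h7 e).2 hx

/-- Try to improve the balance by a transfer chain from each agent. -/
def sweepBody : Cmd := .seq bfs (.seq countProg (.seq pickProg walkProg))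

theorem sweepBody_spec {s : Store} {n m : ℕ} {D : ℕ → ℕ → ℝ} (h : HasInput s n m D)
    (hV : Valid D n m (s.nat 2 0)) (hx : s.nat 20 0 0 < n) :
    let X := (sweepBody.den s).nat 2 0
    Valid D n m X ∧ ((sqSum n m X < sqSum n m (s.nat 2 0) ∧ ¬ Stable D n m (s.nat 2 0)) ∨
      X = s.nat 2 0 ∧ ∀ y < n, Reach D n m (s.nat 2 0) (s.nat 20 0 0) y →
        cnt m (s.nat 2 0) (s.nat 20 0 0) ≤ cnt m (s.nat 2 0) y + 1) := by
  intro X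
  obtain ⟨⟨r, hT⟩, hr⟩ := bfs_spec h hV hx
  set s1 := bfs.den s with hs1
  have i1 : HasInput s1 n m D := h.den (by decide) (by decide)
  have f12 : s1.nat 2 = s.nat 2 := (bfs.frame_den s).1 2 (by decide)
  have f120 : s1.nat 20 = s.nat 20 := (bfs.frame_den s).1 20 (by decide)
  have hc := countProg_spec i1
  set s2 := countProg.den s1 with hs2
  have i2 : HasInput s2 n m D := i1.den (by decide) (by decide)
  have f2 := fun a ha => (countProg.frame_den s1).1 a ha
  have f22 : s2.nat 2 = s.nat 2 := (f2 2 (by decide)).trans f12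
  have f220 : s2.nat 20 = s.nat 20 := (f2 20 (by decide)).trans f120
  have f25 : s2.nat 5 = s1.nat 5 := f2 5 (by decide)
  have f26 : s2.nat 6 = s1.nat 6 := f2 6 (by decide)
  have hp := pickProg_spec i2
  set s3 := pickProg.den s2 with hs3
  have i3 : HasInput s3 n m D := i2.den (by decide) (by decide)
  have f3 := fun a ha => (pickProg.frame_den s2).1 a ha
  have f32 : s3.nat 2 = s.nat 2 := (f3 2 (by decide)).trans f22
  have f320 : s3.nat 20 = s.nat 20 := (f3 20 (by decide)).trans f220
  have f35 : s3.nat 5 = s1.nat 5 := (f3 5 (by decide)).trans f25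
  have f36 : s3.nat 6 = s1.nat 6 := (f3 6 (by decide)).trans f26
  rw [f12] at hc
  simp only [f220, f25, hc _ hx] at hp
  have hlt : s3.nat 21 0 0 < n := by
    rcases hp with hp | hp
    · rw [hp.1]; exact hx
    · exact hp.1
  have hm : s1.nat 5 0 (s3.nat 21 0 0) ≠ 0 := by
    rcases hp with hp | hp
    · rw [hp.1]; exact hT.root
    · exact hp.2.1
  obtain ⟨w1, w2, w3⟩ := walkProg_spec (r := r) i3 (by rw [f32]; exact hV)
    (by rw [f32, f320, f35, f36]; exact hT) hlt (by rw [f35]; exact hm)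
  rw [f32, f320] at w2 w3
  refine ⟨w1, ?_⟩
  rcases hp with hp | hp
  · right
    refine ⟨w3 hp.1, fun y hy hxy => ?_⟩
    have := hp.2 y hy ((hr y hy).2 hxy)
    rwa [hc y hy] at this
  · left
    rw [hc _ hlt] at hp
    refine ⟨sqSum_lt hx hlt hp.2.2 w2, fun hs => ?_⟩
    have := hs _ hx _ hlt ((hr _ hlt).1 hp.2.1)
    omega

/-- Try to improve the balance by a transfer chain from each agent. -/
def sweepProg : Cmd := .loop 20 0 sweepBody

/-- What was checked for earlier sources concerns the original assignment and becomes worthless once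
it changes. The invariant therefore has two alternatives: the potential has already dropped, or
nothing has moved and all sources so far are harmless. -/
theorem sweepProg_spec {s : Store} {n m : ℕ} {D : ℕ → ℕ → ℝ} (h : HasInput s n m D)
    (hV : Valid D n m (s.nat 2 0)) :
    let X := (sweepProg.den s).nat 2 0
    Valid D n m X ∧ (Stable D n m X ∨ sqSum n m X < sqSum n m (s.nat 2 0)) ∧
      (Stable D n m (s.nat 2 0) → X = s.nat 2 0) := by
  have key := Cmd.den_loop_induction (v := 20) (b := 0) (C := sweepBody) (s := s)
    (fun i t => Valid D n m (t.nat 2 0) ∧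
      ((sqSum n m (t.nat 2 0) < sqSum n m (s.nat 2 0) ∧ ¬ Stable D n m (s.nat 2 0)) ∨
      t.nat 2 0 = s.nat 2 0 ∧ ∀ x < i, ∀ y < n, Reach D n m (s.nat 2 0) x y →
        cnt m (s.nat 2 0) x ≤ cnt m (s.nat 2 0) y + 1)) ?_ ?_
  · rw [h.agents] at key
    obtain ⟨h1, h2⟩ := key
    refine ⟨h1, ?_, fun hs => ?_⟩
    · rcases h2 with h2 | h2
      · exact Or.inr h2.1
      · left
        change Stable D n m (((Cmd.loop 20 0 sweepBody).den s).nat 2 0)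
        rw [h2.1]
        exact h2.2
    · rcases h2 with h2 | h2
      · exact absurd hs h2.2
      · exact h2.1
  · simp only [Store.setNat_nat_ne _ _ _ _ (show 2 ≠ 20 by decide)]
    exact ⟨hV, Or.inr ⟨trivial, by simp⟩⟩
  · intro i t hi hv hf ⟨h1, h2⟩
    rw [h.agents] at hi
    have ht : HasInput t n m D := h.of_frame hf (by decide) (by decide)
    obtain ⟨g1, g2⟩ := sweepBody_spec ht h1 (by rw [hv]; exact hi)
    simp only [Store.setNat_nat_ne _ _ _ _ (show 2 ≠ 20 by decide)]
    refine ⟨g1, ?_⟩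
    rcases h2 with h2 | h2
    · left
      rcases g2 with g2 | g2
      · exact ⟨g2.1.trans h2.1, h2.2⟩
      · rw [g2.1]; exact h2
    · rw [h2.1, hv] at g2
      rcases g2 with g2 | g2
      · exact Or.inl g2
      · right
        refine ⟨g2.1, fun x hx => ?_⟩
        rcases Nat.lt_succ_iff_lt_or_eq.mp hx with h' | rfl
        · exact h2.2 x h'
        · exact g2.2

/-- Balance the bundles by transfer chains. -/
def balanceProg : Cmd := .loop 15 1 (.loop 16 1 sweepProg)

/-- The potential `sqSum` is at most `m * m` and drops in every sweep that does not end in a stable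
assignment; the two nested loops provide `m * m` sweeps. -/
theorem balanceProg_spec {s : Store} {n m : ℕ} {D : ℕ → ℕ → ℝ} (h : HasInput s n m D)
    (hV : Valid D n m (s.nat 2 0)) :
    Valid D n m ((balanceProg.den s).nat 2 0) ∧ Stable D n m ((balanceProg.den s).nat 2 0) := by
  have inner : ∀ (t : Store) (i : ℕ), HasInput t n m D → Valid D n m (t.nat 2 0) →
      (Stable D n m (t.nat 2 0) ∨ sqSum n m (t.nat 2 0) + i * m ≤ m * m) →
      Valid D n m (((Cmd.loop 16 1 sweepProg).den t).nat 2 0) ∧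
      (Stable D n m (((Cmd.loop 16 1 sweepProg).den t).nat 2 0) ∨
        sqSum n m (((Cmd.loop 16 1 sweepProg).den t).nat 2 0) + (i + 1) * m ≤ m * m) := by
    intro t i ht hVt hst
    have key := Cmd.den_loop_induction (v := 16) (b := 1) (C := sweepProg) (s := t)
      (fun j u => Valid D n m (u.nat 2 0) ∧
        (Stable D n m (u.nat 2 0) ∨ sqSum n m (u.nat 2 0) + i * m + j ≤ m * m)) ?_ ?_
    · rw [ht.chores] at key
      rw [add_mul, one_mul, ← add_assoc]
      exact key
    · simp only [Store.setNat_nat_ne _ _ _ _ (show 2 ≠ 16 by decide)]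
      exact ⟨hVt, by simpa using hst⟩
    · intro j u hj hv hf ⟨h1, h2⟩
      have hu : HasInput u n m D := ht.of_frame hf (by decide) (by decide)
      obtain ⟨g1, g2, g3⟩ := sweepProg_spec hu h1
      simp only [Store.setNat_nat_ne _ _ _ _ (show 2 ≠ 16 by decide)]
      refine ⟨g1, ?_⟩
      rcases h2 with h2 | h2
      · rw [g3 h2]; exact Or.inl h2
      · exact g2.imp_right fun _ => by omega
  have key := Cmd.den_loop_induction (v := 15) (b := 1) (C := .loop 16 1 sweepProg) (s := s)
    (fun i t => Valid D n m (t.nat 2 0) ∧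
      (Stable D n m (t.nat 2 0) ∨ sqSum n m (t.nat 2 0) + i * m ≤ m * m)) ?_ ?_
  · rw [h.chores] at key
    refine ⟨key.1, ?_⟩
    rcases key.2 with h2 | h2
    · exact h2
    -- A potential that dropped in all `m * m` sweeps is now 0, so all bundles are empty and
    -- stability is trivial.
    · intro x hx y hy _
      have h0 : sqSum n m ((balanceProg.den s).nat 2 0) = 0 := by
        change sqSum n m (((Cmd.loop 15 1 (.loop 16 1 sweepProg)).den s).nat 2 0) = 0
        omega
      have := (sum_eq_zero_iff.1 h0) x (mem_range.2 hx)
      have : cnt m ((balanceProg.den s).nat 2 0) x = 0 := by simpa using this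
      omega
  · simp only [Store.setNat_nat_ne _ _ _ _ (show 2 ≠ 15 by decide)]
    exact ⟨hV, Or.inr (by simpa using sqSum_le n m _)⟩
  · intro i t hi hv hf ⟨h1, h2⟩
    simp only [Store.setNat_nat_ne _ _ _ _ (show 2 ≠ 15 by decide)]
    exact inner t i (h.of_frame hf (by decide) (by decide)) h1 h2

/-! ### Computing the levels -/

/-- Raise the level of every marked agent to the bundle size of the source. -/
def levelStep : Cmd :=
  .cond (.and (.natLt (.lit 0) (ent 5 (var 13))) (.natLt (ent 3 (var 13)) (ent 4 (var 20))))
    (.setNat 3 (.lit 0) (var 13) (ent 4 (var 20))) .skip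

/-- Raise the level of every agent reachable from the source to the bundle size of the source. -/
def levelBody : Cmd := .seq bfs (.loop 13 0 levelStep)

/-- Initialise the levels and the bundle sizes. -/
def levelInit : Cmd := .seq (.loop 12 0 (.setNat 3 (.lit 0) (var 12) (.lit 0))) countProg

/-- Write the levels of the agents to the array `3`. -/
def levelProg : Cmd := .seq levelInit (.loop 20 0 levelBody)

theorem levelBody_spec {s : Store} {n m : ℕ} {D : ℕ → ℕ → ℝ} (h : HasInput s n m D)
    (hV : Valid D n m (s.nat 2 0)) (hx : s.nat 20 0 0 < n) :
    ∀ y < n, (s.nat 3 0 y ≤ (levelBody.den s).nat 3 0 y) ∧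
      ((levelBody.den s).nat 3 0 y = s.nat 3 0 y ∨ (levelBody.den s).nat 3 0 y =
        s.nat 4 0 (s.nat 20 0 0) ∧ Reach D n m (s.nat 2 0) (s.nat 20 0 0) y) ∧
      (Reach D n m (s.nat 2 0) (s.nat 20 0 0) y →
        s.nat 4 0 (s.nat 20 0 0) ≤ (levelBody.den s).nat 3 0 y) := by
  obtain ⟨-, hr⟩ := bfs_spec h hV hx
  have hin : HasInput (bfs.den s) n m D := h.den (by decide) (by decide)
  have f3 := (bfs.frame_den s).1 3 (by decide)
  have f4 := (bfs.frame_den s).1 4 (by decide)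
  have f20 := (bfs.frame_den s).1 20 (by decide)
  have key := Cmd.den_loop_induction (v := 13) (b := 0) (C := levelStep) (s := bfs.den s)
    (fun i t => ∀ y < n, (s.nat 3 0 y ≤ t.nat 3 0 y) ∧ (t.nat 3 0 y = s.nat 3 0 y ∨
      t.nat 3 0 y = s.nat 4 0 (s.nat 20 0 0) ∧ Reach D n m (s.nat 2 0) (s.nat 20 0 0) y) ∧
      (y < i → Reach D n m (s.nat 2 0) (s.nat 20 0 0) y →
        s.nat 4 0 (s.nat 20 0 0) ≤ t.nat 3 0 y)) ?_ ?_
  · rw [hin.agents] at key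
    exact fun y hy => ⟨(key y hy).1, (key y hy).2.1, (key y hy).2.2 hy⟩
  · intro y hy
    simp [f3]
  · intro i t hi hv hf ht y hy
    rw [hin.agents] at hi
    have g4 : t.nat 4 = s.nat 4 := (hf.1 4 (by decide)).trans f4
    have g20 : t.nat 20 = s.nat 20 := (hf.1 20 (by decide)).trans f20
    have g5 : t.nat 5 = (bfs.den s).nat 5 := hf.1 5 (by decide)
    obtain ⟨t1, t2, t3⟩ := ht y hy
    have hri := hr i hi
    simp only [Store.setNat_nat_ne _ _ _ _ (show 3 ≠ 13 by decide), levelStep, Cmd.den_cond,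
      Test.Holds, NatExpr.eval, hv, g4, g20, g5, Cmd.den_setNat, Cmd.den_skip]
    split_ifs with hc
    · rw [Store.setNat_row]
      by_cases hyi : y = i
      · subst hyi
        have := hri.1 hc.1.ne'
        simp only [Function.update_self]
        exact ⟨by omega, Or.inr ⟨trivial, this⟩, fun _ _ => le_rfl⟩
      · rw [Function.update_of_ne hyi]
        exact ⟨t1, t2, fun hlt => t3 (by omega)⟩
    · refine ⟨t1, t2, fun hlt hre => ?_⟩
      rcases Nat.lt_succ_iff_lt_or_eq.mp hlt with h' | rfl
      · exact t3 h' hre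
      · have := hri.2 hre
        by_contra hlt'
        exact hc ⟨Nat.pos_of_ne_zero this, by omega⟩

theorem levelProg_spec {s : Store} {n m : ℕ} {D : ℕ → ℕ → ℝ} (h : HasInput s n m D)
    (hV : Valid D n m (s.nat 2 0)) (hs : Stable D n m (s.nat 2 0)) :
    Leveled D n m (s.nat 2 0) ((levelProg.den s).nat 3 0) := by
  set C : Cmd := Cmd.loop 12 0 (.setNat 3 (.lit 0) (var 12) (.lit 0)) with hC
  have key0 := Cmd.den_loop_induction (v := 12) (b := 0)
    (C := .setNat 3 (.lit 0) (var 12) (.lit 0)) (s := s)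
    (fun i t => ∀ y < i, t.nat 3 0 y = 0) (by simp) (by
      intro i t hi hv hf ht y hy
      by_cases hyi : y = i
      · simp [hyi, hv]
      · simpa [hyi, hv] using ht y (by omega))
  rw [h.agents] at key0
  have hin : HasInput (C.den s) n m D := h.den (by decide) (by decide)
  have e2 := (C.frame_den s).1 2 (by decide)
  have hc := countProg_spec hin
  set s1 := countProg.den (C.den s) with hs1
  have i1 : HasInput s1 n m D := hin.den (by decide) (by decide)
  have f3 : s1.nat 3 = (C.den s).nat 3 := (countProg.frame_den (C.den s)).1 3 (by decide)
  have f2 : s1.nat 2 = s.nat 2 := ((countProg.frame_den (C.den s)).1 2 (by decide)).trans e2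
  rw [e2] at hc
  have key := Cmd.den_loop_induction (v := 20) (b := 0) (C := levelBody) (s := s1)
    (fun i t => ∀ y < n, (t.nat 3 0 y = 0 ∨ ∃ x < n, Reach D n m (s.nat 2 0) x y ∧
      t.nat 3 0 y = cnt m (s.nat 2 0) x) ∧ ∀ x < i, Reach D n m (s.nat 2 0) x y →
      cnt m (s.nat 2 0) x ≤ t.nat 3 0 y) ?_ ?_
  · rw [i1.agents] at key
    exact Leveled.of_stable hV hs (fun y hy => (key y hy).1) fun y hy => (key y hy).2
  · intro y hy
    refine ⟨Or.inl ?_, by simp⟩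
    simpa [f3] using key0 y hy
  · intro i t hi hv hf ht y hy
    rw [i1.agents] at hi
    have hin' : HasInput t n m D := i1.of_frame hf (by decide) (by decide)
    have g2 : t.nat 2 = s.nat 2 := (hf.1 2 (by decide)).trans f2
    have g4 : t.nat 4 = s1.nat 4 := hf.1 4 (by decide)
    have hb := levelBody_spec hin' (by rw [g2]; exact hV) (by rw [hv]; exact hi) y hy
    rw [g2, hv, g4, hc i hi] at hb
    obtain ⟨b1, b2, b3⟩ := hb
    simp only [Store.setNat_nat_ne _ _ _ _ (show 3 ≠ 20 by decide)]
    refine ⟨?_, fun x hx hr => ?_⟩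
    · rcases b2 with b2 | b2
      · rw [b2]; exact (ht y hy).1
      · exact Or.inr ⟨i, hi, b2.2, b2.1⟩
    · rcases Nat.lt_succ_iff_lt_or_eq.mp hx with h' | rfl
      · exact ((ht y hy).2 x h' hr).trans b1
      · exact b3 hr

/-! ### Prices at a threshold and transfers of high-priced chores -/

/-- The total weight of the chores that `Y` gives to `i`. -/
noncomputable def load (m : ℕ) (w : ℕ → ℝ) (Y : ℕ → ℕ) (i : ℕ) : ℝ :=
  ∑ j ∈ range m, if Y j = i then w j else 0

theorem load_update {m : ℕ} (w : ℕ → ℝ) (Y : ℕ → ℕ) {j : ℕ} (hj : j < m) (u a : ℕ) :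
    load m w (Function.update Y j u) a =
      load m w Y a + (if a = u then w j else 0) - (if a = Y j then w j else 0) := by
  unfold load
  rw [← add_sum_erase _ _ (mem_range.2 hj),
    ← add_sum_erase (range m) (fun j => if Y j = a then w j else 0) (mem_range.2 hj)]
  have : ∑ x ∈ (range m).erase j, (if Function.update Y j u x = a then w x else 0) =
      ∑ x ∈ (range m).erase j, if Y x = a then w x else 0 := by
    apply sum_congr rfl
    intro x hx
    rw [Function.update_of_ne (ne_of_mem_erase hx)]
  rw [this, Function.update_self]
  simp only [eq_comm (a := a)]
  ring

theorem load_nonneg {m : ℕ} {w : ℕ → ℝ} (hw : ∀ j < m, 0 ≤ w j) (Y : ℕ → ℕ) (i : ℕ) :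
    0 ≤ load m w Y i :=
  sum_nonneg fun j hj => by split_ifs; exacts [hw j (mem_range.1 hj), le_rfl]

/-- The chore is assigned to an agent of level at most `t`. -/
def Low (n : ℕ) (X hi : ℕ → ℕ) (t j : ℕ) : Prop := X j < n ∧ hi (X j) ≤ t

instance (n : ℕ) (X hi : ℕ → ℕ) (t j : ℕ) : Decidable (Low n X hi t j) :=
  inferInstanceAs (Decidable (_ ∧ _))

/-- The prices of the chores at threshold `t`. -/
def price (n : ℕ) (K : ℝ) (X hi : ℕ → ℕ) (t j : ℕ) : ℝ := if Low n X hi t j then 1 else K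

theorem price_pos {n : ℕ} {K : ℝ} (hK : 1 ≤ K) (X hi : ℕ → ℕ) (t j : ℕ) :
    0 ≤ price n K X hi t j := by
  unfold price; split_ifs <;> linarith

/-- An invariant of the transfers of high-priced chores to agents of level at most `t`. -/
structure Spread (n m : ℕ) (K : ℝ) (X hi : ℕ → ℕ) (t : ℕ) (Y : ℕ → ℕ) : Prop where
  low : ∀ j < m, Low n X hi t j → Y j = X j
  high : ∀ j < m, ¬ Low n X hi t j → (Y j < n ∧ hi (Y j) ≤ t) ∨ Y j = X j
  top : ∀ j < m, ¬ Low n X hi t j → Y j < n → hi (Y j) ≤ t → ∀ u < n, hi u ≤ t →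
    load m (price n K X hi t) Y (Y j) - K ≤ load m (price n K X hi t) Y u
  reduced_max : ∀ j < m, X j < n → t < hi (X j) → Y j ≠ X j → ∀ i < n, t < hi i →
    load m (price n K X hi t) Y i ≤ load m (price n K X hi t) Y (X j) + K
  reduced_top : ∀ j < m, X j < n → t < hi (X j) → Y j ≠ X j → ∀ j' < m, ¬ Low n X hi t j' →
    Y j' < n → hi (Y j') ≤ t →
    load m (price n K X hi t) Y (Y j') - K ≤ load m (price n K X hi t) Y (X j)
  bound : (∃ i < n, t < hi i) → ∀ j < m, ¬ Low n X hi t j → Y j < n → hi (Y j) ≤ t →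
    load m (price n K X hi t) Y (Y j) - K ≤ K * t

/-- The transfers of high-priced chores have come to an end. -/
structure Settled (n m : ℕ) (K : ℝ) (X hi : ℕ → ℕ) (t : ℕ) (Y : ℕ → ℕ) : Prop
    extends Spread n m K X hi t Y where
  assigned : ∀ j < m, Y j < n
  settled : ∀ i < n, t < hi i → ∀ u < n, hi u ≤ t →
    load m (price n K X hi t) Y i - K ≤ load m (price n K X hi t) Y u

/-- The transfers at the next higher threshold leave some agent with a small load. -/
def Failed (n m : ℕ) (K : ℝ) (X hi : ℕ → ℕ) (t : ℕ) : Prop :=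
  ∃ Y, Settled n m K X hi (t + 1) Y ∧ ∃ a < n, load m (price n K X hi (t + 1)) Y a < t

section

variable {D : ℕ → ℕ → ℝ} {n m : ℕ} {K : ℝ} {X hi : ℕ → ℕ} {t : ℕ} {Y : ℕ → ℕ}

theorem load_eq_card (w : ℕ → ℝ) (P : ℕ → Prop) [DecidablePred P] (u : ℕ)
    (h1 : ∀ j < m, Y j = u → ¬ P j → w j = 1) (h2 : ∀ j < m, Y j = u → P j → w j = K) :
    load m w Y u = #{j ∈ range m | Y j = u ∧ ¬ P j} + K * #{j ∈ range m | Y j = u ∧ P j} := by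
  unfold load
  rw [card_filter, card_filter]
  push_cast
  rw [mul_sum, ← sum_add_distrib]
  apply sum_congr rfl
  intro j hj
  rw [mem_range] at hj
  by_cases hu : Y j = u
  · by_cases hP : P j
    · simp [hu, hP, h2 j hj hu hP]
    · simp [hu, hP, h1 j hj hu hP]
  · simp [hu]

/-- Transfers only feed agents of level at most `t`, so bundles above the threshold can only shrink.
-/
theorem Spread.eq_of_high_level (h : Spread n m K X hi t Y) {j : ℕ} (hj : j < m)
    (ht : t < hi (Y j)) : Y j = X j ∧ ¬ Low n X hi t j := by
  have hl : ¬ Low n X hi t j := by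
    intro hl
    rw [h.low j hj hl] at ht
    have := hl.2
    omega
  rcases h.high j hj hl with h' | h'
  · omega
  · exact ⟨h', hl⟩

theorem Spread.load_high (h : Spread n m K X hi t Y) {i : ℕ} (ht : t < hi i) :
    load m (price n K X hi t) Y i = K * cnt m Y i := by
  rw [load_eq_card (K := K) _ (fun _ => True) i (by simp)]
  · simp [cnt]
  · intro j hj hji _
    subst hji
    exact if_neg (h.eq_of_high_level hj ht).2

theorem exists_reduced {i : ℕ}
    (hc : cnt m Y i < cnt m X i) : ∃ j < m, X j = i ∧ Y j ≠ i := by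
  by_contra! hne
  refine absurd hc (not_lt.2 (card_le_card fun j hj => ?_))
  simp only [mem_filter, mem_range] at hj ⊢
  exact ⟨hj.1, hne j hj.1 hj.2⟩

/-- Double counting of the set `E` of chores of price `K` at threshold `t + 1`. If all light agents
had load at least `t`, then every agent would hold at least as many chores of `E` in `Y` as in the
failed distribution `Y'`, and the poor agent `a` strictly more. But `Y'` hands out all of `E`. -/
theorem Spread.exists_load_lt (hL : Leveled D n m X hi) (hK : 1 ≤ K) (h : Spread n m K X hi t Y)
    (hf : Failed n m K X hi t)
    (hR : ∀ i < n, t + 1 < hi i → K * (t + 1) ≤ load m (price n K X hi t) Y i)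
    (hR' : ∀ j < m, X j < n → hi (X j) = t + 1 → Y j = X j) :
    ∃ u < n, hi u ≤ t ∧ load m (price n K X hi t) Y u < t := by
  obtain ⟨Y', hY', a, ha, hlt⟩ := hf
  by_contra! hge
  set E : ℕ → Prop := fun j => ¬ Low n X hi (t + 1) j with hE
  set e : ℕ → ℕ := fun u => #{j ∈ range m | Y j = u ∧ E j} with he
  set e' : ℕ → ℕ := fun u => #{j ∈ range m | Y' j = u ∧ E j} with he'
  have hcntE : ∀ u, hi u ≤ t + 1 → u < n → ∀ Z : ℕ → ℕ,
      (∀ j < m, Low n X hi (t + 1) j → Z j = X j) →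
      #{j ∈ range m | Z j = u ∧ ¬ E j} = cnt m X u := by
    intro u hu hun Z hZ
    unfold cnt
    congr 1
    apply filter_congr
    intro j hj
    rw [mem_range] at hj
    simp only [hE, not_not]
    constructor
    · rintro ⟨rfl, h2⟩; exact (hZ j hj h2).symm
    · rintro rfl
      exact ⟨hZ j hj ⟨hun, hu⟩, ⟨hun, hu⟩⟩
  have hlow : ∀ j < m, Low n X hi (t + 1) j → Y j = X j := by
    intro j hj hl
    rcases Nat.lt_succ_iff_lt_or_eq.mp (Nat.lt_succ_of_le hl.2) with h' | h'
    · exact h.low j hj ⟨hl.1, by omega⟩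
    · exact hR' j hj hl.1 h'
  -- Chores of agents of level `t + 1` are the ones whose price differs between the two thresholds.
  -- By `hR'` they have not moved, so light agents hold none of them.
  have L1 : ∀ u < n, hi u ≤ t → load m (price n K X hi t) Y u = cnt m X u + K * e u := by
    intro u hu hut
    rw [load_eq_card (K := K) _ E u, hcntE u (by omega) hu Y hlow]
    · intro j hj hju hjE
      refine if_pos ?_
      have hl : Low n X hi (t + 1) j := not_not.1 hjE
      have := hlow j hj hl
      exact ⟨hl.1, by rw [← this, hju]; exact hut⟩
    · intro j hj hju hjE
      refine if_neg fun hl => hjE ⟨hl.1, ?_⟩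
      have := hl.2
      omega
  have L1' : ∀ u < n, hi u ≤ t + 1 →
      load m (price n K X hi (t + 1)) Y' u = cnt m X u + K * e' u := by
    intro u hu hut
    rw [load_eq_card (K := K) _ E u, hcntE u hut hu Y' hY'.low]
    · exact fun j hj hju hjE => if_pos (not_not.1 hjE)
    · exact fun j hj hju hjE => if_neg hjE
  have L2 : ∀ i < n, t + 1 < hi i → e i = cnt m Y i := by
    intro i hi' hti
    simp only [he, cnt]
    congr 1
    apply filter_congr
    intro j hj
    rw [mem_range] at hj
    refine ⟨fun h => h.1, fun hji => ⟨hji, fun hl => ?_⟩⟩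
    rw [← hji, hlow j hj hl] at hti
    have := hl.2
    omega
  have L2' : ∀ i < n, t + 1 < hi i → e' i = cnt m Y' i := by
    intro i hi' hti
    simp only [he', cnt]
    congr 1
    apply filter_congr
    intro j hj
    rw [mem_range] at hj
    refine ⟨fun h => h.1, fun hji => ⟨hji, fun hl => ?_⟩⟩
    rw [← hji, hY'.low j hj hl] at hti
    have := hl.2
    omega
  -- Such an `a` had at least `t + 1` chores in `X`, but a load below `t` leaves it fewer than `t`.
  have hred : t + 1 < hi a → ∃ j < m, X j = a ∧ Y' j ≠ a := by
    intro hta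
    apply exists_reduced
    have h1 := hY'.load_high hta
    have h2 := hL.le_cnt a ha
    rw [h1] at hlt
    have h3 : (cnt m Y' a : ℝ) < t := by
      have : (0 : ℝ) ≤ cnt m Y' a := by positivity
      nlinarith
    have : cnt m Y' a < t := by exact_mod_cast h3
    omega
  have S1 : ∀ u < n, hi u ≤ t + 1 → 0 < e' u →
      load m (price n K X hi (t + 1)) Y' u - K < t := by
    intro u hu hut hpos
    obtain ⟨j, hj⟩ := card_pos.1 hpos
    simp only [mem_filter, mem_range] at hj
    obtain ⟨hj, rfl, hjE⟩ := hj
    by_cases hta : t + 1 < hi a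
    · obtain ⟨j', hj', rfl, hne⟩ := hred hta
      exact (hY'.reduced_top j' hj' ha hta hne j hj hjE hu hut).trans_lt hlt
    · exact (hY'.top j hj hjE hu hut a ha (by omega)).trans_lt hlt
  have S2 : ∀ i < n, t + 1 < hi i → e' i ≤ t := by
    intro i hin hti
    have h1 : load m (price n K X hi (t + 1)) Y' i < t + K := by
      by_cases hta : t + 1 < hi a
      · obtain ⟨j', hj', rfl, hne⟩ := hred hta
        have := hY'.reduced_max j' hj' ha hta hne i hin hti
        linarith
      · have := hY'.settled i hin hti a ha (by omega)
        linarith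
    rw [hY'.load_high hti, ← L2' i hin hti] at h1
    by_contra! hlt'
    have h2 : ((t : ℝ) + 1) ≤ e' i := by exact_mod_cast hlt'
    have h3 : (0 : ℝ) ≤ t := by positivity
    nlinarith
  -- At level at most `t`, one more chore of `E` in `Y'` would push the load less `K` to at least
  -- `t`, against `S1`. At level `t + 1` the agent's own chores alone cost at least `t`, so `S1`
  -- allows no chore of `E`. Above, `hR` gives `e u ≥ t + 1` and `S2` gives `e' u ≤ t`.
  have hle : ∀ u ∈ range n, e' u ≤ e u := by
    intro u hu
    rw [mem_range] at hu
    rcases lt_trichotomy (hi u) (t + 1) with h1 | h1 | h1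
    · by_contra! hlt'
      have h2 := S1 u hu h1.le (by omega)
      rw [L1' u hu h1.le] at h2
      have h3 := hge u hu (by omega)
      rw [L1 u hu (by omega)] at h3
      have h4 : (e u : ℝ) + 1 ≤ e' u := by exact_mod_cast hlt'
      nlinarith
    · rcases Nat.eq_zero_or_pos (e' u) with h0 | h0
      · omega
      · exfalso
        have h2 := S1 u hu h1.le h0
        rw [L1' u hu h1.le] at h2
        have h3 := hL.le_cnt u hu
        have h4 : (t : ℝ) ≤ cnt m X u := by exact_mod_cast (by omega : t ≤ cnt m X u)
        have h5 : (1 : ℝ) ≤ e' u := by exact_mod_cast h0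
        nlinarith
    · have h2 := hR u hu h1
      rw [h.load_high (by omega), ← L2 u hu h1] at h2
      have h3 : ((t : ℝ) + 1) ≤ e u := by nlinarith
      have h4 : t + 1 ≤ e u := by exact_mod_cast h3
      have := S2 u hu h1
      omega
  have hstrict : e' a < e a := by
    by_cases hta : t + 1 < hi a
    · have h2 := hR a ha hta
      rw [h.load_high (by omega), ← L2 a ha hta] at h2
      have h3 : ((t : ℝ) + 1) ≤ e a := by nlinarith
      have h4 : t + 1 ≤ e a := by exact_mod_cast h3
      have := S2 a ha hta
      omega
    · rw [L1' a ha (by omega)] at hlt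
      have h5 : (0 : ℝ) ≤ e' a := by positivity
      have h6 : (cnt m X a : ℝ) < t := by nlinarith
      have h7 : cnt m X a < t := by exact_mod_cast h6
      -- With fewer than `t` chores in `X`, the level of `a` is at most `t`, so `hge` applies to it.
      have h8 := hL.le_cnt a ha
      have h9 := hge a ha (by omega)
      rw [L1 a ha (by omega)] at h9
      have : (e' a : ℝ) < e a := by nlinarith
      exact_mod_cast this
  have hsum := sum_lt_sum hle ⟨a, mem_range.2 ha, hstrict⟩
  have hs' : ∑ u ∈ range n, e' u = #{j ∈ range m | E j} := by
    rw [card_eq_sum_card_fiberwise (f := Y') (t := range n)]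
    · apply sum_congr rfl
      intro u _
      rw [filter_filter]
      simp only [he']
      congr 1
      apply filter_congr
      intro j _
      exact and_comm
    · intro j hj
      simp only [coe_filter, Set.mem_ofPred_eq, mem_range] at hj
      simpa using hY'.assigned j hj.1
  have hs : ∑ u ∈ range n, e u ≤ #{j ∈ range m | E j} := by
    have : ∀ u, e u = #{j ∈ {j ∈ range m | E j} | Y j = u} := by
      intro u
      rw [filter_filter]
      simp only [he]
      congr 1
      apply filter_congr
      intro j _
      exact and_comm
    simp only [this]
    rw [← card_biUnion]
    · apply card_le_card
      intro j hj
      simp only [mem_biUnion, mem_filter] at hj ⊢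
      obtain ⟨_, _, hj, _⟩ := hj
      exact hj
    · intro u _ v _ huv
      rw [Function.onFun, disjoint_left]
      intro j h1 h2
      simp only [mem_filter] at h1 h2
      exact huv (h1.2.symm.trans h2.2)
  omega

/-- If threshold `t + 1` fails, then at threshold `t` there is an agent of small load. -/
theorem Spread.small_or_reduced (hL : Leveled D n m X hi) (hK : 1 ≤ K)
    (h : Spread n m K X hi t Y) (hf : Failed n m K X hi t) :
    (∃ u < n, hi u ≤ t ∧ load m (price n K X hi t) Y u < t) ∨
      ∃ j < m, X j < n ∧ t < hi (X j) ∧ Y j ≠ X j ∧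
        load m (price n K X hi t) Y (X j) ≤ K * t := by
  -- The failure of either hypothesis of `Spread.exists_load_lt` exhibits an agent above the
  -- threshold that has lost a chore and keeps at most `t`, each of price `K`.
  by_cases hR : ∀ i < n, t + 1 < hi i → K * (t + 1) ≤ load m (price n K X hi t) Y i
  · by_cases hR' : ∀ j < m, X j < n → hi (X j) = t + 1 → Y j = X j
    · exact Or.inl (h.exists_load_lt hL hK hf hR hR')
    · right
      push Not at hR'
      obtain ⟨j, hj, hX, ht, hne⟩ := hR'
      refine ⟨j, hj, hX, by omega, hne, ?_⟩
      rw [h.load_high (by omega)]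
      have h1 : cnt m Y (X j) < cnt m X (X j) := by
        apply card_lt_card
        refine ⟨fun j' hj' => ?_, fun hss => ?_⟩
        · simp only [mem_filter, mem_range] at hj' ⊢
          refine ⟨hj'.1, ?_⟩
          have := (h.eq_of_high_level hj'.1 (by rw [hj'.2]; omega)).1
          rw [← this, hj'.2]
        · have := hss (by simpa using hj : j ∈ _)
          simp only [mem_filter] at this
          exact hne this.2
      have h2 := hL.cnt_le _ hX
      have h3 : (cnt m Y (X j) : ℝ) ≤ t := by exact_mod_cast (by omega : cnt m Y (X j) ≤ t)
      nlinarith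
  · right
    push Not at hR
    obtain ⟨i, hin, ht, hlt⟩ := hR
    rw [h.load_high (by omega)] at hlt
    have h1 : (cnt m Y i : ℝ) < t + 1 := by nlinarith
    have h2 : cnt m Y i < t + 1 := by exact_mod_cast h1
    have h3 := hL.le_cnt i hin
    obtain ⟨j, hj, rfl, hne⟩ := exists_reduced (i := i) (Y := Y) (by omega : _ < cnt m X i)
    refine ⟨j, hj, hin, by omega, hne, ?_⟩
    rw [h.load_high (by omega)]
    have h4 : (cnt m Y (X j) : ℝ) ≤ t := by exact_mod_cast (by omega : cnt m Y (X j) ≤ t)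
    nlinarith

/-- Giving a high-priced chore to an agent of least load preserves the invariant. -/
theorem Spread.step (hL : Leveled D n m X hi) (hK : 1 ≤ K) (h : Spread n m K X hi t Y)
    (hf : (∀ i < n, hi i ≤ t) ∨ Failed n m K X hi t) {j u : ℕ} (hj : j < m)
    (hjX : Y j = X j) (hlj : ¬ Low n X hi t j) (hu : u < n) (hut : hi u ≤ t)
    (hmin : ∀ v < n, hi v ≤ t → load m (price n K X hi t) Y u ≤ load m (price n K X hi t) Y v)
    (hcase : (X j = n ∧ ∀ j' < m, X j' < n → Y j' = X j') ∨
      (X j < n ∧ (∀ i < n, t < hi i → load m (price n K X hi t) Y i ≤ load m (price n K X hi t) Y (X j)) ∧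
        load m (price n K X hi t) Y u + K < load m (price n K X hi t) Y (X j))) :
    Spread n m K X hi t (Function.update Y j u) := by
  have hwj : price n K X hi t j = K := if_neg hlj
  have htX : X j < n → t < hi (X j) := fun h0 => not_le.1 fun hle => hlj ⟨h0, hle⟩
  have hl : ∀ a, load m (price n K X hi t) (Function.update Y j u) a =
      load m (price n K X hi t) Y a + (if a = u then K else 0) - (if a = X j then K else 0) := by
    intro a
    rw [load_update _ _ hj, hwj, hjX]
  have hneX : ∀ a < n, hi a ≤ t → a ≠ X j := by
    rintro a ha hat rfl
    exact hlj ⟨ha, hat⟩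
  have huX := hneX u hu hut
  have hlU : ∀ a < n, hi a ≤ t → load m (price n K X hi t) (Function.update Y j u) a =
      load m (price n K X hi t) Y a + (if a = u then K else 0) := by
    intro a ha hat
    rw [hl, if_neg (hneX a ha hat)]
    ring
  have hlR : ∀ i, t < hi i → load m (price n K X hi t) (Function.update Y j u) i =
      load m (price n K X hi t) Y i - (if i = X j then K else 0) := by
    intro i hti
    rw [hl, if_neg (by rintro rfl; omega)]
    ring
  have hlUle : ∀ a < n, hi a ≤ t → load m (price n K X hi t) Y a ≤
      load m (price n K X hi t) (Function.update Y j u) a := by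
    intro a ha hat
    rw [hlU a ha hat]
    split_ifs <;> linarith
  -- holders of high-priced chores below the threshold
  have hold : ∀ j' < m, ¬ Low n X hi t j' → Function.update Y j u j' < n →
      hi (Function.update Y j u j') ≤ t → (Function.update Y j u j' = u ∧
        load m (price n K X hi t) (Function.update Y j u) (Function.update Y j u j') - K =
          load m (price n K X hi t) Y u) ∨
      (Function.update Y j u j' = Y j' ∧
        load m (price n K X hi t) (Function.update Y j u) (Function.update Y j u j') =
          load m (price n K X hi t) Y (Y j')) := by
    intro j' hj' hlj' hn ht
    by_cases hju : Function.update Y j u j' = u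
    · left
      refine ⟨hju, ?_⟩
      rw [hju, hlU u hu hut, if_pos rfl]
      ring
    · right
      have hjj : j' ≠ j := by rintro rfl; simp at hju
      have e : Function.update Y j u j' = Y j' := Function.update_of_ne hjj _ _
      refine ⟨e, ?_⟩
      rw [hlU _ hn ht, if_neg hju, e]
      ring
  refine ⟨?_, ?_, ?_, ?_, ?_, ?_⟩
  · intro j' hj' hl'
    have : j' ≠ j := by rintro rfl; exact hlj hl'
    rw [Function.update_of_ne this]
    exact h.low j' hj' hl'
  · intro j' hj' hl'
    by_cases hjj : j' = j
    · subst hjj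
      simp [hu, hut]
    · rw [Function.update_of_ne hjj]
      exact h.high j' hj' hl'
  · intro j' hj' hl' hn ht v hv hvt
    refine le_trans ?_ (hlUle v hv hvt)
    rcases hold j' hj' hl' hn ht with ⟨_, e⟩ | ⟨e, e'⟩
    · rw [e]; exact hmin v hv hvt
    · rw [e']
      rw [e] at hn ht
      exact h.top j' hj' hl' hn ht v hv hvt
  · intro j' hj' hX ht hne i hin hti
    rw [hlR _ hti, hlR _ ht]
    -- While unliked chores are handed out, no agent has lost anything. Later the giver `X j` had
    -- the largest load above the threshold, so after losing `K` it is still within `K` of the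
    -- others.
    rcases hcase with ⟨h1, h2⟩ | ⟨h0, h1, h2⟩
    · exfalso
      have hjj : j' ≠ j := by rintro rfl; omega
      rw [Function.update_of_ne hjj] at hne
      exact hne (h2 j' hj' hX)
    · by_cases hXX : X j' = X j
      · rw [if_pos hXX, hXX]
        have := h1 i hin hti
        split_ifs <;> linarith
      · have hjj : j' ≠ j := by rintro rfl; exact hXX rfl
        rw [Function.update_of_ne hjj] at hne
        have := h.reduced_max j' hj' hX ht hne i hin hti
        rw [if_neg hXX]
        split_ifs <;> linarith
  · intro j' hj' hX ht hne j'' hj'' hl'' hn'' ht''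
    rw [hlR _ ht]
    rcases hcase with ⟨h1, h2⟩ | ⟨h0, h1, h2⟩
    · exfalso
      have hjj : j' ≠ j := by rintro rfl; omega
      rw [Function.update_of_ne hjj] at hne
      exact hne (h2 j' hj' hX)
    · by_cases hXX : X j' = X j
      -- The giver still has more than the old load of `u`, because the transfer requires a gap
      -- larger than `K`; and by `top` no recipient of high-priced chores exceeds the old load of
      -- `u` by more than `K`.
      · rw [if_pos hXX, hXX]
        rcases hold j'' hj'' hl'' hn'' ht'' with ⟨_, e⟩ | ⟨e, e'⟩
        · rw [e]; linarith
        · rw [e']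
          rw [e] at hn'' ht''
          have := h.top j'' hj'' hl'' hn'' ht'' u hu hut
          linarith
      · have hjj : j' ≠ j := by rintro rfl; exact hXX rfl
        rw [Function.update_of_ne hjj] at hne
        rw [if_neg hXX, sub_zero]
        rcases hold j'' hj'' hl'' hn'' ht'' with ⟨_, e⟩ | ⟨e, e'⟩
        · rw [e]
          have := h.reduced_max j' hj' hX ht hne (X j) h0 (htX h0)
          linarith
        · rw [e']
          rw [e] at hn'' ht''
          exact h.reduced_top j' hj' hX ht hne j'' hj'' hl'' hn'' ht''
  · intro hex j' hj' hl' hn ht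
    -- The failure at `t + 1` enters here. Either some light agent has load below `t`, and `u` has
    -- the least load; or some reduced agent has load at most `K * t`, the giver has at most `K`
    -- more than that, and `u` is more than `K` below the giver.
    have key : load m (price n K X hi t) Y u ≤ K * t := by
      rcases hf with hf | hf
      · obtain ⟨i, hin, hti⟩ := hex
        have := hf i hin
        omega
      · rcases h.small_or_reduced hL hK hf with ⟨v, hv, hvt, hlt⟩ | ⟨j1, hj1, hX, ht1, hne, hle⟩
        · have h1 := hmin v hv hvt
          have : (0 : ℝ) ≤ t := by positivity
          nlinarith
        · rcases hcase with ⟨h1, h2⟩ | ⟨h0, h1, h2⟩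
          · exact absurd (h2 j1 hj1 hX) hne
          · have := h.reduced_max j1 hj1 hX ht1 hne (X j) h0 (htX h0)
            linarith
    rcases hold j' hj' hl' hn ht with ⟨_, e⟩ | ⟨e, e'⟩
    · rw [e]; exact key
    · rw [e']
      rw [e] at hn ht
      exact h.bound hex j' hj' hl' hn ht

end

/-! ### Supporting prices and fairness in prices -/

/-- Prices that support the assignment: the agents in `U` have weight `1`, the others weight `K`. -/
structure Supported (D : ℕ → ℕ → ℝ) (n m : ℕ) (K : ℝ) (U : ℕ → Prop) (w : ℕ → ℝ) (Y : ℕ → ℕ) :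
    Prop where
  assigned : ∀ j < m, Y j < n
  price_cases : ∀ j < m, w j = 1 ∨ w j = K
  price_le : ∀ j < m, ∀ i < n, U i → w j ≤ D i j
  eq_of_light : ∀ j < m, U (Y j) → D (Y j) j = w j
  eq_of_heavy : ∀ j < m, ¬ U (Y j) → D (Y j) j = 1 ∧ w j = K

/-- Envy-freeness in prices, up to one chore. -/
structure PriceFair (n m : ℕ) (K : ℝ) (w : ℕ → ℝ) (Y : ℕ → ℕ) : Prop where
  high : ∀ j < m, w j = K → ∀ h < n, load m w Y (Y j) - K ≤ load m w Y h
  ones : ∀ i < n, (∀ j < m, Y j = i → w j = 1) → ∀ h < n, load m w Y i - 1 ≤ load m w Y h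

section

variable {D : ℕ → ℕ → ℝ} {n m : ℕ} {K : ℝ} {X hi : ℕ → ℕ} {t : ℕ} {Y : ℕ → ℕ}

/-- By monotonicity of levels, a holder of a chore liked by an agent of level at most `t` has level
at most `t` as well. So light agents dislike all high-priced chores, whereas agents above the
threshold keep only chores they like. -/
theorem Settled.supported (hL : Leveled D n m X hi) (hK : 1 ≤ K)
    (hD : ∀ i < n, ∀ j < m, D i j = 1 ∨ D i j = K) (h : Settled n m K X hi t Y) :
    Supported D n m K (fun i => hi i ≤ t) (price n K X hi t) Y := by
  have hlike : ∀ i < n, ∀ j < m, Likes D i j → D i j = 1 := by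
    intro i hin j hj hl
    rcases hD i hin j hj with h1 | h1
    · exact h1
    · rw [Likes, h1, not_lt] at hl
      rw [h1]; exact le_antisymm hl hK
  have hdis : ∀ i < n, ∀ j < m, ¬ Likes D i j → D i j = K := by
    intro i hin j hj hl
    rcases hD i hin j hj with h1 | h1
    · simp [Likes, h1] at hl
    · exact h1
  have hhigh : ∀ j < m, ¬ Low n X hi t j → ∀ i < n, hi i ≤ t → D i j = K := by
    intro j hj hlow i hin hit
    apply hdis i hin j hj
    intro hl
    rcases hL.valid j hj with ⟨h1, _⟩ | ⟨_, h1⟩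
    · exact hlow ⟨h1, (hL.mono j hj h1 i hin hl).trans hit⟩
    · exact h1 i hin hl
  refine ⟨h.assigned, ?_, ?_, ?_, ?_⟩
  · intro j hj
    unfold price
    split_ifs <;> simp
  · intro j hj i hin hit
    unfold price
    split_ifs with hl
    · rcases hD i hin j hj with h1 | h1 <;> rw [h1]
      exact hK
    · exact (hhigh j hj hl i hin hit).ge
  · intro j hj hit
    unfold price
    split_ifs with hl
    · rw [h.low j hj hl]
      rcases hL.valid j hj with ⟨h1, h2⟩ | ⟨h1, _⟩
      · exact hlike _ h1 j hj h2
      · have := hl.1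
        omega
    · exact hhigh j hj hl _ (h.assigned j hj) hit
  · intro j hj hit
    obtain ⟨e, hl⟩ := h.eq_of_high_level hj (not_le.1 hit)
    refine ⟨?_, if_neg hl⟩
    have hn := h.assigned j hj
    rw [e] at hn ⊢
    rcases hL.valid j hj with ⟨h1, h2⟩ | ⟨h1, _⟩
    · exact hlike _ h1 j hj h2
    · omega

/-- Envy towards agents that have lost a chore is bounded by the invariants `reduced_max` and
`reduced_top`, envy towards light agents by `top` and `settled`. The remaining targets are heavy
agents that kept everything; their load is at least `K * t`, against which `bound` and the failure
at `t + 1` are used. -/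
theorem Settled.fair (hL : Leveled D n m X hi) (hK : 1 ≤ K) (h : Settled n m K X hi t Y)
    (hf : (∀ i < n, hi i ≤ t) ∨ Failed n m K X hi t)
    (hs : ∀ a < n, (t : ℝ) - 1 ≤ load m (price n K X hi t) Y a) :
    PriceFair n m K (price n K X hi t) Y := by
  have hnn : ∀ i, 0 ≤ load m (price n K X hi t) Y i :=
    load_nonneg (fun j _ => price_pos hK _ _ _ _) Y
  have ht0 : (0 : ℝ) ≤ t := by positivity
  -- A heavy agent that kept all its chores has at least `hi a - 1 ≥ t` of them, of price `K` each.
  have hunred : ∀ a < n, t < hi a → (∃ j < m, X j = a ∧ Y j ≠ a) ∨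
      K * t ≤ load m (price n K X hi t) Y a := by
    intro a ha hta
    by_cases hc : cnt m Y a < cnt m X a
    · exact Or.inl (exists_reduced hc)
    · right
      have h1 := hL.le_cnt a ha
      rw [h.load_high hta]
      have h2 : (t : ℝ) ≤ cnt m Y a := by exact_mod_cast (by omega : t ≤ cnt m Y a)
      nlinarith
  have A : ∀ j < m, ¬ Low n X hi t j → ∀ a < n,
      load m (price n K X hi t) Y (Y j) - K ≤ load m (price n K X hi t) Y a := by
    intro j hj hl a ha
    by_cases hjt : hi (Y j) ≤ t
    · by_cases hat : hi a ≤ t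
      · exact h.top j hj hl (h.assigned j hj) hjt a ha hat
      · rcases hunred a ha (not_le.1 hat) with ⟨j1, hj1, rfl, hne⟩ | hle
        · exact h.reduced_top j1 hj1 ha (not_le.1 hat) hne j hj hl (h.assigned j hj) hjt
        · exact (h.bound ⟨a, ha, not_le.1 hat⟩ j hj hl (h.assigned j hj) hjt).trans hle
    · have hYj := h.assigned j hj
      by_cases hat : hi a ≤ t
      · exact h.settled _ hYj (not_le.1 hjt) a ha hat
      · rcases hunred a ha (not_le.1 hat) with ⟨j1, hj1, rfl, hne⟩ | hle
        · have := h.reduced_max j1 hj1 ha (not_le.1 hat) hne _ hYj (not_le.1 hjt)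
          linarith
        · rcases hf with hf | hf
          · exact absurd (hf a ha) hat
          · rcases h.small_or_reduced hL hK hf with ⟨v, hv, hvt, hlt⟩ | ⟨j1, hj1, hX, h1, hne, hl1⟩
            · have := h.settled _ hYj (not_le.1 hjt) v hv hvt
              nlinarith
            · have := h.reduced_max j1 hj1 hX h1 hne _ hYj (not_le.1 hjt)
              linarith
  -- An owner of cheap chores only has at most `cnt m X i ≤ hi i ≤ t` of them, and `hs` says that
  -- nobody has load below `t - 1`.
  have B : ∀ i < n, hi i ≤ t → (∀ j < m, Y j = i → Low n X hi t j) → ∀ a < n,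
      load m (price n K X hi t) Y i - 1 ≤ load m (price n K X hi t) Y a := by
    intro i hin hit hall a ha
    refine le_trans ?_ (hs a ha)
    rw [load_eq_card (K := K) (price n K X hi t) (fun _ => False) i
      (fun j hj hji _ => if_pos (hall j hj hji)) (by simp)]
    have h1 : #{j ∈ range m | Y j = i ∧ ¬ False} ≤ cnt m X i := by
      apply card_le_card
      intro j hj
      simp only [mem_filter, mem_range, not_false_eq_true, and_true] at hj ⊢
      refine ⟨hj.1, ?_⟩
      rw [← h.low j hj.1 (hall j hj.1 hj.2), hj.2]
    have h2 := hL.cnt_le i hin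
    have h3 : (#{j ∈ range m | Y j = i ∧ ¬ False} : ℝ) ≤ t := by
      exact_mod_cast (h1.trans h2).trans hit
    simp only [and_false, filter_false, card_empty, Nat.cast_zero, mul_zero, add_zero]
    linarith
  refine ⟨fun j hj hw a ha => ?_, fun i hin hall a ha => ?_⟩
  · by_cases hl : Low n X hi t j
    -- A cheap chore of price `K` means `K = 1`, where the two kinds of price coincide.
    · have hK1 : K = 1 := by rw [← hw, price, if_pos hl]
      by_cases hex : ∃ j' < m, Y j' = Y j ∧ ¬ Low n X hi t j'
      · obtain ⟨j', hj', e, hl'⟩ := hex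
        rw [← e]
        exact A j' hj' hl' a ha
      · push Not at hex
        have := B (Y j) (h.assigned j hj) (by rw [h.low j hj hl]; exact hl.2) hex a ha
        rw [hK1] at this ⊢
        exact this
    · exact A j hj hl a ha
  · by_cases hex : ∃ j' < m, Y j' = i ∧ ¬ Low n X hi t j'
    · obtain ⟨j', hj', rfl, hl'⟩ := hex
      have hK1 : K = 1 := by
        rw [← hall j' hj' rfl, price, if_neg hl']
      have := A j' hj' hl' a ha
      linarith
    · push Not at hex
      by_cases hit : hi i ≤ t
      · exact B i hin hit hex a ha
      · have : load m (price n K X hi t) Y i = 0 := by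
          apply sum_eq_zero
          intro j hj
          rw [mem_range] at hj
          refine if_neg fun e => ?_
          have h1 := hex j hj e
          exact (h.eq_of_high_level hj (by rw [e]; exact not_le.1 hit)).2 h1
        have := hnn a
        linarith

theorem Spread.initial : Spread n m K X hi t X where
  low _ _ _ := rfl
  high _ _ _ := Or.inr rfl
  top _ _ hl hn ht := absurd ⟨hn, ht⟩ hl
  reduced_max _ _ _ _ hne := absurd rfl hne
  reduced_top _ _ _ _ hne := absurd rfl hne
  bound _ _ _ hl hn ht := absurd ⟨hn, ht⟩ hl

/-- Guarantees a recipient for transfers: a failure at `t + 1` yields a light agent of small load,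
or a chore that has left its holder, necessarily for a light agent. -/
theorem Spread.exists_low_level (hn : 0 < n) (hL : Leveled D n m X hi) (hK : 1 ≤ K)
    (h : Spread n m K X hi t Y) (hf : (∀ i < n, hi i ≤ t) ∨ Failed n m K X hi t) :
    ∃ u < n, hi u ≤ t := by
  rcases hf with hf | hf
  · exact ⟨0, hn, hf 0 hn⟩
  · rcases h.small_or_reduced hL hK hf with ⟨v, hv, hvt, _⟩ | ⟨j, hj, hX, ht, hne, _⟩
    · exact ⟨v, hv, hvt⟩
    · rcases h.high j hj (fun hl => by have := hl.2; omega) with h1 | h1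
      · exact ⟨_, h1.1, h1.2⟩
      · exact absurd h1 hne

/-- The number of chores held above the threshold drops when such a chore is transferred. -/
theorem card_high_update {j u : ℕ} (hj : j < m) (hY : t < hi (Y j)) (hu : hi u ≤ t) :
    #{x ∈ range m | t < hi (Function.update Y j u x)} < #{x ∈ range m | t < hi (Y x)} := by
  apply card_lt_card
  refine ⟨fun x hx => ?_, fun hss => ?_⟩
  · simp only [mem_filter, mem_range] at hx ⊢
    refine ⟨hx.1, ?_⟩
    by_cases hxj : x = j
    · rw [hxj]; exact hY
    · rw [Function.update_of_ne hxj] at hx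
      exact hx.2
  · have := hss (by simpa using ⟨hj, hY⟩ : j ∈ _)
    simp only [mem_filter, Function.update_self] at this
    omega

end

/-! ### The program that distributes chores at a threshold -/

theorem load_zero (w : ℕ → ℝ) (Y : ℕ → ℕ) (i : ℕ) : load 0 w Y i = 0 := by simp [load]

theorem load_succ (m : ℕ) (w : ℕ → ℝ) (Y : ℕ → ℕ) (i : ℕ) :
    load (m + 1) w Y i = load m w Y i + if Y m = i then w m else 0 := by
  rw [load, sum_range_succ]; rfl

/-- Search, among the agents satisfying `b`, for a best one; the result is the number of agents if
there is none. -/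
def argProg (v : ℕ) (b better : Test) : Cmd :=
  .seq (.setNat v (.lit 0) (.lit 0) (.get 0 (.lit 0) (.lit 0)))
    (.loop 12 0 (.cond (.and b (.not (.and (.natLt (var v) (.get 0 (.lit 0) (.lit 0)))
      (.not better)))) (.setNat v (.lit 0) (.lit 0) (var 12)) .skip))

/-- The tests are arbitrary syntax, so their meaning is assumed on all stores differing from `s` at
most in the counter and the result. `better` has to be meaningful only when the result is a genuine
agent, since the initial `n` is always replaced. Maximisation uses a negated `f`. -/
theorem argProg_spec {s : Store} {n m : ℕ} {D : ℕ → ℕ → ℝ} (h : HasInput s n m D) {v : ℕ}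
    {b better : Test} (hv0 : v ≠ 0) (hv : v ≠ 12) (B : ℕ → Prop) (f : ℕ → ℝ)
    (hb : ∀ t, t.num = s.num → (∀ a, a ≠ v → a ≠ 12 → t.nat a = s.nat a) → t.nat 12 0 0 < n →
      (b.Holds t ↔ B (t.nat 12 0 0)))
    (hbetter : ∀ t, t.num = s.num → (∀ a, a ≠ v → a ≠ 12 → t.nat a = s.nat a) →
      t.nat 12 0 0 < n → t.nat v 0 0 < n →
      (better.Holds t ↔ f (t.nat 12 0 0) < f (t.nat v 0 0))) :
    let u := ((argProg v b better).den s).nat v 0 0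
    (u = n ∧ ∀ i < n, ¬ B i) ∨ (u < n ∧ B u ∧ ∀ i < n, B i → f u ≤ f i) := by
  set C : Cmd := .setNat v (.lit 0) (.lit 0) (.get 0 (.lit 0) (.lit 0)) with hC
  have hin : HasInput (C.den s) n m D := h.den (by simp [hC, Cmd.natWrites, hv0.symm])
    (by simp [hC, Cmd.numWrites])
  have key := Cmd.den_loop_induction (v := 12) (b := 0) (s := C.den s)
    (C := .cond (.and b (.not (.and (.natLt (var v) (.get 0 (.lit 0) (.lit 0)))
      (.not better)))) (.setNat v (.lit 0) (.lit 0) (var 12)) .skip)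
    (fun i t => (t.nat v 0 0 = n ∧ ∀ x < i, ¬ B x) ∨
      (t.nat v 0 0 < n ∧ B (t.nat v 0 0) ∧ ∀ x < i, B x → f (t.nat v 0 0) ≤ f x))
    (by
      left
      rw [Store.setNat_nat_ne _ _ _ _ hv]
      simp [hC, h.agents]) (by
      intro i t hi h12 hf ht
      rw [hin.agents] at hi
      have htn : HasInput t n m D := hin.of_frame hf
        (by simp [Cmd.natWrites, hv0.symm]) (by simp [Cmd.numWrites])
      have e1 : t.num = s.num := by
        funext a
        rw [hf.2 a (by simp [Cmd.numWrites])]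
        simp [hC]
      have e2 : ∀ a, a ≠ v → a ≠ 12 → t.nat a = s.nat a := by
        intro a ha ha'
        rw [hf.1 a (by simp [Cmd.natWrites, ha, ha'])]
        simp [hC, Store.setNat_nat_ne _ _ _ _ ha]
      have b1 := hb t e1 e2 (by rw [h12]; exact hi)
      have b2 := hbetter t e1 e2 (by rw [h12]; exact hi)
      rw [h12] at b1 b2
      have hiff : (Test.and b (.not (.and (.natLt (var v) (.get 0 (.lit 0) (.lit 0)))
          (.not better)))).Holds t ↔ B i ∧ ¬ (t.nat v 0 0 < n ∧ ¬ better.Holds t) := by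
        simp only [Test.Holds, NatExpr.eval, htn.agents, b1]
      rw [Cmd.den_cond]
      by_cases hc : B i ∧ ¬ (t.nat v 0 0 < n ∧ ¬ better.Holds t)
      · right
        rw [if_pos (hiff.2 hc)]
        simp only [Cmd.den_setNat, NatExpr.eval, h12, Store.setNat_nat_ne _ _ _ _ hv,
          Store.setNat_row, Function.update_self]
        refine ⟨hi, hc.1, fun x hx hBx => ?_⟩
        rcases Nat.lt_succ_iff_lt_or_eq.mp hx with h' | rfl
        · rcases ht with ht | ht
          · exact absurd hBx (ht.2 x h')
          · have h3 : better.Holds t := by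
              by_contra hne
              exact hc.2 ⟨ht.1, hne⟩
            exact ((b2 ht.1).1 h3).le.trans (ht.2.2 x h' hBx)
        · exact le_rfl
      · rw [if_neg (fun h' => hc (hiff.1 h'))]
        simp only [Cmd.den_skip, Store.setNat_nat_ne _ _ _ _ hv]
        rcases ht with ht | ht
        · left
          refine ⟨ht.1, fun x hx => ?_⟩
          rcases Nat.lt_succ_iff_lt_or_eq.mp hx with h' | rfl
          · exact ht.2 x h'
          · intro hB
            exact hc ⟨hB, fun h' => by omega⟩
        · right
          refine ⟨ht.1, ht.2.1, fun x hx hBx => ?_⟩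
          rcases Nat.lt_succ_iff_lt_or_eq.mp hx with h' | rfl
          · exact ht.2.2 x h' hBx
          · by_contra hlt
            exact hc ⟨hBx, fun h' => h'.2 ((b2 ht.1).2 (not_le.1 hlt))⟩)
  rw [hin.agents] at key
  exact key

/-- Write the loads of the assignment in the array `1` to the array `2`, at the threshold in the
variable `26`. -/
def loadProg : Cmd :=
  .seq (.loop 12 0 (.setNum 2 (.lit 0) (var 12) (.lit 0)))
    (.loop 13 1 (.cond (.and (.natLt (ent 2 (var 13)) (.get 0 (.lit 0) (.lit 0)))
        (.not (.natLt (var 26) (ent 3 (ent 2 (var 13))))))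
      (.setNum 2 (.lit 0) (ent 1 (var 13)) (.add (.get 2 (.lit 0) (ent 1 (var 13))) (.lit 1)))
      (.setNum 2 (.lit 0) (ent 1 (var 13))
        (.add (.get 2 (.lit 0) (ent 1 (var 13))) (.get 1 (.lit 0) (.lit 0))))))

theorem loadProg_spec {s : Store} {n m : ℕ} {D : ℕ → ℕ → ℝ} (h : HasInput s n m D) :
    ∀ i < n, (loadProg.den s).num 2 0 i =
      load m (price n (s.num 1 0 0) (s.nat 2 0) (s.nat 3 0) (s.nat 26 0 0)) (s.nat 1 0) i := by
  set C : Cmd := Cmd.loop 12 0 (.setNum 2 (.lit 0) (var 12) (.lit 0)) with hC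
  have key := Cmd.den_loop_induction (v := 12) (b := 0)
    (C := .setNum 2 (.lit 0) (var 12) (.lit 0)) (s := s)
    (fun i t => ∀ y < i, t.num 2 0 y = 0) (by simp) (by
      intro i t hi hv hf ht y hy
      by_cases hyi : y = i
      · simp [hyi, hv]
      · simpa [hyi, hv] using ht y (by omega))
  rw [h.agents] at key
  have hin : HasInput (C.den s) n m D := h.den (by decide) (by decide)
  have f1 := fun a ha => (C.frame_den s).1 a ha
  have f2 := (C.frame_den s).2 1 (by decide)
  have key' := Cmd.den_loop_induction (v := 13) (b := 1) (s := C.den s)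
    (C := .cond (.and (.natLt (ent 2 (var 13)) (.get 0 (.lit 0) (.lit 0)))
        (.not (.natLt (var 26) (ent 3 (ent 2 (var 13))))))
      (.setNum 2 (.lit 0) (ent 1 (var 13)) (.add (.get 2 (.lit 0) (ent 1 (var 13))) (.lit 1)))
      (.setNum 2 (.lit 0) (ent 1 (var 13))
        (.add (.get 2 (.lit 0) (ent 1 (var 13))) (.get 1 (.lit 0) (.lit 0)))))
    (fun j t => ∀ i < n, t.num 2 0 i = load j
      (price n (s.num 1 0 0) (s.nat 2 0) (s.nat 3 0) (s.nat 26 0 0)) (s.nat 1 0) i)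
    (fun i hi => by simpa [load_zero] using key i hi) (by
      intro j t hj hv hf ht i hi
      have ht' : HasInput t n m D := hin.of_frame hf (by decide) (by decide)
      have e1 : t.nat 1 = s.nat 1 := (hf.1 1 (by decide)).trans (f1 1 (by decide))
      have e2 : t.nat 2 = s.nat 2 := (hf.1 2 (by decide)).trans (f1 2 (by decide))
      have e3 : t.nat 3 = s.nat 3 := (hf.1 3 (by decide)).trans (f1 3 (by decide))
      have e26 : t.nat 26 = s.nat 26 := (hf.1 26 (by decide)).trans (f1 26 (by decide))
      have eK : t.num 1 = s.num 1 := (hf.2 1 (by decide)).trans f2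
      rw [load_succ, ← ht i hi]
      simp only [Cmd.den_cond, Test.Holds, NatExpr.eval, ht'.agents, hv, e2, e3, e26, not_lt,
        Store.setNat_num]
      change (if Low n (s.nat 2 0) (s.nat 3 0) (s.nat 26 0 0) j then _ else _ : Store).num 2 0 i = _
      unfold price
      by_cases hl : Low n (s.nat 2 0) (s.nat 3 0) (s.nat 26 0 0) j
      · by_cases hij : s.nat 1 0 j = i
        · subst hij; simp [hl, hv, e1]
        · simp [hl, hv, e1, hij, Ne.symm hij]
      · by_cases hij : s.nat 1 0 j = i
        · subst hij; simp [hl, hv, e1, eK]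
        · simp [hl, hv, e1, eK, hij, Ne.symm hij])
  rw [hin.chores] at key'
  exact key'

/-- The store holds an instance with larger disutility `K`, and a leveled assignment of it. -/
structure Ctx (s : Store) (n m : ℕ) (D : ℕ → ℕ → ℝ) (K : ℝ) (X hi : ℕ → ℕ) : Prop
    extends HasInput s n m D where
  large : s.num 1 0 0 = K
  assignment : s.nat 2 0 = X
  level : s.nat 3 0 = hi

theorem Ctx.of_frame {s t : Store} {n m : ℕ} {D : ℕ → ℕ → ℝ} {K : ℝ} {X hi : ℕ → ℕ} {C : Cmd}
    (h : Ctx s n m D K X hi) (hf : C.Frame s t)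
    (h1 : 0 ∉ C.natWrites ∧ 2 ∉ C.natWrites ∧ 3 ∉ C.natWrites)
    (h2 : 0 ∉ C.numWrites ∧ 1 ∉ C.numWrites) : Ctx t n m D K X hi :=
  ⟨h.toHasInput.of_frame hf h1.1 h2.1, by rw [hf.2 1 h2.2, h.large],
    by rw [hf.1 2 h1.2.1, h.assignment], by rw [hf.1 3 h1.2.2, h.level]⟩

theorem Ctx.den {s : Store} {n m : ℕ} {D : ℕ → ℕ → ℝ} {K : ℝ} {X hi : ℕ → ℕ} {C : Cmd}
    (h : Ctx s n m D K X hi)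
    (h1 : 0 ∉ C.natWrites ∧ 2 ∉ C.natWrites ∧ 3 ∉ C.natWrites)
    (h2 : 0 ∉ C.numWrites ∧ 1 ∉ C.numWrites) : Ctx (C.den s) n m D K X hi :=
  h.of_frame (C.frame_den s) h1 h2

/-- Compute the loads, and an agent of least load below the threshold. -/
def leastProg : Cmd :=
  .seq loadProg (argProg 24 (.not (.natLt (var 26) (ent 3 (var 12))))
    (.numLt (.get 2 (.lit 0) (var 12)) (.get 2 (.lit 0) (var 24))))

section

variable {D : ℕ → ℕ → ℝ} {n m : ℕ} {K : ℝ} {X hi : ℕ → ℕ} {t : ℕ} {s : Store}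

theorem leastProg_spec (h : Ctx s n m D K X hi) (ht : s.nat 26 0 0 = t)
    (hex : ∃ u < n, hi u ≤ t) :
    let u := (leastProg.den s).nat 24 0 0
    (∀ i < n, (leastProg.den s).num 2 0 i = load m (price n K X hi t) (s.nat 1 0) i) ∧
      u < n ∧ hi u ≤ t ∧ ∀ v < n, hi v ≤ t →
        load m (price n K X hi t) (s.nat 1 0) u ≤ load m (price n K X hi t) (s.nat 1 0) v := by
  have hl := loadProg_spec h.toHasInput
  rw [h.large, h.assignment, h.level, ht] at hl
  have h1 : Ctx (loadProg.den s) n m D K X hi := h.den (by decide) (by decide)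
  have f26 := (loadProg.frame_den s).1 26 (by decide)
  have key := argProg_spec h1.toHasInput (v := 24)
    (b := .not (.natLt (var 26) (ent 3 (var 12))))
    (better := .numLt (.get 2 (.lit 0) (var 12)) (.get 2 (.lit 0) (var 24)))
    (by decide) (by decide) (fun i => hi i ≤ t) (load m (price n K X hi t) (s.nat 1 0))
    (by
      intro u _ hu hlt
      simp [hu 26 (by decide) (by decide), hu 3 (by decide) (by decide), h1.level, f26, ht])
    (by
      intro u hnum hu hlt hlt'
      simp [hnum, hl _ hlt, hl _ hlt'])
  refine ⟨fun i hi' => ?_, ?_⟩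
  · rw [← hl i hi']
    exact congrFun (congrFun (((argProg _ _ _).frame_den _).2 2 (by decide)) 0) i
  · rcases key with ⟨_, hno⟩ | hyes
    · obtain ⟨u, hu, hut⟩ := hex
      exact absurd hut (hno u hu)
    · exact hyes

/-- Copy the array `2` to the array `1`. -/
def copyProg : Cmd := .loop 13 1 (.setNat 1 (.lit 0) (var 13) (ent 2 (var 13)))

theorem copyProg_spec (h : HasInput s n m D) :
    ∀ j < m, (copyProg.den s).nat 1 0 j = s.nat 2 0 j := by
  have key := Cmd.den_loop_induction (v := 13) (b := 1)
    (C := .setNat 1 (.lit 0) (var 13) (ent 2 (var 13))) (s := s)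
    (fun j t => ∀ j' < j, t.nat 1 0 j' = s.nat 2 0 j') (by simp) (by
      intro j t hj hv hf ht j' hj'
      have h2 : t.nat 2 = s.nat 2 := hf.1 2 (by decide)
      by_cases hjj : j' = j
      · simp [hjj, hv, h2]
      · simpa [hjj, hv] using ht j' (by omega))
  rw [h.chores] at key
  exact key

theorem load_congr {w : ℕ → ℝ} {Y Y' : ℕ → ℕ} (h : ∀ j < m, Y j = Y' j) (i : ℕ) :
    load m w Y i = load m w Y' i :=
  sum_congr rfl fun j hj => by rw [h j (mem_range.1 hj)]

/-- Needed because a copied array agrees with the original only below `m`. -/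
theorem Spread.congr {Y Y' : ℕ → ℕ} (h : Spread n m K X hi t Y) (he : ∀ j < m, Y' j = Y j) :
    Spread n m K X hi t Y' := by
  have hl : load m (price n K X hi t) Y' = load m (price n K X hi t) Y :=
    funext fun i => load_congr he i
  constructor
  · intro j hj; rw [he j hj]; exact h.low j hj
  · intro j hj; rw [he j hj]; exact h.high j hj
  · intro j hj; rw [he j hj, hl]; exact h.top j hj
  · intro j hj; rw [he j hj, hl]; exact h.reduced_max j hj
  · intro j hj hX ht hne j' hj'
    rw [he j hj] at hne
    rw [he j' hj', hl]
    exact h.reduced_top j hj hX ht hne j' hj'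
  · intro hex j hj; rw [he j hj, hl]; exact h.bound hex j hj

/-- Give chore `j` to an agent of least load below the threshold, if nobody likes it. -/
def assignBody : Cmd :=
  .cond (.natLt (ent 2 (var 16)) (.get 0 (.lit 0) (.lit 0))) .skip
    (.seq leastProg (.setNat 1 (.lit 0) (var 16) (var 24)))

theorem assignProg_spec (hn : 0 < n) (hL : Leveled D n m X hi) (hK : 1 ≤ K)
    (h : Ctx s n m D K X hi) (ht : s.nat 26 0 0 = t)
    (hf : (∀ i < n, hi i ≤ t) ∨ Failed n m K X hi t) (hY : ∀ j < m, s.nat 1 0 j = X j) :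
    let Y := ((Cmd.loop 16 1 assignBody).den s).nat 1 0
    Spread n m K X hi t Y ∧ ∀ j < m, Y j < n := by
  have key := Cmd.den_loop_induction (v := 16) (b := 1) (C := assignBody) (s := s)
    (fun i u => Spread n m K X hi t (u.nat 1 0) ∧ (∀ j < m, X j < n → u.nat 1 0 j = X j) ∧
      (∀ j < m, i ≤ j → u.nat 1 0 j = X j) ∧ ∀ j < i, u.nat 1 0 j < n)
    (by
      rw [Store.setNat_nat_ne _ _ _ _ (by decide)]
      exact ⟨Spread.initial.congr hY, fun j hj _ => hY j hj, fun j hj _ => hY j hj, by simp⟩)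
    (by
      intro j u hj hv hfr ⟨hS, h1, h2, h3⟩
      rw [h.chores] at hj
      have hu : Ctx u n m D K X hi := h.of_frame hfr (by decide) (by decide)
      have e26 : u.nat 26 0 0 = t := by rw [hfr.1 26 (by decide), ht]
      rw [Store.setNat_nat_ne _ _ _ _ (by decide), assignBody, Cmd.den_cond]
      by_cases hX : X j < n
      · rw [if_pos (by simpa [hu.assignment, hv, hu.agents] using hX), Cmd.den_skip]
        refine ⟨hS, h1, fun j' hj' hjj' => h2 j' hj' (by omega), fun j' hj' => ?_⟩
        rcases Nat.lt_succ_iff_lt_or_eq.mp hj' with h' | rfl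
        · exact h3 j' h'
        · rw [h1 _ hj hX]; exact hX
      · rw [if_neg (by simpa [hu.assignment, hv, hu.agents] using hX)]
        obtain ⟨-, l1, l2, l3⟩ := leastProg_spec hu e26 (hS.exists_low_level hn hL hK hf)
        have e1 : (leastProg.den u).nat 1 = u.nat 1 := (leastProg.frame_den u).1 1 (by decide)
        have e16 : (leastProg.den u).nat 16 0 0 = j := by
          rw [(leastProg.frame_den u).1 16 (by decide), hv]
        have e : ((Cmd.seq leastProg (.setNat 1 (.lit 0) (var 16) (var 24))).den u).nat 1 0 =
            Function.update (u.nat 1 0) j ((leastProg.den u).nat 24 0 0) := by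
          simp [e16, e1]
        rw [e]
        have hXn : X j = n := le_antisymm (hL.valid.le hj) (not_lt.1 hX)
        refine ⟨hS.step hL hK hf hj (h2 j hj le_rfl) (fun hl => hX hl.1) l1 l2 l3
          (Or.inl ⟨hXn, h1⟩), ?_, ?_, ?_⟩
        · intro j' hj' hX'
          rw [Function.update_of_ne (by rintro rfl; exact hX hX')]
          exact h1 j' hj' hX'
        · intro j' hj' hjj'
          rw [Function.update_of_ne (by omega)]
          exact h2 j' hj' (by omega)
        · intro j' hj'
          by_cases hjj : j' = j
          · rw [hjj, Function.update_self]; exact l1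
          · rw [Function.update_of_ne hjj]; exact h3 j' (by omega))
  rw [h.chores] at key
  exact ⟨key.1, key.2.2.2⟩

/-- Compute an agent of largest load above the threshold. -/
def mostProg : Cmd :=
  argProg 25 (.natLt (var 26) (ent 3 (var 12)))
    (.numLt (.get 2 (.lit 0) (var 25)) (.get 2 (.lit 0) (var 12)))

/-- Find a chore of the agent in the variable `25`. -/
def findProg : Cmd :=
  .loop 13 1 (.cond (.and (.not (.natLt (ent 1 (var 13)) (var 25)))
    (.not (.natLt (var 25) (ent 1 (var 13))))) (.setNat 23 (.lit 0) (.lit 0) (var 13)) .skip)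

theorem findProg_spec (h : HasInput s n m D) (hex : ∃ j < m, s.nat 1 0 j = s.nat 25 0 0) :
    (findProg.den s).nat 23 0 0 < m ∧
      s.nat 1 0 ((findProg.den s).nat 23 0 0) = s.nat 25 0 0 := by
  have key := Cmd.den_loop_induction (v := 13) (b := 1) (s := s)
    (C := .cond (.and (.not (.natLt (ent 1 (var 13)) (var 25)))
      (.not (.natLt (var 25) (ent 1 (var 13))))) (.setNat 23 (.lit 0) (.lit 0) (var 13)) .skip)
    (fun i u => (∃ j < i, s.nat 1 0 j = s.nat 25 0 0) →
      u.nat 23 0 0 < m ∧ s.nat 1 0 (u.nat 23 0 0) = s.nat 25 0 0) (by simp) (by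
      intro j u hj hv hfr ih ⟨j', hj', he⟩
      rw [h.chores] at hj
      have e1 : u.nat 1 = s.nat 1 := hfr.1 1 (by decide)
      have e25 : u.nat 25 = s.nat 25 := hfr.1 25 (by decide)
      simp only [Cmd.den_cond, Test.Holds, NatExpr.eval, hv, e1, e25,
        Store.setNat_nat_ne _ _ _ _ (show 23 ≠ 13 by decide)]
      by_cases hc : s.nat 1 0 j = s.nat 25 0 0
      · rw [if_pos (by omega)]
        simp [hv, hj, hc]
      · rw [if_neg (by omega)]
        apply ih
        refine ⟨j', ?_, he⟩
        have : j' ≠ j := by rintro rfl; exact hc he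
        omega)
  rw [h.chores] at key
  exact key hex

/-- Transfer a chore from an agent of largest load above the threshold to an agent of least load
below, if this reduces envy. -/
def transferBody : Cmd :=
  .seq leastProg (.seq mostProg
    (.cond (.and (.natLt (var 25) (.get 0 (.lit 0) (.lit 0)))
        (.numLt (.add (.get 2 (.lit 0) (var 24)) (.get 1 (.lit 0) (.lit 0)))
          (.get 2 (.lit 0) (var 25))))
      (.seq findProg (.setNat 1 (.lit 0) (var 23) (var 24))) .skip))

/-- Comparing the largest load above the threshold with the least load below it decides whether the
distribution is settled. That a transfer happens only if it is not keeps settled distributions fixed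
in later rounds. -/
theorem transferBody_spec (hn : 0 < n) (hL : Leveled D n m X hi) (hK : 1 ≤ K)
    (h : Ctx s n m D K X hi) (ht : s.nat 26 0 0 = t)
    (hf : (∀ i < n, hi i ≤ t) ∨ Failed n m K X hi t)
    (hS : Spread n m K X hi t (s.nat 1 0)) (ha : ∀ j < m, s.nat 1 0 j < n) :
    let Y := (transferBody.den s).nat 1 0
    (Y = s.nat 1 0 ∧ Settled n m K X hi t (s.nat 1 0)) ∨
      (¬ Settled n m K X hi t (s.nat 1 0) ∧ Spread n m K X hi t Y ∧ (∀ j < m, Y j < n) ∧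
        #{x ∈ range m | t < hi (Y x)} < #{x ∈ range m | t < hi (s.nat 1 0 x)}) := by
  obtain ⟨l0, l1, l2, l3⟩ := leastProg_spec h ht (hS.exists_low_level hn hL hK hf)
  set s1 := leastProg.den s with hs1
  have c1 : Ctx s1 n m D K X hi := h.den (by decide) (by decide)
  have f26 : s1.nat 26 = s.nat 26 := (leastProg.frame_den s).1 26 (by decide)
  have f1 : s1.nat 1 = s.nat 1 := (leastProg.frame_den s).1 1 (by decide)
  have key := argProg_spec c1.toHasInput (v := 25) (b := .natLt (var 26) (ent 3 (var 12)))
    (better := .numLt (.get 2 (.lit 0) (var 25)) (.get 2 (.lit 0) (var 12)))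
    (by decide) (by decide) (fun i => t < hi i)
    (fun i => - load m (price n K X hi t) (s.nat 1 0) i)
    (by
      intro u _ hu hlt
      simp [hu 26 (by decide) (by decide), hu 3 (by decide) (by decide), c1.level, f26, ht])
    (by
      intro u hnum hu hlt hlt'
      simp [hnum, l0 _ hlt, l0 _ hlt'])
  set s2 := mostProg.den s1 with hs2
  change (s2.nat 25 0 0 = n ∧ _) ∨ (s2.nat 25 0 0 < n ∧ _ ∧ _) at key
  have c2 : Ctx s2 n m D K X hi := c1.den (by decide) (by decide)
  have g1 : s2.nat 1 = s.nat 1 := ((mostProg.frame_den s1).1 1 (by decide)).trans f1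
  have g24 : s2.nat 24 = s1.nat 24 := (mostProg.frame_den s1).1 24 (by decide)
  have gl : s2.num 2 = s1.num 2 := (mostProg.frame_den s1).2 2 (by decide)
  intro Y
  have hYdef : Y = ((Cmd.cond (.and (.natLt (var 25) (.get 0 (.lit 0) (.lit 0)))
        (.numLt (.add (.get 2 (.lit 0) (var 24)) (.get 1 (.lit 0) (.lit 0)))
          (.get 2 (.lit 0) (var 25))))
      (.seq findProg (.setNat 1 (.lit 0) (var 23) (var 24))) .skip).den s2).nat 1 0 := rfl
  rw [Cmd.den_cond] at hYdef
  set u := s1.nat 24 0 0 with hu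
  set r := s2.nat 25 0 0 with hr
  have hcond : (Test.and (.natLt (var 25) (.get 0 (.lit 0) (.lit 0)))
        (.numLt (.add (.get 2 (.lit 0) (var 24)) (.get 1 (.lit 0) (.lit 0)))
          (.get 2 (.lit 0) (var 25)))).Holds s2 ↔ r < n ∧
      load m (price n K X hi t) (s.nat 1 0) u + K < load m (price n K X hi t) (s.nat 1 0) r := by
    simp only [Test.Holds, NatExpr.eval, NumExpr.eval, c2.agents, c2.large, g24, gl, ← hu, ← hr]
    refine and_congr_right fun hlt => ?_
    rw [l0 _ l1, l0 _ hlt]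
  by_cases hc : r < n ∧
      load m (price n K X hi t) (s.nat 1 0) u + K < load m (price n K X hi t) (s.nat 1 0) r
  · right
    rw [if_pos (hcond.2 hc)] at hYdef
    have hk : t < hi r ∧ ∀ i < n, t < hi i →
        load m (price n K X hi t) (s.nat 1 0) i ≤ load m (price n K X hi t) (s.nat 1 0) r := by
      rcases key with key | ⟨_, k2, k3⟩
      · omega
      · exact ⟨k2, fun i hi' hti => neg_le_neg_iff.1 (k3 i hi' hti)⟩
    -- The load of `r` exceeds another load by more than `K`, so it is positive.
    have hex : ∃ j < m, s2.nat 1 0 j = s2.nat 25 0 0 := by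
      by_contra! hno
      have h0 : load m (price n K X hi t) (s.nat 1 0) r = 0 := by
        apply sum_eq_zero
        intro j hj
        refine if_neg ?_
        have := hno j (mem_range.1 hj)
        rwa [g1] at this
      have := load_nonneg (m := m) (w := price n K X hi t)
        (fun j _ => price_pos hK _ _ _ _) (s.nat 1 0) u
      linarith [hc.2]
    obtain ⟨x1, x2⟩ := findProg_spec c2.toHasInput hex
    have k1 : (findProg.den s2).nat 1 = s.nat 1 :=
      ((findProg.frame_den s2).1 1 (by decide)).trans g1
    have k24 : (findProg.den s2).nat 24 0 0 = u := by
      rw [(findProg.frame_den s2).1 24 (by decide), g24]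
    rw [g1] at x2
    have hY' : Y = Function.update (s.nat 1 0) ((findProg.den s2).nat 23 0 0) u := by
      rw [hYdef]
      simp [k1, k24]
    rw [hY']
    set j := (findProg.den s2).nat 23 0 0 with hj
    have hjr : s.nat 1 0 j = r := x2
    obtain ⟨y1, y2⟩ := hS.eq_of_high_level x1 (by rw [hjr]; exact hk.1)
    have hXr : X j = r := y1.symm.trans hjr
    refine ⟨fun hs => ?_, hS.step hL hK hf x1 y1 y2 l1 l2 l3 (Or.inr ?_), ?_,
      card_high_update x1 (by rw [hjr]; exact hk.1) l2⟩
    · have := hs.settled r hc.1 hk.1 u l1 l2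
      linarith [hc.2]
    · rw [hXr]
      exact ⟨hc.1, hk.2, hc.2⟩
    · intro j' hj'
      by_cases hjj : j' = j
      · rw [hjj, Function.update_self]; exact l1
      · rw [Function.update_of_ne hjj]; exact ha j' hj'
  · left
    rw [if_neg (fun h' => hc (hcond.1 h')), Cmd.den_skip, g1] at hYdef
    refine ⟨hYdef, hS, ha, fun i hi' hti v hv hvt => ?_⟩
    rcases key with ⟨_, key⟩ | ⟨k1, k2, k3⟩
    · exact absurd hti (key i hi')
    · have h1 : load m (price n K X hi t) (s.nat 1 0) i ≤
          load m (price n K X hi t) (s.nat 1 0) r := neg_le_neg_iff.1 (k3 i hi' hti)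
      have h2 := l3 v hv hvt
      have h3 : ¬ (load m (price n K X hi t) (s.nat 1 0) u + K <
        load m (price n K X hi t) (s.nat 1 0) r) := fun h' => hc ⟨k1, h'⟩
      linarith [not_lt.1 h3]

/-- Every transfer lowers the number of chores held above the threshold, so `m` rounds suffice; once
the number is 0, all loads up there vanish and nothing is left to settle. -/
theorem transferProg_spec (hn : 0 < n) (hL : Leveled D n m X hi) (hK : 1 ≤ K)
    (h : Ctx s n m D K X hi) (ht : s.nat 26 0 0 = t)
    (hf : (∀ i < n, hi i ≤ t) ∨ Failed n m K X hi t)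
    (hS : Spread n m K X hi t (s.nat 1 0)) (ha : ∀ j < m, s.nat 1 0 j < n) :
    Settled n m K X hi t (((Cmd.loop 16 1 transferBody).den s).nat 1 0) := by
  have key := Cmd.den_loop_induction (v := 16) (b := 1) (C := transferBody) (s := s)
    (fun i u => Settled n m K X hi t (u.nat 1 0) ∨ (Spread n m K X hi t (u.nat 1 0) ∧
      (∀ j < m, u.nat 1 0 j < n) ∧ #{x ∈ range m | t < hi (u.nat 1 0 x)} + i ≤ m))
    (by
      right
      rw [Store.setNat_nat_ne _ _ _ _ (by decide)]
      exact ⟨hS, ha, by simpa using card_filter_le (range m) _⟩)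
    (by
      intro i u hi' hv hfr ih
      have hu : Ctx u n m D K X hi := h.of_frame hfr (by decide) (by decide)
      have e26 : u.nat 26 0 0 = t := by rw [hfr.1 26 (by decide), ht]
      rw [Store.setNat_nat_ne _ _ _ _ (by decide)]
      have hb := transferBody_spec (s := u) hn hL hK hu e26 hf
      rcases ih with ih | ⟨ih1, ih2, ih3⟩
      · left
        rcases hb ih.toSpread ih.assigned with ⟨e, _⟩ | ⟨h1, _⟩
        · rw [e]; exact ih
        · exact absurd ih h1
      · rcases hb ih1 ih2 with ⟨e, h1⟩ | ⟨_, h1, h2, h3⟩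
        · rw [e]; exact Or.inl h1
        · exact Or.inr ⟨h1, h2, by omega⟩)
  rw [h.chores] at key
  rcases key with key | ⟨h1, h2, h3⟩
  · exact key
  · refine ⟨h1, h2, fun i hi' hti v hv hvt => ?_⟩
    have h0 : load m (price n K X hi t) (((Cmd.loop 16 1 transferBody).den s).nat 1 0) i = 0 := by
      apply sum_eq_zero
      intro j hj
      refine if_neg ?_
      rintro rfl
      have : 0 < #{x ∈ range m | t < hi (((Cmd.loop 16 1 transferBody).den s).nat 1 0 x)} :=
        card_pos.2 ⟨j, by simpa using ⟨mem_range.1 hj, hti⟩⟩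
      omega
    have := load_nonneg (m := m) (w := price n K X hi t)
      (fun j _ => price_pos hK _ _ _ _) (((Cmd.loop 16 1 transferBody).den s).nat 1 0) v
    linarith

end

/-- Count the threshold, less one, as a real number. -/
def thresholdBody : Cmd :=
  .cond (.natLt (.add (var 13) (.lit 1)) (var 26))
    (.setNum 3 (.lit 0) (.lit 0) (.add (.get 3 (.lit 0) (.lit 0)) (.lit 1))) .skip

/-- Record whether the load of the agent in the variable `12` is too small. -/
def checkBody : Cmd :=
  .cond (.numLt (.get 2 (.lit 0) (var 12)) (.get 3 (.lit 0) (.lit 0)))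
    (.setNat 28 (.lit 0) (.lit 0) (.lit 0)) .skip

/-- Compute the threshold, less one, as a real number. -/
def thresholdProg : Cmd :=
  .seq (.setNum 3 (.lit 0) (.lit 0) (.lit 0)) (.loop 13 1 thresholdBody)

/-- Record whether some load is smaller than the threshold less one. -/
def checkProg : Cmd :=
  .seq loadProg (.seq thresholdProg
    (.seq (.setNat 28 (.lit 0) (.lit 0) (.lit 1)) (.seq (.loop 12 0 checkBody)
      (.setNat 27 (.lit 0) (.lit 0) (var 28)))))

section

variable {D : ℕ → ℕ → ℝ} {n m : ℕ} {K : ℝ} {X hi : ℕ → ℕ} {t : ℕ} {s : Store}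

/-- The machine does not convert natural numbers to reals, so the real number `t - 1` is counted up.
-/
theorem thresholdProg_spec (h : HasInput s n m D) (ht : s.nat 26 0 0 = t) (htm : t ≤ m) :
    (thresholdProg.den s).num 3 0 0 = ((t - 1 : ℕ) : ℝ) := by
  set C : Cmd := .setNum 3 (.lit 0) (.lit 0) (.lit 0) with hC
  have hin : HasInput (C.den s) n m D := h.den (by decide) (by decide)
  have key := Cmd.den_loop_induction (v := 13) (b := 1) (C := thresholdBody) (s := C.den s)
    (fun j u => u.num 3 0 0 = (min j (t - 1) : ℕ)) (by simp [hC]) (by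
      intro j u hj hv hf ih
      have e26 : u.nat 26 0 0 = t := by
        rw [hf.1 26 (by decide)]
        simp [hC, ht]
      simp only [thresholdBody, Cmd.den_cond, Test.Holds, NatExpr.eval, hv, e26, Store.setNat_num]
      split_ifs with hc
      · simp only [Cmd.den_setNum, NatExpr.eval, NumExpr.eval, Store.setNum_row,
          Function.update_self, ih]
        rw [min_eq_left (by omega : j ≤ t - 1), min_eq_left (by omega : j + 1 ≤ t - 1)]
        push_cast
        ring
      · rw [Cmd.den_skip, ih, min_eq_right (by omega : t - 1 ≤ j),
          min_eq_right (by omega : t - 1 ≤ j + 1)])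
  rw [hin.chores, min_eq_right (by omega)] at key
  exact key

theorem checkProg_spec (h : Ctx s n m D K X hi) (ht : s.nat 26 0 0 = t) (ht1 : 1 ≤ t)
    (htm : t ≤ m) : 0 < (checkProg.den s).nat 27 0 0 ↔
      ∀ a < n, (t : ℝ) - 1 ≤ load m (price n K X hi t) (s.nat 1 0) a := by
  have hl := loadProg_spec h.toHasInput
  rw [h.large, h.assignment, h.level, ht] at hl
  set s1 := loadProg.den s with hs1
  have c1 : Ctx s1 n m D K X hi := h.den (by decide) (by decide)
  have f26 : s1.nat 26 0 0 = t := by rw [(loadProg.frame_den s).1 26 (by decide), ht]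
  have hT := thresholdProg_spec c1.toHasInput f26 htm
  set s2 := thresholdProg.den s1 with hs2
  have c2 : Ctx s2 n m D K X hi := c1.den (by decide) (by decide)
  have f2 : s2.num 2 = s1.num 2 := (thresholdProg.frame_den s1).2 2 (by decide)
  set C : Cmd := .setNat 28 (.lit 0) (.lit 0) (.lit 1) with hC
  have hin : HasInput (C.den s2) n m D := c2.toHasInput.den (by decide) (by decide)
  rw [Nat.cast_sub ht1, Nat.cast_one] at hT
  have key := Cmd.den_loop_induction (v := 12) (b := 0) (C := checkBody) (s := C.den s2)
    (fun i u => 0 < u.nat 28 0 0 ↔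
      ∀ a < i, (t : ℝ) - 1 ≤ load m (price n K X hi t) (s.nat 1 0) a) (by simp [hC]) (by
      intro i u hi' hv hf ih
      rw [hin.agents] at hi'
      have e2 : u.num 2 0 i = load m (price n K X hi t) (s.nat 1 0) i := by
        rw [hf.2 2 (by decide), ← hl i hi', ← f2]
        simp [hC]
      have e3 : u.num 3 0 0 = (t : ℝ) - 1 := by
        rw [hf.2 3 (by decide), ← hT]
        simp [hC]
      simp only [checkBody, Cmd.den_cond, Test.Holds, NatExpr.eval, NumExpr.eval, hv, e2, e3,
        Store.setNat_nat_ne _ _ _ _ (show 28 ≠ 12 by decide)]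
      split_ifs with hc
      · simp only [Cmd.den_setNat, NatExpr.eval, Store.setNat_row, Function.update_self,
          lt_irrefl, false_iff, not_forall]
        exact ⟨i, by omega, not_le.2 hc⟩
      · rw [Cmd.den_skip, ih]
        refine ⟨fun h' a ha => ?_, fun h' a ha => h' a (by omega)⟩
        rcases Nat.lt_succ_iff_lt_or_eq.mp ha with h'' | rfl
        · exact h' a h''
        · exact not_lt.1 hc)
  rw [hin.agents] at key
  rw [← key]
  simp [checkProg, ← hC, ← hs1, ← hs2]

/-- Distribute the chores at the threshold determined by the variable `15`. -/
def tryProg : Cmd :=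
  .seq (.setNat 26 (.lit 0) (.lit 0) (.sub (.get 0 (.lit 0) (.lit 1)) (var 15)))
    (.seq copyProg (.seq (.loop 16 1 assignBody) (.seq (.loop 16 1 transferBody) checkProg)))

theorem tryProg_spec (hn : 0 < n) (hL : Leveled D n m X hi) (hK : 1 ≤ K)
    (h : Ctx s n m D K X hi) (ht : m - s.nat 15 0 0 = t) (ht1 : 1 ≤ t)
    (hf : (∀ i < n, hi i ≤ t) ∨ Failed n m K X hi t) :
    Settled n m K X hi t ((tryProg.den s).nat 1 0) ∧ (0 < (tryProg.den s).nat 27 0 0 ↔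
      ∀ a < n, (t : ℝ) - 1 ≤ load m (price n K X hi t) ((tryProg.den s).nat 1 0) a) := by
  set C : Cmd := .setNat 26 (.lit 0) (.lit 0) (.sub (.get 0 (.lit 0) (.lit 1)) (var 15)) with hC
  have c0 : Ctx (C.den s) n m D K X hi := h.den (by decide) (by decide)
  have e0 : (C.den s).nat 26 0 0 = t := by simp [hC, h.chores, ht]
  have hcopy := copyProg_spec c0.toHasInput
  rw [c0.assignment] at hcopy
  set s1 := copyProg.den (C.den s) with hs1
  have c1 : Ctx s1 n m D K X hi := c0.den (by decide) (by decide)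
  have e1 : s1.nat 26 0 0 = t := by rw [(copyProg.frame_den _).1 26 (by decide), e0]
  obtain ⟨a1, a2⟩ := assignProg_spec hn hL hK c1 e1 hf hcopy
  set s2 := (Cmd.loop 16 1 assignBody).den s1 with hs2
  have c2 : Ctx s2 n m D K X hi := c1.den (by decide) (by decide)
  have e2 : s2.nat 26 0 0 = t := by
    rw [((Cmd.loop 16 1 assignBody).frame_den s1).1 26 (by decide), e1]
  have hset := transferProg_spec hn hL hK c2 e2 hf a1 a2
  set s3 := (Cmd.loop 16 1 transferBody).den s2 with hs3
  have c3 : Ctx s3 n m D K X hi := c2.den (by decide) (by decide)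
  have e3 : s3.nat 26 0 0 = t := by
    rw [((Cmd.loop 16 1 transferBody).frame_den s2).1 26 (by decide), e2]
  have hc := checkProg_spec c3 e3 ht1 (by omega)
  have e : tryProg.den s = checkProg.den s3 := rfl
  rw [e, (checkProg.frame_den s3).1 1 (by decide)]
  exact ⟨hset, hc⟩

/-- Distribute the chores at the largest threshold for which no load is too small. -/
def distributeProg : Cmd :=
  .seq (.setNat 27 (.lit 0) (.lit 0) (.lit 0))
    (.loop 15 1 (.cond (.natLt (.lit 0) (var 27)) .skip tryProg))

/-- At threshold `m` all agents are light. If a threshold leaves some load too small, this very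
outcome is the `Failed` hypothesis for the next one. The search succeeds by threshold 1 at the
latest, as `Failed` at 0 would need a negative load. -/
theorem distributeProg_spec (hn : 0 < n) (hm : 0 < m) (hL : Leveled D n m X hi) (hK : 1 ≤ K)
    (h : Ctx s n m D K X hi) :
    ∃ t, ((∀ i < n, hi i ≤ t) ∨ Failed n m K X hi t) ∧
      Settled n m K X hi t ((distributeProg.den s).nat 1 0) ∧
      ∀ a < n, (t : ℝ) - 1 ≤ load m (price n K X hi t) ((distributeProg.den s).nat 1 0) a := by
  set C : Cmd := .setNat 27 (.lit 0) (.lit 0) (.lit 0) with hC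
  have c0 : Ctx (C.den s) n m D K X hi := h.den (by decide) (by decide)
  have key := Cmd.den_loop_induction (v := 15) (b := 1)
    (C := .cond (.natLt (.lit 0) (var 27)) .skip tryProg) (s := C.den s)
    (fun i u => (0 < u.nat 27 0 0 ∧ ∃ t, ((∀ i < n, hi i ≤ t) ∨ Failed n m K X hi t) ∧
      Settled n m K X hi t (u.nat 1 0) ∧
      ∀ a < n, (t : ℝ) - 1 ≤ load m (price n K X hi t) (u.nat 1 0) a) ∨
      (u.nat 27 0 0 = 0 ∧ (i = 0 ∨ Failed n m K X hi (m - i))))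
    (by simp [hC]) (by
      intro i u hi' hv hfr ih
      rw [c0.chores] at hi'
      have hu : Ctx u n m D K X hi := c0.of_frame hfr (by decide) (by decide)
      rw [Store.setNat_nat_ne _ _ _ _ (show 27 ≠ 15 by decide),
        Store.setNat_nat_ne _ _ _ _ (show 1 ≠ 15 by decide), Cmd.den_cond]
      rcases ih with ih | ⟨ih1, ih2⟩
      · rw [if_pos (by simpa using ih.1), Cmd.den_skip]
        exact Or.inl ih
      · rw [if_neg (by simpa using ih1)]
        have hf : (∀ a < n, hi a ≤ m - i) ∨ Failed n m K X hi (m - i) := by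
          rcases ih2 with rfl | ih2
          · exact Or.inl hL.le_items
          · exact Or.inr ih2
        obtain ⟨t1, t2⟩ := tryProg_spec hn hL hK hu (t := m - i) (by rw [hv]) (by omega) hf
        by_cases hc : 0 < (tryProg.den u).nat 27 0 0
        · exact Or.inl ⟨hc, m - i, hf, t1, t2.1 hc⟩
        · refine Or.inr ⟨by omega, Or.inr ?_⟩
          rw [t2] at hc
          push Not at hc
          obtain ⟨a, ha, hlt⟩ := hc
          have e : m - i = m - (i + 1) + 1 := by omega
          rw [e] at t1 hlt
          refine ⟨_, t1, a, ha, ?_⟩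
          push_cast at hlt
          linarith)
  rw [c0.chores] at key
  rcases key with key | ⟨_, key⟩
  · exact key.2
  · exfalso
    rcases key with key | ⟨Y, hY, a, ha, hlt⟩
    · omega
    · have := load_nonneg (m := m) (w := price n K X hi (m - m + 1))
        (fun j _ => price_pos hK _ _ _ _) Y a
      simp only [Nat.sub_self, Nat.cast_zero] at hlt this
      linarith

end

/-! ### From fairness in prices to approximate EFX -/

/-- The factor in the envy-freeness guarantee. -/
noncomputable def ratio (K : ℝ) : ℝ := 2 - 1 / K

theorem one_le_ratio {K : ℝ} (hK : 1 ≤ K) : 1 ≤ ratio K := by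
  have : 1 / K ≤ 1 := by rw [div_le_one (by linarith)]; exact hK
  unfold ratio; linarith

theorem ratio_mul_self {K : ℝ} (hK : 1 ≤ K) : ratio K * K = 2 * K - 1 := by
  have : K ≠ 0 := by linarith
  unfold ratio
  field_simp

theorem two_mul_sub_one_le_ratio_mul {K v : ℝ} (hK : 1 ≤ K) (hv : v ≤ K) :
    2 * v - 1 ≤ ratio K * v := by
  have : v / K ≤ 1 := by rw [div_le_one (by linarith)]; exact hv
  have e : ratio K * v = 2 * v - v / K := by unfold ratio; ring
  linarith

/-- Equality at `v = K`, where both sides are `2 * K - 1`, and the right side grows at least as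
fast. The previous bound, for `v ≤ K`, is also tight at `K`; this is where the factor comes from. -/
theorem add_sub_one_le_ratio_mul {K v : ℝ} (hK : 1 ≤ K) (hv : K ≤ v) :
    v + K - 1 ≤ ratio K * v := by
  have h1 := ratio_mul_self hK
  have h2 : ratio K * K + 1 * (v - K) ≤ ratio K * K + ratio K * (v - K) := by
    have := mul_le_mul_of_nonneg_right (one_le_ratio hK) (by linarith : 0 ≤ v - K)
    linarith
  nlinarith

theorem le_ratio_mul {K v : ℝ} (hK : 1 ≤ K) (hv : 0 ≤ v) : v ≤ ratio K * v := by
  have := mul_le_mul_of_nonneg_right (one_le_ratio hK) hv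
  linarith

/-- Envy-freeness up to any chore, up to the factor `ratio K`. -/
def ApproxEFX (D : ℕ → ℕ → ℝ) (n m : ℕ) (K : ℝ) (Y : ℕ → ℕ) : Prop :=
  ∀ h < n, ∀ j < m, load m (D (Y j)) Y (Y j) - D (Y j) j ≤ ratio K * load m (D (Y j)) Y h

section

variable {D : ℕ → ℕ → ℝ} {n m : ℕ} {K : ℝ} {U : ℕ → Prop} {w : ℕ → ℝ} {Y : ℕ → ℕ}

theorem load_mono {w w' : ℕ → ℝ} {h : ℕ} (hw : ∀ j < m, Y j = h → w j ≤ w' j) :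
    load m w Y h ≤ load m w' Y h := by
  apply sum_le_sum
  intro j hj
  split_ifs with hY
  · exact hw j (mem_range.1 hj) hY
  · exact le_rfl

theorem le_load {w : ℕ → ℝ} (hw : ∀ j < m, 0 ≤ w j) {j : ℕ} (hj : j < m) :
    w j ≤ load m w Y (Y j) := by
  have := single_le_sum (f := fun x => if Y x = Y j then w x else 0) (s := range m)
    (fun x hx => by
      split_ifs
      · exact hw x (mem_range.1 hx)
      · exact le_rfl) (mem_range.2 hj)
  simpa [load] using this

theorem add_le_load {w : ℕ → ℝ} (hw : ∀ j < m, 0 ≤ w j) {j j' : ℕ} (hj : j < m) (hj' : j' < m)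
    (hne : j ≠ j') (hY : Y j' = Y j) : w j + w j' ≤ load m w Y (Y j) := by
  have : ∑ x ∈ ({j, j'} : Finset ℕ), (if Y x = Y j then w x else 0) ≤ load m w Y (Y j) := by
    apply sum_le_sum_of_subset_of_nonneg
    · intro x hx
      simp only [mem_insert, mem_singleton] at hx
      rcases hx with rfl | rfl <;> simpa
    · intro x hx _
      split_ifs
      · exact hw x (mem_range.1 hx)
      · exact le_rfl
  rw [sum_pair hne] at this
  simpa [hY] using this

theorem load_eq_of_unique {w : ℕ → ℝ} {j : ℕ} (hj : j < m)
    (huniq : ∀ j' < m, Y j' = Y j → j' = j) : load m w Y (Y j) = w j := by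
  unfold load
  rw [sum_eq_single j]
  · simp
  · intro x hx hne
    exact if_neg fun h => hne (huniq x (mem_range.1 hx) h)
  · intro h
    exact absurd (mem_range.2 hj) h

namespace Supported

theorem price_nonneg (h : Supported D n m K U w Y) (hK : 1 ≤ K) : ∀ j < m, 0 ≤ w j := by
  intro j hj
  rcases h.price_cases j hj with e | e <;> rw [e] <;> linarith

theorem one_le_price (h : Supported D n m K U w Y) (hK : 1 ≤ K) : ∀ j < m, 1 ≤ w j := by
  intro j hj
  rcases h.price_cases j hj with e | e <;> rw [e]
  exact hK

theorem load_le (h : Supported D n m K U w Y) {i : ℕ} (hi : i < n) (hU : U i) (a : ℕ) :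
    load m w Y a ≤ load m (D i) Y a :=
  load_mono fun j hj _ => h.price_le j hj i hi hU

theorem load_self (h : Supported D n m K U w Y) {i : ℕ} (hU : U i) :
    load m (D i) Y i = load m w Y i := by
  apply sum_congr rfl
  intro j hj
  split_ifs with hY
  · subst hY; exact h.eq_of_light j (mem_range.1 hj) hU
  · rfl

theorem load_heavy (h : Supported D n m K U w Y) {i : ℕ} (hU : ¬ U i) :
    load m w Y i = K * load m (D i) Y i := by
  unfold load
  rw [mul_sum]
  apply sum_congr rfl
  intro j hj
  split_ifs with hY
  · subst hY
    rw [(h.eq_of_heavy j (mem_range.1 hj) hU).1, (h.eq_of_heavy j (mem_range.1 hj) hU).2, mul_one]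
  · simp

theorem load_le_mul (h : Supported D n m K U w Y) (hK : 1 ≤ K)
    (hD : ∀ i < n, ∀ j < m, D i j = 1 ∨ D i j = K) {i : ℕ} (hi : i < n) (a : ℕ) :
    load m w Y a ≤ K * load m (D i) Y a := by
  unfold load
  rw [mul_sum]
  apply sum_le_sum
  intro j hj
  rw [mem_range] at hj
  split_ifs with hY
  · rcases h.price_cases j hj with e | e <;> rcases hD i hi j hj with e' | e' <;> rw [e, e'] <;>
      nlinarith
  · simp

/-- For a heavy agent, prices are `K` times its disutilities on its own bundle and at most that
elsewhere. Price envy of at most `K` thus scales down to envy of at most 1, the disutility of each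
of its chores; no factor is lost. -/
theorem heavy_efx (h : Supported D n m K U w Y) (hK : 1 ≤ K)
    (hD : ∀ i < n, ∀ j < m, D i j = 1 ∨ D i j = K) (hf : PriceFair n m K w Y) {j : ℕ}
    (hj : j < m) (hU : ¬ U (Y j)) {a : ℕ} (ha : a < n) :
    load m (D (Y j)) Y (Y j) - D (Y j) j ≤ load m (D (Y j)) Y a := by
  obtain ⟨h1, h2⟩ := h.eq_of_heavy j hj hU
  have h3 := hf.high j hj h2 a ha
  have h4 := h.load_le_mul hK hD (h.assigned j hj) a
  rw [h.load_heavy hU] at h3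
  rw [h1]
  nlinarith

/-- For a light agent, price envy is at most `K` and removing any chore saves at least 1, so `v + K
- 1 ≤ ratio K * v` with `v ≥ K` is enough. -/
theorem efx_of_large (h : Supported D n m K U w Y) (hK : 1 ≤ K)
    (hD : ∀ i < n, ∀ j < m, D i j = 1 ∨ D i j = K) (hf : PriceFair n m K w Y)
    (hlarge : ∀ a < n, K ≤ load m w Y a) : ApproxEFX D n m K Y := by
  intro a ha j hj
  have hYj := h.assigned j hj
  have hD0 : ∀ j' < m, 0 ≤ D (Y j) j' := by
    intro j' hj'
    rcases hD _ hYj j' hj' with e | e <;> rw [e] <;> linarith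
  by_cases hU : U (Y j)
  · have h1 := h.one_le_price hK j hj
    have h2 := hlarge a ha
    have h3 : ratio K * load m w Y a ≤ ratio K * load m (D (Y j)) Y a :=
      mul_le_mul_of_nonneg_left (h.load_le hYj hU a) (by linarith [one_le_ratio hK])
    rw [h.load_self hU, h.eq_of_light j hj hU]
    have h4 := add_sub_one_le_ratio_mul hK h2
    by_cases hex : ∃ j' < m, Y j' = Y j ∧ w j' = K
    · obtain ⟨j', hj', e, hw⟩ := hex
      have := hf.high j' hj' hw a ha
      rw [e] at this
      linarith
    · push Not at hex
      have := hf.ones (Y j) hYj (fun j' hj' e =>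
        (h.price_cases j' hj').resolve_right (hex j' hj' e)) a ha
      linarith
  · exact (h.heavy_efx hK hD hf hj hU ha).trans (le_ratio_mul hK (load_nonneg hD0 Y a))

end Supported

/-- An invariant of the exchanges of bundles, when the smallest load `a` is less than `K`;
the agents below `i` have been treated. -/
structure Repaired (D : ℕ → ℕ → ℝ) (n m : ℕ) (K : ℝ) (U : ℕ → Prop) (w : ℕ → ℝ) (a : ℝ) (i : ℕ)
    (Y : ℕ → ℕ) : Prop extends Supported D n m K U w Y where
  lower : ∀ x < n, a ≤ load m w Y x
  cases : ∀ x < n, (∀ j < m, ∀ j' < m, Y j = x → Y j' = x → j = j') ∨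
    (U x ∧ (∃ j < m, Y j = x ∧ w j = K) ∧ load m w Y x ≤ K + a ∧
      (x < i → ∀ h < n, K ≤ load m (D x) Y h)) ∨
    (U x ∧ (∀ j < m, Y j = x → w j = 1) ∧ load m w Y x ≤ 2 * K ∧
      ∀ h < n, load m w Y x - 1 ≤ ratio K * load m (D x) Y h)

/-- Here the load of `x` is the least one and below `K`. A heavy agent has at most one chore: two
would cost `2 * K`, but price fairness bounds its load by `K` plus the least load. -/
theorem Supported.repaired (h : Supported D n m K U w Y) (hK : 1 ≤ K) (hf : PriceFair n m K w Y)
    {x : ℕ} (hx : x < n) (hxK : load m w Y x < K) (hmin : ∀ y < n, load m w Y x ≤ load m w Y y) :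
    Repaired D n m K U w (load m w Y x) 0 Y := by
  refine ⟨h, hmin, fun y hy => ?_⟩
  by_cases hU : U y
  · right
    by_cases hex : ∃ j < m, Y j = y ∧ w j = K
    · left
      obtain ⟨j, hj, rfl, hw⟩ := hex
      refine ⟨hU, ⟨j, hj, rfl, hw⟩, ?_, by simp⟩
      have := hf.high j hj hw x hx
      linarith
    · right
      push Not at hex
      have hones : ∀ j < m, Y j = y → w j = 1 := fun j hj e =>
        (h.price_cases j hj).resolve_right (hex j hj e)
      refine ⟨hU, hones, ?_, fun z hz => ?_⟩
      · have := hf.ones y hy hones x hx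
        linarith
      · refine (hf.ones y hy hones z hz).trans ((h.load_le hy hU z).trans (le_ratio_mul hK ?_))
        exact (load_nonneg (h.price_nonneg hK) Y z).trans (h.load_le hy hU z)
  · left
    intro j hj j' hj' e e'
    by_contra hne
    subst e
    have h1 := (h.eq_of_heavy j hj hU).2
    have h2 := (h.eq_of_heavy j' hj' (by rw [e']; exact hU)).2
    have h3 := hf.high j hj h1 x hx
    have h4 := add_le_load (h.price_nonneg hK) hj hj' hne e'
    linarith

/-- The middle case of the invariant is where treatment matters: the load without one chore is at
most `K + a - 1 < 2 * K - 1 = ratio K * K`, and all bundles cost such an agent at least `K`. -/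
theorem Repaired.efx {a : ℝ} (h : Repaired D n m K U w a n Y) (hK : 1 ≤ K) (haK : a < K)
    (hD : ∀ i < n, ∀ j < m, D i j = 1 ∨ D i j = K) : ApproxEFX D n m K Y := by
  intro z hz j hj
  have hYj := h.assigned j hj
  have hD0 : ∀ j' < m, 0 ≤ D (Y j) j' := by
    intro j' hj'
    rcases hD _ hYj j' hj' with e | e <;> rw [e] <;> linarith
  have h1 := h.one_le_price hK j hj
  rcases h.cases _ hYj with hc | ⟨hU, _, hle, hc⟩ | ⟨hU, _, _, hc⟩
  · rw [load_eq_of_unique hj fun j' hj' e => hc j' hj' j hj e rfl, sub_self]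
    exact mul_nonneg (by linarith [one_le_ratio hK]) (load_nonneg hD0 Y z)
  · rw [h.load_self hU, h.eq_of_light j hj hU]
    have h2 := mul_le_mul_of_nonneg_left (hc hYj z hz)
      (by linarith [one_le_ratio hK] : 0 ≤ ratio K)
    rw [ratio_mul_self hK] at h2
    linarith
  · rw [h.load_self hU, h.eq_of_light j hj hU]
    have := hc z hz
    linarith

/-- The loads after agent `i` takes the bundle of agent `b` and gives chore `c` in exchange. -/
theorem load_exchange (v : ℕ → ℝ) {Y Y' : ℕ → ℕ} {i b c : ℕ} (hc : c < m) (hci : Y c = i)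
    (hib : b ≠ i) (hY' : ∀ j < m, Y' j = if j = c then b else if Y j = b then i else Y j) :
    load m v Y' b = v c ∧ load m v Y' i = load m v Y i - v c + load m v Y b ∧
      ∀ x, x ≠ i → x ≠ b → load m v Y' x = load m v Y x := by
  have hcb : Y' c = b := by rw [hY' c hc, if_pos rfl]
  refine ⟨?_, ?_, ?_⟩
  · rw [← hcb]
    apply load_eq_of_unique hc
    intro j hj e
    by_contra hne
    rw [hcb, hY' j hj, if_neg hne] at e
    split_ifs at e with h1
    · exact hib e.symm
    · exact h1 e
  · unfold load
    rw [← add_sum_erase _ _ (mem_range.2 hc),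
      ← add_sum_erase (range m) (fun j => if Y j = i then v j else 0) (mem_range.2 hc),
      ← add_sum_erase (range m) (fun j => if Y j = b then v j else 0) (mem_range.2 hc),
      hcb, if_neg hib, hci, if_pos rfl, if_neg hib.symm]
    have : ∑ x ∈ (range m).erase c, (if Y' x = i then v x else 0) =
        ∑ x ∈ (range m).erase c, (if Y x = i then v x else 0) +
          ∑ x ∈ (range m).erase c, (if Y x = b then v x else 0) := by
      rw [← sum_add_distrib]
      apply sum_congr rfl
      intro x hx
      rw [mem_erase, mem_range] at hx
      rw [hY' x hx.2, if_neg hx.1]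
      by_cases h1 : Y x = b
      · simp [h1, hib]
      · simp [h1]
    rw [this]
    ring
  · intro x hxi hxb
    apply sum_congr rfl
    intro j hj
    rw [mem_range] at hj
    rw [hY' j hj]
    by_cases h1 : j = c
    · subst h1
      rw [if_pos rfl, if_neg hxb.symm, hci, if_neg hxi.symm]
    · rw [if_neg h1]
      by_cases h2 : Y j = b
      · rw [if_pos h2, if_neg hxi.symm, h2, if_neg hxb.symm]
      · rw [if_neg h2]

/-- If agent `i` is in the middle case and does not hold both liked and disliked chores, all its
chores have price `K` (liking a chore of price `K` forces `K = 1`). Two of them would exceed `K +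
a`, so it has a single chore. -/
theorem Repaired.skip {a : ℝ} {i : ℕ} (h : Repaired D n m K U w a i Y) (hK : 1 ≤ K) (haK : a < K)
    (hskip : (∀ j < m, Y j = i → ¬ 1 < D i j) ∨ (∀ j < m, Y j = i → 1 < D i j) ∨
      ∀ b < n, K ≤ load m (D i) Y b) : Repaired D n m K U w a (i + 1) Y := by
  refine ⟨h.toSupported, h.lower, fun x hx => ?_⟩
  rcases h.cases x hx with hc | ⟨hU, hex, hle, hc⟩ | hc
  · exact Or.inl hc
  · rcases Nat.lt_or_ge x i with hlt | hge
    · exact Or.inr (Or.inl ⟨hU, hex, hle, fun _ => hc hlt⟩)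
    · rcases hge.lt_or_eq with hlt | rfl
      · exact Or.inr (Or.inl ⟨hU, hex, hle, fun h' => by omega⟩)
      · have hw1 : (∀ j < m, Y j = i → w j = K) → ∀ j < m, ∀ j' < m, Y j = i → Y j' = i →
            j = j' := by
          intro hall j hj j' hj' e e'
          by_contra hne
          have h1 := add_le_load (Y := Y) (h.price_nonneg hK) hj hj' hne (e'.trans e.symm)
          rw [e, hall j hj e, hall j' hj' e'] at h1
          linarith
        rcases hskip with hs | hs | hs
        · left
          obtain ⟨j0, hj0, e0, hw0⟩ := hex
          have h1 := hs j0 hj0 e0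
          have h2 := h.eq_of_light j0 hj0 (by rw [e0]; exact hU)
          rw [e0, hw0] at h2
          have hK1 : K = 1 := by rw [h2] at h1; linarith
          apply hw1
          intro j hj _
          rcases h.price_cases j hj with e | e
          · rw [e, hK1]
          · exact e
        · left
          apply hw1
          intro j hj e
          have h1 := hs j hj e
          have h2 := h.eq_of_light j hj (by rw [e]; exact hU)
          rw [e] at h2
          rcases h.price_cases j hj with e' | e'
          · linarith
          · exact e'
        · exact Or.inr (Or.inl ⟨hU, hex, hle, fun _ => hs⟩)
  · exact Or.inr (Or.inr hc)

/-- Agent `i` is in the middle case, so without `c` its bundle costs at most `a`, and the bundle of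
`b` adds less than `K`. Agent `b` ends with the single chore `c`, envies nobody up to one chore, and
is not envied too much, since `c` costs `K` to every light agent. -/
theorem Repaired.exchange {a : ℝ} {i : ℕ} (h : Repaired D n m K U w a i Y) (hK : 1 ≤ K)
    (haK : a < K) (hD : ∀ i < n, ∀ j < m, D i j = 1 ∨ D i j = K) (hi : i < n) {b c c' : ℕ}
    {Y' : ℕ → ℕ} (hc : c < m) (hci : Y c = i) (hcD : 1 < D i c) (hc' : c' < m) (hci' : Y c' = i)
    (hcD' : ¬ 1 < D i c') (hb : b < n) (hbK : load m (D i) Y b < K)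
    (hbmin : ∀ x < n, load m (D i) Y b ≤ load m (D i) Y x)
    (hY' : ∀ j < m, Y' j = if j = c then b else if Y j = b then i else Y j) :
    Repaired D n m K U w a (i + 1) Y' := by
  have hcc : c ≠ c' := by rintro rfl; exact hcD' hcD
  have hDc : D i c = K := by
    rcases hD i hi c hc with e | e
    · linarith
    · exact e
  have hK1 : 1 < K := hDc ▸ hcD
  have hw0 := h.price_nonneg hK
  have hw1 := h.one_le_price hK
  have hU : U i := by
    by_contra hU
    have := (h.eq_of_heavy c hc (by rw [hci]; exact hU)).1
    rw [hci] at this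
    linarith
  have hwc : w c = K := by
    have := h.eq_of_light c hc (by rw [hci]; exact hU)
    rw [hci] at this
    linarith
  have hle : load m w Y i ≤ K + a := by
    rcases h.cases i hi with hA | ⟨_, _, hle, _⟩ | ⟨_, hones, _⟩
    · exact absurd (hA c hc c' hc' hci hci') hcc
    · exact hle
    · have := hones c hc hci
      linarith
  have hDi0 : ∀ j < m, 0 ≤ D i j := by
    intro j hj
    rcases hD i hi j hj with e | e <;> rw [e] <;> linarith
  have hbi : b ≠ i := by
    rintro rfl
    have := le_load (Y := Y) hDi0 hc
    rw [hci, hDc] at this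
    linarith
  -- Agent `i` holds `c` of price `K` and another chore of price at least 1, with total at most `K +
  -- a`.
  have ha1 : 1 ≤ a := by
    have h1 := add_le_load (Y := Y) hw0 hc hc' hcc (hci'.trans hci.symm)
    have h2 := hw1 c' hc'
    rw [hci] at h1
    linarith
  -- the bundle of `b`
  have hbD : ∀ j < m, Y j = b → D i j = 1 := by
    intro j hj e
    rcases hD i hi j hj with e' | e'
    · exact e'
    · have := le_load (Y := Y) hDi0 hj
      rw [e] at this
      linarith
  have hbw : ∀ j < m, Y j = b → w j = 1 := by
    intro j hj e
    have h1 := h.price_le j hj i hi hU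
    rw [hbD j hj e] at h1
    exact le_antisymm h1 (hw1 j hj)
  -- The chores of `b` have price 1, whereas heavy agents hold only chores of price `K > 1`. A heavy
  -- `b` would have nothing, contrary to the least load `a ≥ 1`.
  have hbU : U b := by
    by_contra hbU
    have h0 : load m w Y b = 0 := by
      apply sum_eq_zero
      intro j hj
      rw [mem_range] at hj
      refine if_neg fun e => ?_
      have h1 := (h.eq_of_heavy j hj (by rw [e]; exact hbU)).2
      have h2 := hbw j hj e
      linarith
    have := h.lower b hb
    linarith
  have hbl : load m (D i) Y b = load m w Y b := by
    apply sum_congr rfl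
    intro j hj
    rw [mem_range] at hj
    split_ifs with e
    · rw [hbD j hj e, hbw j hj e]
    · rfl
  have hab := h.lower b hb
  rw [hbl] at hbK hbmin
  have hl := fun v => load_exchange (m := m) v hc hci hbi hY'
  have hY'b : Y' c = b := by rw [hY' c hc, if_pos rfl]
  have hY'cases : ∀ j < m, (j = c) ∨ (j ≠ c ∧ Y j = b ∧ Y' j = i) ∨
      (j ≠ c ∧ Y j ≠ b ∧ Y' j = Y j) := by
    intro j hj
    by_cases h1 : j = c
    · exact Or.inl h1
    · by_cases h2 : Y j = b
      · exact Or.inr (Or.inl ⟨h1, h2, by rw [hY' j hj, if_neg h1, if_pos h2]⟩)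
      · exact Or.inr (Or.inr ⟨h1, h2, by rw [hY' j hj, if_neg h1, if_neg h2]⟩)
  have hUD : ∀ x < n, U x → K ≤ D x c := fun x hx hUx => hwc ▸ h.price_le c hc x hx hUx
  have hKmul := ratio_mul_self hK
  have hr1 := one_le_ratio hK
  have hwi : K ≤ load m w Y i := by
    have := le_load (Y := Y) hw0 hc
    rwa [hci, hwc] at this
  have hl_i : load m w Y' i ≤ a + load m w Y b := by
    rw [(hl w).2.1, hwc]
    linarith
  have hsup : Supported D n m K U w Y' := by
    refine ⟨fun j hj => ?_, h.price_cases, h.price_le, fun j hj hUj => ?_, fun j hj hUj => ?_⟩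
    · rcases hY'cases j hj with rfl | ⟨_, _, e⟩ | ⟨_, _, e⟩
      · rw [hY'b]; exact hb
      · rw [e]; exact hi
      · rw [e]; exact h.assigned j hj
    · rcases hY'cases j hj with rfl | ⟨_, e', e⟩ | ⟨_, _, e⟩
      · rw [hY'b, hwc]
        have h1 := hUD b hb hbU
        rcases hD b hb j hj with e | e
        · linarith
        · exact e
      · rw [e, hbD j hj e', hbw j hj e']
      · rw [e] at hUj ⊢
        exact h.eq_of_light j hj hUj
    · rcases hY'cases j hj with rfl | ⟨_, _, e⟩ | ⟨_, _, e⟩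
      · rw [hY'b] at hUj; exact absurd hbU hUj
      · rw [e] at hUj; exact absurd hU hUj
      · rw [e] at hUj ⊢
        exact h.eq_of_heavy j hj hUj
  refine ⟨hsup, fun x hx => ?_, fun x hx => ?_⟩
  · by_cases hxb : x = b
    · rw [hxb, (hl w).1, hwc]; exact haK.le
    · by_cases hxi : x = i
      · rw [hxi, (hl w).2.1, hwc]; linarith
      · rw [(hl w).2.2 x hxi hxb]; exact h.lower x hx
  · by_cases hxb : x = b
    · left
      have huniq : ∀ j < m, Y' j = b → j = c := by
        intro j hj e
        rcases hY'cases j hj with h1 | ⟨_, _, e'⟩ | ⟨_, h2, e'⟩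
        · exact h1
        · exact absurd (e.symm.trans e') hbi
        · exact absurd (e'.symm.trans e) h2
      intro j hj j' hj' e e'
      rw [huniq j hj (e.trans hxb), huniq j' hj' (e'.trans hxb)]
    · by_cases hxi : x = i
      · right; right
        subst hxi
        refine ⟨hU, fun j hj e => ?_, by linarith, fun z hz => ?_⟩
        · rcases hY'cases j hj with rfl | ⟨_, e', _⟩ | ⟨hne, _, e'⟩
          · exact absurd (hY'b.symm.trans e) hbi
          · exact hbw j hj e'
          · rcases h.price_cases j hj with e'' | e''
            · exact e''
            · have h1 := add_le_load (Y := Y) hw0 hj hc hne (hci.trans (e.symm.trans e'))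
              rw [e'', hwc, e'.symm.trans e] at h1
              linarith
        -- The new load of `i` is at most `a + load b`. Against `c` it suffices that this is below
        -- `2 * K`; against another bundle, `a ≤ load b` bounds it by `2 * load b`, and `b` was
        -- cheapest for `i`.
        · by_cases hzb : z = b
          · rw [hzb, (hl (D x)).1, hDc, hKmul]
            linarith
          · by_cases hzx : z = x
            · rw [hzx, hsup.load_self hU]
              have := le_ratio_mul hK (load_nonneg hw0 Y' x)
              linarith
            · rw [(hl (D x)).2.2 z hzx hzb]
              have h1 := two_mul_sub_one_le_ratio_mul hK hbK.le
              have h2 := mul_le_mul_of_nonneg_left (hbmin z hz) (by linarith : 0 ≤ ratio K)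
              linarith
      · have hsame : ∀ j < m, Y' j = x → Y j = x := by
          intro j hj e
          rcases hY'cases j hj with rfl | ⟨_, _, e'⟩ | ⟨_, _, e'⟩
          · exact absurd (e.symm.trans hY'b) hxb
          · exact absurd (e.symm.trans e') hxi
          · exact e'.symm.trans e
        have hsame' : ∀ j < m, Y j = x → Y' j = x := by
          intro j hj e
          rcases hY'cases j hj with rfl | ⟨_, e', _⟩ | ⟨_, _, e'⟩
          · exact absurd (e.symm.trans hci) hxi
          · exact absurd (e.symm.trans e') hxb
          · exact e'.trans e
        have hDx0 : ∀ j < m, 0 ≤ D x j := by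
          intro j hj
          rcases hD x hx j hj with e | e <;> rw [e] <;> linarith
        -- To an onlooker `x`, the new bundle of `i` contains the old bundle of `b`, so bounds
        -- against the latter carry over; and the new bundle of `b` costs a light `x` the amount
        -- `K`.
        have hgrow : ∀ z, z ≠ b → load m (D x) Y b ≤ load m (D x) Y' i ∧
            (z ≠ i → load m (D x) Y' z = load m (D x) Y z) := by
          intro z hzb
          refine ⟨?_, fun hzi => (hl (D x)).2.2 z hzi hzb⟩
          rw [(hl (D x)).2.1]
          have := le_load (Y := Y) hDx0 hc
          rw [hci] at this
          linarith
        rcases h.cases x hx with hA | ⟨hUx, ⟨j, hj, e, hwj⟩, hle', hBx⟩ | ⟨hUx, hones, hle', hCx⟩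
        · exact Or.inl fun j hj j' hj' e e' => hA j hj j' hj' (hsame j hj e) (hsame j' hj' e')
        · right; left
          refine ⟨hUx, ⟨j, hj, hsame' j hj e, hwj⟩, ?_, fun hlt z hz => ?_⟩
          · rw [(hl w).2.2 x hxi hxb]; exact hle'
          · have hlt' : x < i := by omega
            by_cases hzb : z = b
            · rw [hzb, (hl (D x)).1]; exact hUD x hx hUx
            · by_cases hzi : z = i
              · rw [hzi]; exact (hBx hlt' b hb).trans (hgrow z hzb).1
              · rw [(hgrow z hzb).2 hzi]; exact hBx hlt' z hz
        · right; right
          refine ⟨hUx, fun j hj e => hones j hj (hsame j hj e), ?_, fun z hz => ?_⟩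
          · rw [(hl w).2.2 x hxi hxb]; exact hle'
          · rw [(hl w).2.2 x hxi hxb]
            by_cases hzb : z = b
            · rw [hzb, (hl (D x)).1]
              have := mul_le_mul_of_nonneg_left (hUD x hx hUx) (by linarith : 0 ≤ ratio K)
              linarith
            · by_cases hzi : z = i
              · rw [hzi]
                have := mul_le_mul_of_nonneg_left (hgrow z hzb).1 (by linarith : 0 ≤ ratio K)
                exact (hCx b hb).trans this
              · rw [(hgrow z hzb).2 hzi]; exact hCx z hz

end

/-! ### The program for the exchanges -/

/-- The test that two natural numbers are equal. -/
abbrev eqTest (x y : NatExpr) : Test := .and (.not (.natLt x y)) (.not (.natLt y x))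

theorem eqTest_holds (s : Store) (x y : NatExpr) : (eqTest x y).Holds s ↔ x.eval s = y.eval s := by
  simp only [Test.Holds]; omega

/-- Record chore `j` if it belongs to agent `i`: in the variable `29` if the agent dislikes it, by
the flag `30` otherwise. -/
def scanBody : Cmd :=
  .cond (eqTest (ent 1 (var 13)) (var 16))
    (.cond (likesTest (var 16) (var 13)) (.setNat 30 (.lit 0) (.lit 0) (.lit 1))
      (.setNat 29 (.lit 0) (.lit 0) (var 13))) .skip

/-- Look for a disliked and a liked chore of agent `i`. -/
def scanProg : Cmd :=
  .seq (.setNat 29 (.lit 0) (.lit 0) (.get 0 (.lit 0) (.lit 1)))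
    (.seq (.setNat 30 (.lit 0) (.lit 0) (.lit 0)) (.loop 13 1 scanBody))

/-- Write the disutilities of all bundles for agent `i` to the array `2`. -/
def disutilityProg : Cmd :=
  .seq (.loop 12 0 (.setNum 2 (.lit 0) (var 12) (.lit 0)))
    (.loop 13 1 (.setNum 2 (.lit 0) (ent 1 (var 13))
      (.add (.get 2 (.lit 0) (ent 1 (var 13))) (.get 0 (var 16) (var 13)))))

/-- Give the bundle of the agent in the variable `24` to agent `i`. -/
def takeProg : Cmd :=
  .loop 13 1 (.cond (eqTest (ent 1 (var 13)) (var 24)) (.setNat 1 (.lit 0) (var 13) (var 16)) .skip)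

/-- Find a bundle of least disutility for agent `i`. -/
def bestProg : Cmd :=
  argProg 24 (.not (.natLt (.lit 0) (.lit 0)))
    (.numLt (.get 2 (.lit 0) (var 12)) (.get 2 (.lit 0) (var 24)))

/-- Exchange the bundle of the agent in the variable `24` for the chore in the variable `29`, if
agent `i` prefers that bundle to the chore. -/
def exchangeProg : Cmd :=
  .cond (.numLt (.get 2 (.lit 0) (var 24)) (.get 1 (.lit 0) (.lit 0)))
    (.seq takeProg (.setNat 1 (.lit 0) (var 29) (var 24))) .skip

/-- Treat agent `i`. -/
def repairBody : Cmd :=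
  .seq scanProg (.cond (.and (.natLt (var 29) (.get 0 (.lit 0) (.lit 1))) (.natLt (.lit 0) (var 30)))
    (.seq disutilityProg (.seq bestProg exchangeProg)) .skip)

section

variable {D : ℕ → ℕ → ℝ} {n m : ℕ} {K : ℝ} {X hi : ℕ → ℕ} {i : ℕ} {s : Store}

theorem scanProg_spec (h : HasInput s n m D) (hi : s.nat 16 0 0 = i) :
    (((scanProg.den s).nat 29 0 0 = m ∧ ∀ j < m, s.nat 1 0 j = i → ¬ 1 < D i j) ∨
      ((scanProg.den s).nat 29 0 0 < m ∧ s.nat 1 0 ((scanProg.den s).nat 29 0 0) = i ∧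
        1 < D i ((scanProg.den s).nat 29 0 0))) ∧
    (((scanProg.den s).nat 30 0 0 = 0 ∧ ∀ j < m, s.nat 1 0 j = i → 1 < D i j) ∨
      (0 < (scanProg.den s).nat 30 0 0 ∧ ∃ j < m, s.nat 1 0 j = i ∧ ¬ 1 < D i j)) := by
  set C : Cmd := .seq (.setNat 29 (.lit 0) (.lit 0) (.get 0 (.lit 0) (.lit 1)))
    (.setNat 30 (.lit 0) (.lit 0) (.lit 0)) with hC
  have hin : HasInput (C.den s) n m D := h.den (by decide) (by decide)
  have key := Cmd.den_loop_induction (v := 13) (b := 1) (C := scanBody) (s := C.den s)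
    (fun j u => ((u.nat 29 0 0 = m ∧ ∀ j' < j, s.nat 1 0 j' = i → ¬ 1 < D i j') ∨
      (u.nat 29 0 0 < m ∧ s.nat 1 0 (u.nat 29 0 0) = i ∧ 1 < D i (u.nat 29 0 0))) ∧
      ((u.nat 30 0 0 = 0 ∧ ∀ j' < j, s.nat 1 0 j' = i → 1 < D i j') ∨
      (0 < u.nat 30 0 0 ∧ ∃ j' < m, s.nat 1 0 j' = i ∧ ¬ 1 < D i j')))
    (by simp [hC, h.chores]) (by
      intro j u hj hv hf ⟨ih1, ih2⟩
      rw [hin.chores] at hj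
      have hu : HasInput u n m D := hin.of_frame hf (by decide) (by decide)
      have e1 : u.nat 1 = s.nat 1 := (hf.1 1 (by decide)).trans (by simp [hC])
      have e16 : u.nat 16 0 0 = i := by rw [hf.1 16 (by decide)]; simp [hC, hi]
      rw [Store.setNat_nat_ne _ _ _ _ (show 29 ≠ 13 by decide),
        Store.setNat_nat_ne _ _ _ _ (show 30 ≠ 13 by decide), scanBody, Cmd.den_cond]
      by_cases hc : s.nat 1 0 j = i
      · rw [if_pos (by rw [eqTest_holds]; simp [hv, e1, e16, hc]), Cmd.den_cond]
        by_cases hd : 1 < D i j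
        · rw [if_neg (by simp [hv, e16, hu.disutility, hd])]
          simp only [Cmd.den_setNat, NatExpr.eval, hv, Store.setNat_row, Function.update_self,
            Store.setNat_nat_ne _ _ _ _ (show 30 ≠ 29 by decide)]
          refine ⟨Or.inr ⟨hj, hc, hd⟩, ih2.imp_left fun ⟨h1, h2⟩ => ⟨h1, fun j' hj' e => ?_⟩⟩
          rcases Nat.lt_succ_iff_lt_or_eq.mp hj' with h' | rfl
          · exact h2 j' h' e
          · exact hd
        · rw [if_pos (by simpa [hv, e16, hu.disutility] using hd)]
          simp only [Cmd.den_setNat, NatExpr.eval, Store.setNat_row, Function.update_self,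
            Store.setNat_nat_ne _ _ _ _ (show 29 ≠ 30 by decide)]
          refine ⟨ih1.imp_left fun ⟨h1, h2⟩ => ⟨h1, fun j' hj' e => ?_⟩,
            Or.inr ⟨by omega, j, hj, hc, hd⟩⟩
          rcases Nat.lt_succ_iff_lt_or_eq.mp hj' with h' | rfl
          · exact h2 j' h' e
          · exact hd
      · rw [if_neg (by rw [eqTest_holds]; simpa [hv, e1, e16] using hc), Cmd.den_skip]
        refine ⟨ih1.imp_left fun ⟨h1, h2⟩ => ⟨h1, fun j' hj' e => ?_⟩,
          ih2.imp_left fun ⟨h1, h2⟩ => ⟨h1, fun j' hj' e => ?_⟩⟩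
        · rcases Nat.lt_succ_iff_lt_or_eq.mp hj' with h' | rfl
          · exact h2 j' h' e
          · exact absurd e hc
        · rcases Nat.lt_succ_iff_lt_or_eq.mp hj' with h' | rfl
          · exact h2 j' h' e
          · exact absurd e hc)
  rw [hin.chores] at key
  exact key

theorem disutilityProg_spec (h : HasInput s n m D) (hi : s.nat 16 0 0 = i) :
    ∀ a < n, (disutilityProg.den s).num 2 0 a = load m (D i) (s.nat 1 0) a := by
  set C : Cmd := Cmd.loop 12 0 (.setNum 2 (.lit 0) (var 12) (.lit 0)) with hC
  have key := Cmd.den_loop_induction (v := 12) (b := 0)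
    (C := .setNum 2 (.lit 0) (var 12) (.lit 0)) (s := s)
    (fun i t => ∀ y < i, t.num 2 0 y = 0) (by simp) (by
      intro i t hi hv hf ht y hy
      by_cases hyi : y = i
      · simp [hyi, hv]
      · simpa [hyi, hv] using ht y (by omega))
  rw [h.agents] at key
  have hin : HasInput (C.den s) n m D := h.den (by decide) (by decide)
  have f1 := (C.frame_den s).1 1 (by decide)
  have f16 := (C.frame_den s).1 16 (by decide)
  have key' := Cmd.den_loop_induction (v := 13) (b := 1) (s := C.den s)
    (C := .setNum 2 (.lit 0) (ent 1 (var 13))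
      (.add (.get 2 (.lit 0) (ent 1 (var 13))) (.get 0 (var 16) (var 13))))
    (fun j t => ∀ a < n, t.num 2 0 a = load j (D i) (s.nat 1 0) a)
    (fun a ha => by simpa [load_zero] using key a ha) (by
      intro j t hj hv hf ht a ha
      have ht' : HasInput t n m D := hin.of_frame hf (by decide) (by decide)
      have e1 : t.nat 1 = s.nat 1 := (hf.1 1 (by decide)).trans f1
      have e16 : t.nat 16 0 0 = i := by rw [hf.1 16 (by decide), f16, hi]
      rw [load_succ, ← ht a ha]
      by_cases hij : s.nat 1 0 j = a
      · subst hij; simp [hv, e1, e16, ht'.disutility]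
      · simp [hv, e1, hij, Ne.symm hij])
  rw [hin.chores] at key'
  exact key'

theorem takeProg_spec (h : HasInput s n m D) (hi : s.nat 16 0 0 = i) :
    ∀ j < m, (takeProg.den s).nat 1 0 j =
      if s.nat 1 0 j = s.nat 24 0 0 then i else s.nat 1 0 j := by
  have key := Cmd.den_loop_induction (v := 13) (b := 1) (s := s)
    (C := .cond (eqTest (ent 1 (var 13)) (var 24)) (.setNat 1 (.lit 0) (var 13) (var 16)) .skip)
    (fun j u => ∀ j' < m, u.nat 1 0 j' =
      if j' < j ∧ s.nat 1 0 j' = s.nat 24 0 0 then i else s.nat 1 0 j') (by simp) (by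
      intro j u hj hv hf ih j' hj'
      rw [h.chores] at hj
      have e24 : u.nat 24 = s.nat 24 := hf.1 24 (by decide)
      have e16 : u.nat 16 0 0 = i := by rw [hf.1 16 (by decide), hi]
      have ej : u.nat 1 0 j = s.nat 1 0 j := by rw [ih j hj, if_neg (by omega)]
      rw [Store.setNat_nat_ne _ _ _ _ (show 1 ≠ 13 by decide), Cmd.den_cond]
      by_cases hc : s.nat 1 0 j = s.nat 24 0 0
      · rw [if_pos (by rw [eqTest_holds]; simp [hv, ej, e24, hc])]
        by_cases hjj : j' = j
        · subst hjj
          simp [hv, e16, hc]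
        · simp only [Cmd.den_setNat, NatExpr.eval, hv, Store.setNat_row,
            Function.update_of_ne hjj]
          rw [ih j' hj']
          congr 1
          refine propext (and_congr_left fun _ => ?_)
          omega
      · rw [if_neg (by rw [eqTest_holds]; simpa [hv, ej, e24] using hc), Cmd.den_skip, ih j' hj']
        congr 1
        refine propext ⟨fun ⟨h1, h2⟩ => ⟨by omega, h2⟩, fun ⟨h1, h2⟩ => ⟨?_, h2⟩⟩
        rcases Nat.lt_succ_iff_lt_or_eq.mp h1 with h' | rfl
        · exact h'
        · exact absurd h2 hc)
  rw [h.chores] at key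
  intro j hj
  have := key j hj
  simp only [hj, true_and] at this
  exact this

theorem repairBody_spec (hn : 0 < n) (h : Ctx s n m D K X hi) (hi16 : s.nat 16 0 0 = i) :
    let Y := s.nat 1 0
    let Y' := (repairBody.den s).nat 1 0
    (Y' = Y ∧ ((∀ j < m, Y j = i → ¬ 1 < D i j) ∨ (∀ j < m, Y j = i → 1 < D i j) ∨
      ∀ b < n, K ≤ load m (D i) Y b)) ∨
    ∃ b c c', c < m ∧ Y c = i ∧ 1 < D i c ∧ c' < m ∧ Y c' = i ∧ ¬ 1 < D i c' ∧ b < n ∧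
      load m (D i) Y b < K ∧ (∀ x < n, load m (D i) Y b ≤ load m (D i) Y x) ∧
      ∀ j < m, Y' j = if j = c then b else if Y j = b then i else Y j := by
  intro Y Y'
  obtain ⟨h29, h30⟩ := scanProg_spec h.toHasInput hi16
  set s1 := scanProg.den s with hs1
  have c1 : Ctx s1 n m D K X hi := h.den (by decide) (by decide)
  have f1 : s1.nat 1 = s.nat 1 := (scanProg.frame_den s).1 1 (by decide)
  have f16 : s1.nat 16 0 0 = i := by rw [(scanProg.frame_den s).1 16 (by decide), hi16]
  have hY' : Y' = ((Cmd.cond (.and (.natLt (var 29) (.get 0 (.lit 0) (.lit 1)))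
    (.natLt (.lit 0) (var 30))) (.seq disutilityProg (.seq bestProg exchangeProg))
      .skip).den s1).nat 1 0 := rfl
  rw [Cmd.den_cond] at hY'
  by_cases hc : s1.nat 29 0 0 < m ∧ 0 < s1.nat 30 0 0
  · rw [if_pos (by simpa [c1.chores] using hc)] at hY'
    obtain ⟨g1, g2⟩ := h29.resolve_left fun h' => by omega
    obtain ⟨c', hc'm, g3, g4⟩ := (h30.resolve_left fun h' => by omega).2
    have hd := disutilityProg_spec c1.toHasInput f16
    rw [f1] at hd
    set s2 := disutilityProg.den s1 with hs2
    have c2 : Ctx s2 n m D K X hi := c1.den (by decide) (by decide)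
    have p1 : s2.nat 1 = s.nat 1 := ((disutilityProg.frame_den s1).1 1 (by decide)).trans f1
    have p16 : s2.nat 16 0 0 = i := by rw [(disutilityProg.frame_den s1).1 16 (by decide), f16]
    have p29 : s2.nat 29 = s1.nat 29 := (disutilityProg.frame_den s1).1 29 (by decide)
    have key := argProg_spec c2.toHasInput (v := 24) (b := .not (.natLt (.lit 0) (.lit 0)))
      (better := .numLt (.get 2 (.lit 0) (var 12)) (.get 2 (.lit 0) (var 24)))
      (by decide) (by decide) (fun _ => True) (load m (D i) Y) (by simp)
      (by
        intro u hnum hu hlt hlt'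
        simp [hnum, hd _ hlt, hd _ hlt', Y])
    set s3 := bestProg.den s2 with hs3
    have c3 : Ctx s3 n m D K X hi := c2.den (by decide) (by decide)
    have q1 : s3.nat 1 = s.nat 1 := ((bestProg.frame_den s2).1 1 (by decide)).trans p1
    have q16 : s3.nat 16 0 0 = i := by rw [(bestProg.frame_den s2).1 16 (by decide), p16]
    have q29 : s3.nat 29 = s1.nat 29 := ((bestProg.frame_den s2).1 29 (by decide)).trans p29
    have ql : s3.num 2 = s2.num 2 := (bestProg.frame_den s2).2 2 (by decide)
    change (s3.nat 24 0 0 = n ∧ _) ∨ (s3.nat 24 0 0 < n ∧ _ ∧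
      ∀ x < n, True → load m (D i) Y (s3.nat 24 0 0) ≤ load m (D i) Y x) at key
    obtain ⟨k1, -, k2⟩ := key.resolve_left fun h' => h'.2 0 hn trivial
    set b := s3.nat 24 0 0 with hb
    have hY'' : Y' = (exchangeProg.den s3).nat 1 0 := hY'
    rw [exchangeProg, Cmd.den_cond] at hY''
    by_cases hlt : load m (D i) Y b < K
    · right
      rw [if_pos (by simpa [ql, ← hb, hd _ k1, c3.large] using hlt)] at hY''
      have ht := takeProg_spec c3.toHasInput q16
      rw [q1, ← hb] at ht
      refine ⟨b, s1.nat 29 0 0, c', g1, g2.1, g2.2, hc'm, g3, g4, k1, hlt,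
        fun x hx => k2 x hx trivial, fun j hj => ?_⟩
      have r24 : (takeProg.den s3).nat 24 0 0 = b := by
        rw [(takeProg.frame_den s3).1 24 (by decide)]
      have r29 : (takeProg.den s3).nat 29 = s1.nat 29 := by
        rw [(takeProg.frame_den s3).1 29 (by decide), q29]
      rw [hY'', Cmd.den_seq, Cmd.den_setNat]
      simp only [NatExpr.eval, Store.setNat_row, r24, r29]
      by_cases hjc : j = s1.nat 29 0 0
      · rw [hjc, Function.update_self, if_pos rfl]
      · rw [Function.update_of_ne hjc, if_neg hjc, ht j hj]
    · left
      rw [if_neg (by simpa [ql, ← hb, hd _ k1, c3.large] using hlt), Cmd.den_skip, q1] at hY''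
      exact ⟨hY'', Or.inr (Or.inr fun x hx => (not_lt.1 hlt).trans (k2 x hx trivial))⟩
  · left
    rw [if_neg (by simpa [c1.chores] using hc), Cmd.den_skip, f1] at hY'
    refine ⟨hY', ?_⟩
    rcases h29 with h29 | h29
    · exact Or.inl h29.2
    · rcases h30 with h30 | h30
      · exact Or.inr (Or.inl h30.2)
      · exact absurd ⟨h29.1, h30.1⟩ hc

/-- Treat all agents. -/
def repairProg : Cmd := .loop 16 0 repairBody

/-- The program does not test whether the least load is below `K`. If it is not, no exchange ever
takes place: heavy agents hold no disliked chores, and to light agents all bundles cost at least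
`K`. -/
theorem repairProg_spec {U : ℕ → Prop} {w : ℕ → ℝ} (hn : 0 < n) (h : Ctx s n m D K X hi)
    (hK : 1 ≤ K) (hD : ∀ i < n, ∀ j < m, D i j = 1 ∨ D i j = K)
    (hsup : Supported D n m K U w (s.nat 1 0)) (hf : PriceFair n m K w (s.nat 1 0)) :
    Supported D n m K U w ((repairProg.den s).nat 1 0) ∧
      ApproxEFX D n m K ((repairProg.den s).nat 1 0) := by
  obtain ⟨x, hx, hmin⟩ := exists_min_image (range n) (load m w (s.nat 1 0)) ⟨0, by simpa using hn⟩
  simp only [mem_range] at hx hmin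
  by_cases hxK : load m w (s.nat 1 0) x < K
  · have key := Cmd.den_loop_induction (v := 16) (b := 0) (C := repairBody) (s := s)
      (fun i u => Repaired D n m K U w (load m w (s.nat 1 0) x) i (u.nat 1 0))
      (by
        rw [Store.setNat_nat_ne _ _ _ _ (by decide)]
        exact hsup.repaired hK hf hx hxK hmin) (by
        intro i u hi' hv hfr ih
        rw [h.agents] at hi'
        have hu : Ctx u n m D K X hi := h.of_frame hfr (by decide) (by decide)
        rw [Store.setNat_nat_ne _ _ _ _ (by decide)]
        rcases repairBody_spec hn hu hv with ⟨e, hs⟩ | ⟨b, c, c', h1, h2, h3, h4, h5, h6, h7, h8,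
          h9, h10⟩
        · rw [e]
          exact ih.skip hK hxK hs
        · exact ih.exchange hK hxK hD hi' h1 h2 h3 h4 h5 h6 h7 h8 h9 h10)
    rw [h.agents] at key
    exact ⟨key.toSupported, key.efx hK hxK hD⟩
  · have hlarge : ∀ a < n, K ≤ load m w (s.nat 1 0) a := fun a ha =>
      (not_lt.1 hxK).trans (hmin a ha)
    have key := Cmd.den_loop_induction (v := 16) (b := 0) (C := repairBody) (s := s)
      (fun i u => u.nat 1 0 = s.nat 1 0) (by simp) (by
        intro i u hi' hv hfr ih
        rw [h.agents] at hi'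
        have hu : Ctx u n m D K X hi := h.of_frame hfr (by decide) (by decide)
        rw [Store.setNat_nat_ne _ _ _ _ (by decide)]
        rcases repairBody_spec hn hu hv with ⟨e, hs⟩ | ⟨b, c, c', h1, h2, h3, h4, h5, h6, h7, h8,
          h9, h10⟩
        · rw [e, ih]
        · exfalso
          rw [ih] at h2 h8
          have hU : U i := by
            by_contra hU
            have := (hsup.eq_of_heavy c h1 (by rw [h2]; exact hU)).1
            rw [h2] at this
            linarith
          have := (hlarge b h7).trans (hsup.load_le hi' hU b)
          linarith)
    change (repairProg.den s).nat 1 0 = s.nat 1 0 at key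
    rw [key]
    exact ⟨hsup, hsup.efx_of_large hK hD hf hlarge⟩

end

/-! ### The whole algorithm, Pareto optimality and the theorem -/

/-- The whole algorithm. -/
def mainProg : Cmd :=
  .seq maxProg (.seq initProg (.seq balanceProg (.seq levelProg (.seq distributeProg repairProg))))

theorem mainProg_wellFormed : mainProg.WellFormed := by decide

theorem mainProg_spec {s : Store} {n m : ℕ} {D : ℕ → ℕ → ℝ} (h : HasInput s n m D) (hn : 0 < n)
    (hm : 0 < m) {k : ℝ} (hk : 1 ≤ k) (hD : ∀ i < n, ∀ j < m, D i j = 1 ∨ D i j = k) :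
    ∃ K U w, 1 ≤ K ∧ K ≤ k ∧ Supported D n m K U w ((mainProg.den s).nat 1 0) ∧
      ApproxEFX D n m K ((mainProg.den s).nat 1 0) := by
  obtain ⟨hK, hKk, hDK⟩ := maxProg_spec h hk hD
  set s1 := maxProg.den s with hs1
  set K := s1.num 1 0 0 with hKdef
  have i1 : HasInput s1 n m D := h.den (by decide) (by decide)
  have hV := initProg_spec i1
  set s2 := initProg.den s1 with hs2
  have i2 : HasInput s2 n m D := i1.den (by decide) (by decide)
  have K2 : s2.num 1 = s1.num 1 := (initProg.frame_den s1).2 1 (by decide)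
  obtain ⟨hV3, hS3⟩ := balanceProg_spec i2 hV
  set s3 := balanceProg.den s2 with hs3
  have i3 : HasInput s3 n m D := i2.den (by decide) (by decide)
  have K3 : s3.num 1 = s1.num 1 := ((balanceProg.frame_den s2).2 1 (by decide)).trans K2
  have hL := levelProg_spec i3 hV3 hS3
  set s4 := levelProg.den s3 with hs4
  have c4 : Ctx s4 n m D K (s3.nat 2 0) (s4.nat 3 0) :=
    ⟨i3.den (by decide) (by decide), by rw [(levelProg.frame_den s3).2 1 (by decide), K3],
      by rw [(levelProg.frame_den s3).1 2 (by decide)], rfl⟩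
  obtain ⟨t, hf, hset, hs⟩ := distributeProg_spec hn hm hL hK c4
  set s5 := distributeProg.den s4 with hs5
  have c5 : Ctx s5 n m D K (s3.nat 2 0) (s4.nat 3 0) := c4.den (by decide) (by decide)
  have hsup := hset.supported hL hK hDK
  exact ⟨K, _, _, hK, hKk, repairProg_spec hn c5 hK hDK hsup (hset.fair hL hK hf hs)⟩

theorem sum_weight_load {D : ℕ → ℕ → ℝ} {n m : ℕ} {Y : ℕ → ℕ} (W : ℕ → ℝ)
    (hY : ∀ j < m, Y j < n) :
    ∑ i ∈ range n, W i * load m (D i) Y i = ∑ j ∈ range m, W (Y j) * D (Y j) j := by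
  simp only [load, mul_sum]
  rw [sum_comm]
  apply sum_congr rfl
  intro j hj
  rw [sum_eq_single (Y j)]
  · simp
  · intro i _ hne
    simp [hne.symm]
  · intro hno
    exact absurd (mem_range.2 (hY j (mem_range.1 hj))) hno

/-- A supported assignment is not dominated. -/
theorem Supported.not_dominated {D : ℕ → ℕ → ℝ} {n m : ℕ} {K : ℝ} {U : ℕ → Prop} {w : ℕ → ℝ}
    {Y : ℕ → ℕ} (h : Supported D n m K U w Y) (hK : 1 ≤ K)
    (hD : ∀ i < n, ∀ j < m, 1 ≤ D i j) {Z : ℕ → ℕ} (hZ : ∀ j < m, Z j < n)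
    (hle : ∀ i < n, load m (D i) Z i ≤ load m (D i) Y i) {a : ℕ} (ha : a < n)
    (hlt : load m (D a) Z a < load m (D a) Y a) : False := by
  classical
  -- With these weights each chore contributes its price to the weighted total of `Y`, and at least
  -- its price to that of any `Z`; domination would make the latter total strictly smaller.
  set W : ℕ → ℝ := fun i => if U i then 1 else K with hW
  have hWpos : ∀ i, 0 < W i := by
    intro i
    simp only [hW]
    split_ifs <;> linarith
  have h1 : ∑ i ∈ range n, W i * load m (D i) Z i < ∑ i ∈ range n, W i * load m (D i) Y i :=
    sum_lt_sum (fun i hi => mul_le_mul_of_nonneg_left (hle i (mem_range.1 hi)) (hWpos i).le)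
      ⟨a, mem_range.2 ha, mul_lt_mul_of_pos_left hlt (hWpos a)⟩
  rw [sum_weight_load W hZ, sum_weight_load W h.assigned] at h1
  refine absurd h1 (not_lt.2 (sum_le_sum fun j hj => ?_))
  rw [mem_range] at hj
  have e : W (Y j) * D (Y j) j = w j := by
    simp only [hW]
    split_ifs with hU
    · rw [one_mul, h.eq_of_light j hj hU]
    · rw [(h.eq_of_heavy j hj hU).1, (h.eq_of_heavy j hj hU).2, mul_one]
  rw [e]
  simp only [hW]
  split_ifs with hU
  · rw [one_mul]
    exact h.price_le j hj _ (hZ j hj) hU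
  · have h2 := hD _ (hZ j hj) j hj
    have h3 : w j ≤ K := by
      rcases h.price_cases j hj with e | e <;> rw [e]
      exact hK
    nlinarith

theorem ChoreInstance.hasInput {n m : ℕ} (I : ChoreInstance n m) :
    HasInput I.input n m (I.input.num 0) :=
  ⟨by simp [ChoreInstance.input, update], by simp [ChoreInstance.input, update], rfl⟩

theorem ChoreInstance.input_num {n m : ℕ} (I : ChoreInstance n m) (i : Fin n) (j : Fin m) :
    I.input.num 0 i j = I.d i j := by
  simp [ChoreInstance.input]

theorem ChoreInstance.disutility_bundle {n m : ℕ} (I : ChoreInstance n m) (X : Allocation n m)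
    {Y : ℕ → ℕ} (hY : ∀ j : Fin m, Y j = X j) (i h : Fin n) :
    I.disutility i (X.bundle h) = load m (I.input.num 0 i) Y h := by
  unfold ChoreInstance.disutility Allocation.bundle load
  rw [sum_filter, ← Fin.sum_univ_eq_sum_range (fun j => if Y j = h then I.input.num 0 i j else 0)]
  apply sum_congr rfl
  intro j _
  rw [I.input_num, hY]
  simp only [Fin.ext_iff]

/-- The compiled main program computes an envy-free and Pareto optimal allocation in polynomial
time. -/
theorem mainProg_computes (n m : ℕ) (hn : 0 < n) (k : ℝ) (hk : 1 ≤ k) (I : ChoreInstance n m)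
    (hI : I.IsBivalued k) :
    ∃ X : Allocation n m, I.IsEFX (2 - 1 / k) X ∧ I.IsParetoOptimal X ∧
      mainProg.compile.Computes I X (mainProg.time.eval (n + m)) := by
  have hin := I.hasInput
  obtain ⟨t, ht, hexec⟩ := mainProg.exec_compile mainProg_wellFormed I.input hin.agents hin.chores
  -- Without chores the threshold loop makes no attempt at all, so this case is settled directly.
  rcases Nat.eq_zero_or_pos m with rfl | hm
  · refine ⟨fun j => j.elim0, fun i h j => j.elim0, ?_, t, _, hexec, ht, fun j => j.elim0⟩
    rintro ⟨Y, -, a, ha⟩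
    have h0 (Z : Allocation n 0) : I.disutility a (Z.bundle a) = 0 :=
      Finset.sum_eq_zero fun j => j.elim0
    rw [h0, h0] at ha
    exact lt_irrefl _ ha
  have hD : ∀ i < n, ∀ j < m, I.input.num 0 i j = 1 ∨ I.input.num 0 i j = k := by
    intro i hi j hj
    have := hI ⟨i, hi⟩ ⟨j, hj⟩
    rwa [← I.input_num] at this
  obtain ⟨K, U, w, hK, hKk, hsup, hefx⟩ := mainProg_spec hin hn hm hk hD
  set Y := (mainProg.den I.input).nat 1 0 with hY
  set X : Allocation n m := fun j => ⟨Y j, hsup.assigned j j.2⟩ with hX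
  have hYX : ∀ j : Fin m, Y j = X j := fun j => rfl
  have hD1 : ∀ i < n, ∀ j < m, 1 ≤ I.input.num 0 i j := by
    intro i hi j hj
    rcases hD i hi j hj with e | e <;> rw [e]
    exact hk
  refine ⟨X, ?_, ?_, t, _, hexec, ht, fun j => rfl⟩
  · intro i h j hj
    have hij : X j = i := by simpa [Allocation.bundle] using hj
    have h1 := hefx h h.2 j j.2
    have hYj : Y j = i := by rw [hYX, hij]
    rw [hYj] at h1
    have h2 : I.disutility i ((X.bundle i).erase j) =
        I.disutility i (X.bundle i) - I.d i j := by
      unfold ChoreInstance.disutility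
      rw [Finset.sum_erase_eq_sub hj]
    rw [h2, I.disutility_bundle X hYX, I.disutility_bundle X hYX, ← I.input_num]
    refine h1.trans (mul_le_mul_of_nonneg_right ?_ ?_)
    -- The factor increases with `K`, and `K ≤ k`.
    · have := one_div_le_one_div_of_le (by linarith : 0 < K) hKk
      unfold ratio
      linarith
    · exact load_nonneg (fun j' hj' => by linarith [hD1 i i.2 j' hj']) Y h
  · rintro ⟨Z, hle, a, ha⟩
    set Z' : ℕ → ℕ := fun j => if h : j < m then Z ⟨j, h⟩ else 0 with hZ'
    have hZ : ∀ j : Fin m, Z' j = Z j := fun j => by simp [hZ']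
    refine hsup.not_dominated hK hD1 (Z := Z') (a := a) (fun j hj => ?_) (fun i hi => ?_) a.2 ?_
    · rw [hZ ⟨j, hj⟩]; exact (Z ⟨j, hj⟩).2
    · have := hle ⟨i, hi⟩
      rwa [I.disutility_bundle Z hZ, I.disutility_bundle X hYX] at this
    · rwa [I.disutility_bundle Z hZ, I.disutility_bundle X hYX] at ha

end ChoreDivision

theorem theorem6 :
    ∃ (P : ChoreDivision.Program) (p : Polynomial ℕ),
      ∀ (n m : ℕ) (_ : 0 < n) (k : ℝ) (_ : 1 ≤ k)
        (I : ChoreDivision.ChoreInstance n m) (_ : I.IsBivalued k),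
        ∃ X : ChoreDivision.Allocation n m,
          I.IsEFX (2 - 1 / k) X ∧ I.IsParetoOptimal X ∧ P.Computes I X (p.eval (n + m)) :=
  ⟨_, _, ChoreDivision.mainProg_computes⟩
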